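/- **Setting.** Let $n\ge 1$, $s\in(0,1)$, $\gamma\in(0,1]$, $n\neq 2s$, let $\Omega\subset\mathbb R^n$ be a nonempty bounded open set of class $C^{1,1}$, and let $\delta(x)=\mathrm{dist}(x,\partial\Omega)$. Let $\mathcal G_0$ be a measurable symmetric kernel, defined off the diagonal of $\Omega\times\Omega$, with $$\mathcal G_0(x,y)\asymp \frac1{|x-y|^{n-2s}}\Big(\frac{\delta^\gamma(x)}{|x-y|^\gamma}\wedge1\Big)\Big(\frac{\delta^\gamma(y)}{|x-y|^\gamma}\wedge1\Big),$$ and put $\mathbb G_0(f)(x)=\int_\Omega\mathcal G_0(x,y)f(y)\,dy$ (so $\mathbb G_0=\mathcal L^{-1}$). Let $0<\lambda_1\le\lambda_2\le\cdots$ be the eigenvalues of $\mathcal L$, repeated according to multiplicity, and $(\varphi_j)_{j\ge1}$ a corresponding orthonormal basis of $L^2(\Omega)$ with $\varphi_j=\lambda_j\mathbb G_0(\varphi_j)$; write $\Sigma=\{\lambda_j\}$. For $\lambda\in\mathbb R\setminus\Sigma$ let $$I=\min\{j:\lambda_j\ge\lambda,\ \lambda_{j+1}>\lambda_j\},\qquad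 \bar\lambda=\lambda_{I+1},\qquad \mathbb G_\lambda(\psi)=\sum_{j\ge1}\frac{\langle\psi,\varphi_j\rangle}{\lambda_j-\lambda}\varphi_j\quad(\psi\in L^2(\Omega)).$$ For a weight $w>0$ let $L^1(\Omega;w)=\{f: fw\in L^1(\Omega)\}$, and let $\widetilde{E^\perp}=\{f\in L^1(\Omega;\delta^\gamma):\int_\Omega f\varphi_j=0\text{ for }1\le j\le I\}$. For $f\in L^1(\Omega;\delta^\gamma)$, a $\mathbb G_\lambda(\delta^\gamma L^\infty(\Omega))$-weak solution of $\mathcal Lu-\lambda u=f$ with zero boundary datum is a function $u\in L^1(\Omega;\delta^\gamma)$ such that $\int_\Omega u\psi=\int_\Omega f\,\mathbb G_\lambda(\psi)$ for all $\psi\in\delta^\gamma L^\infty(\Omega)$. **Theorem (uniform estimate for low integrability data).** Let $m\in\mathbb R$. Let $\lambda\in\mathbb R\setminus\Sigma$ with $\lambda\ge -m$, let $f^\perp\in\widetilde{E^\perp}$, and let $u^\perp$ be a $\mathbb G_\lambda(\delta^\gamma L^\infty(\Omega))$-weak solution of $\mathcal Lu^\perp-\lambda u^\perp=f^\perp$ with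 zero boundary datum. Then $u^\perp\in\widetilde{E^\perp}$, and the following hold, with constants that depend on $\lambda$ only through $\bar\lambda$ (for given $m$ and a given operator $\mathcal L$ on $\Omega$); in particular they do not depend on $\mathrm{dist}(\lambda,\Sigma)$. 1. For every $\alpha>-1-\gamma$: if $f^\perp\in L^1(\Omega;\mathbb G_0(\delta^\alpha))$, then $u^\perp\in L^1(\Omega;\delta^\alpha)$ and $$\|u^\perp\delta^\alpha\|_{L^1(\Omega)}\le C(\bar\lambda,m)\,\|f^\perp\,\mathbb G_0(\delta^\alpha)\|_{L^1(\Omega)}.$$ 2. For every $p\in[1,\frac n{n-2s})$: if $f^\perp\in L^1(\Omega)$, then $u^\perp\in L^p(\Omega)$ and $\|u^\perp\|_{L^p(\Omega)}\le C(p,\bar\lambda,m)\|f^\perp\|_{L^1(\Omega)}$. 3. For every $p_0\in(1,\frac n{2s})$ and $\frac1{p_1}=\frac1{p_0}-\frac{2s}n$: if $f^\perp\in L^{p_0}(\Omega)$, then $u^\perp\in L^{p_1}(\Omega)$ and $\|u^\perp\|_{L^{p_1}(\Omega)}\le C(p_0,\bar\lambda,m)\|f^\perp\|_{L^{p_0}(\Omega)}$.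 4. If $\gamma<2s$, then for every $p\in[1,\frac n{n-2s+\gamma})$: $u^\perp\in L^p(\Omega)$ and $\|u^\perp\|_{L^p(\Omega)}\le C(p,\bar\lambda,m)\|f^\perp\delta^\gamma\|_{L^1(\Omega)}$. (The intervals in 2 and 3 are empty if $n<2s$. The lower bound $\lambda\ge-m$ matters only for negative $\lambda$.) -/

import Mathlib

open MeasureTheory Set

noncomputable section

/-- Bounded nonempty open sets of class `C^{1,1}`: near each boundary point `z` and in suitable
Euclidean coordinates (with inner direction `ν`), the set is the strict epigraph of a `C^1` function
with Lipschitz gradient of the coordinates orthogonal to `ν`. -/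
structure IsBoundedC11 {n : ℕ} (Ω : Set (EuclideanSpace ℝ (Fin n))) : Prop where
  isOpen : IsOpen Ω
  nonempty : Ω.Nonempty
  bounded : Bornology.IsBounded Ω
  chart : ∀ z ∈ frontier Ω, ∃ r : ℝ, 0 < r ∧ ∃ ν : EuclideanSpace ℝ (Fin n), ‖ν‖ = 1 ∧
    ∃ h : EuclideanSpace ℝ (Fin n) → ℝ, ContDiff ℝ 1 h ∧ (∃ L, LipschitzWith L (fderiv ℝ h)) ∧
      ∀ x ∈ Metric.ball z r,
        (x ∈ Ω ↔ h (x - z - (inner ℝ (x - z) ν : ℝ) • ν) < (inner ℝ (x - z) ν : ℝ))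

/-- The distance to the boundary of `Ω`. -/
def bdist {n : ℕ} (Ω : Set (EuclideanSpace ℝ (Fin n))) (x : EuclideanSpace ℝ (Fin n)) : ℝ :=
  Metric.infDist x (frontier Ω)

/-- The two-sided model for the Green function of an operator of order `2 s` with boundary
exponent `γ`. -/
def modelKernel {n : ℕ} (Ω : Set (EuclideanSpace ℝ (Fin n))) (s γ : ℝ)
    (x y : EuclideanSpace ℝ (Fin n)) : ℝ :=
  1 / ‖x - y‖ ^ ((n : ℝ) - 2 * s) *
    min (bdist Ω x ^ γ / ‖x - y‖ ^ γ) 1 * min (bdist Ω y ^ γ / ‖x - y‖ ^ γ) 1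

/-- The Green function `G` (whose values matter only off the diagonal of `Ω × Ω`) is symmetric and
comparable to the model kernel; in particular it is positive. -/
structure IsGreenFunction {n : ℕ} (Ω : Set (EuclideanSpace ℝ (Fin n))) (s γ : ℝ)
    (G : EuclideanSpace ℝ (Fin n) → EuclideanSpace ℝ (Fin n) → ℝ) : Prop where
  aemeasurable : AEMeasurable (Function.uncurry G)
    ((volume.restrict Ω).prod (volume.restrict Ω))
  symm : ∀ x ∈ Ω, ∀ y ∈ Ω, x ≠ y → G x y = G y x
  comparable : ∃ c : ℝ, 0 < c ∧ ∀ x ∈ Ω, ∀ y ∈ Ω, x ≠ y →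
    c⁻¹ * modelKernel Ω s γ x y ≤ G x y ∧ G x y ≤ c * modelKernel Ω s γ x y

/-- The Green operator `𝔾₀ f (x) = ∫_Ω G(x,y) f(y) dy`. -/
def greenOp {n : ℕ} (Ω : Set (EuclideanSpace ℝ (Fin n)))
    (G : EuclideanSpace ℝ (Fin n) → EuclideanSpace ℝ (Fin n) → ℝ)
    (f : EuclideanSpace ℝ (Fin n) → ℝ) (x : EuclideanSpace ℝ (Fin n)) : ℝ :=
  ∫ y in Ω, G x y * f y

/-- The real Hilbert space `L²(Ω)`. -/
abbrev L2 {n : ℕ} (Ω : Set (EuclideanSpace ℝ (Fin n))) : Type :=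
  Lp ℝ 2 ((volume : Measure (EuclideanSpace ℝ (Fin n))).restrict Ω)

/-- `ev` is the nondecreasing sequence of (positive) eigenvalues of the operator with Green function
`G`, repeated according to multiplicity, and the orthonormal basis `φ` of `L²(Ω)` consists of
corresponding eigenfunctions: `φ_j = ev_j 𝔾₀ φ_j`. The first index is `0`. -/
structure IsEigenbasis {n : ℕ} (Ω : Set (EuclideanSpace ℝ (Fin n)))
    (G : EuclideanSpace ℝ (Fin n) → EuclideanSpace ℝ (Fin n) → ℝ)
    (ev : ℕ → ℝ) (φ : HilbertBasis ℕ ℝ (L2 Ω)) : Prop where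
  pos : ∀ j, 0 < ev j
  mono : Monotone ev
  eigen : ∀ j, ∀ᵐ x ∂(volume.restrict Ω), (φ j : L2 Ω) x = ev j * greenOp Ω G (φ j : L2 Ω) x

/-- `I` is the least index with `lam ≤ ev I < ev (I + 1)`. -/
def IsCutIndex (ev : ℕ → ℝ) (lam : ℝ) (I : ℕ) : Prop :=
  IsLeast {j : ℕ | lam ≤ ev j ∧ ev j < ev (j + 1)} I

/-- The solution operator on `L²(Ω)`: `𝔾_lam ψ = ∑_j ⟨ψ, φ_j⟩ / (ev_j - lam) φ_j`. -/
def helmholtzOp {n : ℕ} {Ω : Set (EuclideanSpace ℝ (Fin n))} (ev : ℕ → ℝ)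
    (φ : HilbertBasis ℕ ℝ (L2 Ω)) (lam : ℝ) (ψ : L2 Ω) : L2 Ω :=
  ∑' j, ((inner ℝ (φ j) ψ : ℝ) / (ev j - lam)) • (φ j : L2 Ω)

/-- Membership in the weighted space `L¹(Ω; w)`. -/
def MemWeightedL1 {n : ℕ} (Ω : Set (EuclideanSpace ℝ (Fin n)))
    (w f : EuclideanSpace ℝ (Fin n) → ℝ) : Prop :=
  Integrable (fun x => f x * w x) (volume.restrict Ω)

/-- The functions of `L¹(Ω; δ^γ)` orthogonal to the eigenfunctions `φ_0, …, φ_I`. -/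
def MemPerp {n : ℕ} (Ω : Set (EuclideanSpace ℝ (Fin n))) (γ : ℝ)
    (φ : HilbertBasis ℕ ℝ (L2 Ω)) (I : ℕ) (f : EuclideanSpace ℝ (Fin n) → ℝ) : Prop :=
  MemWeightedL1 Ω (fun x => bdist Ω x ^ γ) f ∧
    ∀ j ≤ I, ∫ x in Ω, f x * (φ j : L2 Ω) x = 0

/-- `u` is a `𝔾_lam(δ^γ L^∞(Ω))`-weak solution of `ℒ u - lam u = f` with zero boundary datum. Since
`Ω` is bounded and `γ > 0`, the test space `δ^γ L^∞(Ω)` is a subspace of `L²(Ω)`. -/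
def IsWeakSolution {n : ℕ} (Ω : Set (EuclideanSpace ℝ (Fin n))) (γ : ℝ) (ev : ℕ → ℝ)
    (φ : HilbertBasis ℕ ℝ (L2 Ω)) (lam : ℝ) (f u : EuclideanSpace ℝ (Fin n) → ℝ) : Prop :=
  MemWeightedL1 Ω (fun x => bdist Ω x ^ γ) f ∧
  MemWeightedL1 Ω (fun x => bdist Ω x ^ γ) u ∧
  ∀ ψ : L2 Ω, (∃ M : ℝ, ∀ᵐ x ∂(volume.restrict Ω), |ψ x| ≤ M * bdist Ω x ^ γ) →
    ∫ x in Ω, u x * ψ x = ∫ x in Ω, f x * helmholtzOp ev φ lam ψ x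

end

/-!
The identity `1 / (e - t) = ∑_{i < M} t ^ i / e ^ (i + 1) + t ^ M / (e ^ M (e - t))` expresses
`𝔾_lam` through finitely many powers of `𝔾₀` and a copy of `𝔾_lam` between two high powers of `𝔾₀`.
On the modes above `I`, the only ones seen by functions orthogonal to `φ_0, …, φ_I`, the factor
`1 / (ev_j - lam)` is bounded in terms of the gap between `ev_I` and `ev_{I+1}`. A quasi-metric (3G)
inequality shows that the kernels of all powers of `𝔾₀` are dominated by the model kernel, and that
the kernel of a high power is even dominated by `δ(x)^γ δ(y)^γ`, which lies below the model kernel.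
Sandwiching an `L²`-bounded operator between two such powers preserves the latter bound, so `𝔾_lam`
is dominated by the model kernel on the relevant modes, and duality gives `|u| ≤ C 𝔾₀ |f|` with `C`
independent of `lam`.

The estimates are then those of `𝔾₀`: the symmetry of the kernel for the weighted one, Schur's test
and the Hardy–Littlewood–Sobolev inequality for the others. The case `n < 2 s` does not occur: the
kernel would vanish on the diagonal, and `𝔾₀` would not be positive.
-/

open Module (finrank)
open scoped ENNReal NNReal Topology

section LayerCake

variable {α β : Type*} [MeasurableSpace α] [MeasurableSpace β] {μ : Measure α} {ν : Measure β}

lemma setLIntegral_Ioo_rpow_sub_one {e X : ℝ} (he : 0 < e) (hX : 0 ≤ X) :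
    ∫⁻ t in Ioo 0 X, ENNReal.ofReal (t ^ (e - 1)) = ENNReal.ofReal (X ^ e / e) := by
  have hint : IntegrableOn (fun t : ℝ => t ^ (e - 1)) (Ioo 0 X) := by
    rcases hX.eq_or_lt with h | h
    · simp [← h]
    · exact (intervalIntegral.integrableOn_Ioo_rpow_iff h).2 (by linarith)
  rw [← ofReal_integral_eq_lintegral_ofReal hint
    ((ae_restrict_iff' measurableSet_Ioo).2 (ae_of_all _ fun t ht => Real.rpow_nonneg ht.1.le _)),
    ← integral_Ioc_eq_integral_Ioo, ← intervalIntegral.integral_of_le hX,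
    integral_rpow (Or.inl (by linarith))]
  simp [Real.zero_rpow he.ne']

lemma setLIntegral_Ioi_rpow_eq_top (e : ℝ) :
    ∫⁻ t in Ioi (0 : ℝ), ENNReal.ofReal (t ^ e) = ∞ := by
  by_contra hfin
  refine not_integrableOn_Ioi_rpow e ⟨by fun_prop, ?_⟩
  have hnonneg : 0 ≤ᵐ[volume.restrict (Ioi 0)] fun t : ℝ => t ^ e :=
    (ae_restrict_iff' measurableSet_Ioi).2
      (ae_of_all _ fun t (ht : 0 < t) => Real.rpow_nonneg ht.le _)
  exact (hasFiniteIntegral_iff_ofReal hnonneg).2 (lt_top_iff_ne_top.2 hfin)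

lemma lintegral_Ioi_indicator_lt_rpow_sub_one {e : ℝ} (he : 0 < e) (X : ℝ≥0∞) :
    ∫⁻ t in Ioi 0, {t | ENNReal.ofReal t < X}.indicator (fun t => ENNReal.ofReal (t ^ (e - 1))) t =
      X ^ e / ENNReal.ofReal e := by
  have hmeas : MeasurableSet {t | ENNReal.ofReal t < X} :=
    measurableSet_lt ENNReal.measurable_ofReal measurable_const
  rw [setLIntegral_indicator hmeas]
  induction X with
  | top =>
    rw [show {t : ℝ | ENNReal.ofReal t < ∞} = univ by ext; simp, univ_inter,
      setLIntegral_Ioi_rpow_eq_top, ENNReal.top_rpow_of_pos he,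
      ENNReal.top_div_of_ne_top ENNReal.ofReal_ne_top]
  | coe X =>
    have hIoo : {t : ℝ | ENNReal.ofReal t < X} ∩ Ioi 0 = Ioo 0 (X : ℝ) := by
      ext t
      simp only [mem_inter_iff, mem_ofPred_eq, mem_Ioi, mem_Ioo, and_comm (a := 0 < t)]
      refine and_congr_left fun ht => ?_
      rw [← ENNReal.ofReal_coe_nnreal, ENNReal.ofReal_lt_ofReal_iff_of_nonneg ht.le]
    rw [hIoo, setLIntegral_Ioo_rpow_sub_one he X.coe_nonneg, ENNReal.ofReal_div_of_pos he,
      ← ENNReal.ofReal_rpow_of_nonneg X.coe_nonneg he.le, ENNReal.ofReal_coe_nnreal]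

lemma lintegral_Ioi_rpow_mul_setLIntegral_lt [SFinite ν] {f g : β → ℝ≥0∞} (hf : Measurable f)
    (hg : Measurable g) {e : ℝ} (he : 0 < e) :
    ∫⁻ t in Ioi 0, ENNReal.ofReal (t ^ (e - 1)) * ∫⁻ y in {y | ENNReal.ofReal t < f y}, g y ∂ν =
      ∫⁻ y, g y * (f y ^ e / ENNReal.ofReal e) ∂ν := by
  set k : ℝ → β → ℝ≥0∞ := fun t y =>
    g y * {t | ENNReal.ofReal t < f y}.indicator (fun t => ENNReal.ofReal (t ^ (e - 1))) t
  have hk : Measurable (Function.uncurry k) := by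
    refine (hg.comp measurable_snd).mul ?_
    exact Measurable.indicator (f := fun z : ℝ × β => ENNReal.ofReal (z.1 ^ (e - 1)))
      (s := {z | ENNReal.ofReal z.1 < f z.2}) (by fun_prop)
      (measurableSet_lt (by fun_prop) (hf.comp measurable_snd))
  calc _ = ∫⁻ t in Ioi 0, ∫⁻ y, k t y ∂ν := by
        refine lintegral_congr fun t => ?_
        rw [← lintegral_const_mul' _ _ ENNReal.ofReal_ne_top,
          ← lintegral_indicator (measurableSet_lt measurable_const hf)]
        refine lintegral_congr fun y => ?_
        by_cases h : ENNReal.ofReal t < f y <;> simp [k, indicator, h, mul_comm]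
    _ = ∫⁻ y, (∫⁻ t in Ioi 0, k t y) ∂ν := lintegral_lintegral_swap hk.aemeasurable
    _ = _ := by
        refine lintegral_congr fun y => ?_
        rw [← lintegral_Ioi_indicator_lt_rpow_sub_one he, lintegral_const_mul]
        exact Measurable.indicator (by fun_prop)
          (measurableSet_lt ENNReal.measurable_ofReal measurable_const)

/-- Doob's maximal inequality in abstract form: a distributional estimate of weak type `(1, 1)`, in
which only the large values of `f` enter, self-improves to a strong bound. -/
theorem lintegral_rpow_le_of_forall_meas_lt_le [SFinite μ] [SFinite ν] {F : α → ℝ≥0∞}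
    {f : β → ℝ≥0∞} (hF : Measurable F) (hf : Measurable f) {p : ℝ} (hp : 1 < p)
    (h : ∀ t : ℝ, 0 < t → μ {x | ENNReal.ofReal t < F x} ≤
      (∫⁻ y in {y | ENNReal.ofReal t < f y}, f y ∂ν) / ENNReal.ofReal t) :
    ∫⁻ x, F x ^ p ∂μ ≤ ENNReal.ofReal (p / (p - 1)) * ∫⁻ y, f y ^ p ∂ν := by
  have hp0 : 0 < p := by linarith
  have hp1 : 0 < p - 1 := by linarith
  have hpow : ∀ y, f y * (f y ^ (p - 1) / ENNReal.ofReal (p - 1)) =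
      (ENNReal.ofReal (p - 1))⁻¹ * f y ^ p := fun y => by
    nth_rw 1 [← ENNReal.rpow_one (f y)]
    rw [← mul_div_assoc, ← ENNReal.rpow_add_of_nonneg _ _ zero_le_one hp1.le,
      add_sub_cancel, ENNReal.div_eq_inv_mul]
  calc ∫⁻ x, F x ^ p ∂μ
      = ENNReal.ofReal p * ∫⁻ x, 1 * (F x ^ p / ENNReal.ofReal p) ∂μ := by
        rw [← lintegral_const_mul' _ _ ENNReal.ofReal_ne_top]
        refine lintegral_congr fun x => ?_
        rw [one_mul, ENNReal.mul_div_cancel (by simpa using hp0) ENNReal.ofReal_ne_top]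
    _ = ENNReal.ofReal p *
        ∫⁻ t in Ioi 0, ENNReal.ofReal (t ^ (p - 1)) * μ {x | ENNReal.ofReal t < F x} := by
        rw [← lintegral_Ioi_rpow_mul_setLIntegral_lt hF measurable_const hp0]
        simp only [setLIntegral_one]
    _ ≤ ENNReal.ofReal p * ∫⁻ t in Ioi 0, ENNReal.ofReal (t ^ (p - 1 - 1)) *
          ∫⁻ y in {y | ENNReal.ofReal t < f y}, f y ∂ν := by
        gcongr 1
        refine setLIntegral_mono' measurableSet_Ioi fun t (ht : 0 < t) => ?_
        refine (mul_le_mul_right (h t ht) _).trans_eq ?_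
        rw [Real.rpow_sub_one ht.ne' (p - 1), ENNReal.ofReal_div_of_pos ht, ENNReal.div_eq_inv_mul,
          ENNReal.div_eq_inv_mul]
        ring
    _ = ENNReal.ofReal (p / (p - 1)) * ∫⁻ y, f y ^ p ∂ν := by
        rw [lintegral_Ioi_rpow_mul_setLIntegral_lt hf hf hp1]
        simp only [hpow]
        rw [lintegral_const_mul _ (hf.pow_const p), ← mul_assoc, ENNReal.ofReal_div_of_pos hp1,
          ENNReal.div_eq_inv_mul, mul_comm (ENNReal.ofReal p)]

lemma eLpNorm_ofReal_eq_lintegral {r : ℝ} (hr : 0 < r) (f : α → ℝ≥0∞) :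
    eLpNorm f (ENNReal.ofReal r) μ = (∫⁻ x, f x ^ r ∂μ) ^ (1 / r) := by
  simp [eLpNorm_eq_lintegral_rpow_enorm_toReal, hr, hr.le]

end LayerCake

section RieszPotential

variable {E : Type*} [NormedAddCommGroup E] [MeasurableSpace E] (μ : Measure E)

lemma setLIntegral_ball_sub_mul [OpensMeasurableSpace E] (κ g : E → ℝ≥0∞) (x : E) (R : ℝ) :
    ∫⁻ y in Metric.ball x R, κ (x - y) * g y ∂μ =
      ∫⁻ y, (Metric.ball 0 R).indicator κ (x - y) * g y ∂μ := by
  rw [← lintegral_indicator Metric.isOpen_ball.measurableSet]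
  refine lintegral_congr fun y => ?_
  by_cases h : ‖x - y‖ < R <;> simp [indicator, h, dist_eq_norm, norm_sub_rev y]

variable [NormedSpace ℝ E]

/-- The Riesz potential of order `σ` with respect to the measure `μ`. The dimensional constant that
makes it the inverse of a fractional Laplacian is omitted. -/
noncomputable def rieszPotential (σ : ℝ) (f : E → ℝ≥0∞) (x : E) : ℝ≥0∞ :=
  ∫⁻ y, ENNReal.ofReal (‖x - y‖ ^ (σ - finrank ℝ E)) * f y ∂μ

lemma rieszPotential_const_mul {c : ℝ≥0∞} (hc : c ≠ ∞) (σ : ℝ) (f : E → ℝ≥0∞) (x : E) :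
    rieszPotential μ σ (fun y => c * f y) x = c * rieszPotential μ σ f x := by
  simp only [rieszPotential, mul_left_comm _ c, lintegral_const_mul' c _ hc]

variable {μ} in
lemma rieszPotential_congr_ae {f g : E → ℝ≥0∞} (h : f =ᵐ[μ] g) (σ : ℝ) :
    rieszPotential μ σ f = rieszPotential μ σ g :=
  funext fun _ => lintegral_congr_ae (h.mono fun y hy => by simp only [hy])

variable [BorelSpace E]

lemma rieszPotential_le_add {f : E → ℝ≥0∞} (σ R t : ℝ) (x : E) :
    rieszPotential μ σ f x ≤
      ∫⁻ y in (Metric.ball x R)ᶜ, ENNReal.ofReal (‖x - y‖ ^ (σ - finrank ℝ E)) * f y ∂μ +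
      ((∫⁻ y in Metric.ball x R, ENNReal.ofReal (‖x - y‖ ^ (σ - finrank ℝ E)) ∂μ) *
          ENNReal.ofReal t +
        ∫⁻ y in Metric.ball x R, ENNReal.ofReal (‖x - y‖ ^ (σ - finrank ℝ E)) *
          {y | ENNReal.ofReal t < f y}.indicator f y ∂μ) := by
  have hker : Measurable fun y => ENNReal.ofReal (‖x - y‖ ^ (σ - finrank ℝ E)) := by fun_prop
  have hf_le : ∀ y, f y ≤ ENNReal.ofReal t + {y | ENNReal.ofReal t < f y}.indicator f y := by
    intro y
    by_cases hy : ENNReal.ofReal t < f y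
    · simp [hy]
    · simpa [hy] using not_lt.1 hy
  rw [rieszPotential, ← lintegral_add_compl _ Metric.isOpen_ball.measurableSet, add_comm,
    ← lintegral_mul_const _ hker, ← lintegral_add_left (hker.mul_const _)]
  gcongr with y
  rw [← mul_add]
  gcongr
  exact hf_le y

variable [FiniteDimensional ℝ E]

lemma measurable_rieszPotential [SFinite μ] (σ : ℝ) {f : E → ℝ≥0∞} (hf : Measurable f) :
    Measurable (rieszPotential μ σ f) := by
  have hker : Measurable (Function.uncurry fun x y : E =>
      ENNReal.ofReal (‖x - y‖ ^ (σ - finrank ℝ E)) * f y) :=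
    Measurable.mul (by fun_prop) (hf.comp measurable_snd)
  exact hker.lintegral_prod_right

variable [μ.IsAddHaarMeasure]

lemma lintegral_comp_smul_of_pos {R : ℝ} (hR : 0 < R) (g : E → ℝ≥0∞) :
    ∫⁻ z, g z ∂μ = ENNReal.ofReal (R ^ (finrank ℝ E : ℝ)) * ∫⁻ z, g (R • z) ∂μ := by
  have hmap : ∫⁻ z, g (R • z) ∂μ = ∫⁻ z, g z ∂(μ.map (R • ·)) :=
    (lintegral_map_equiv g (MeasurableEquiv.smul₀ R hR.ne')).symm
  rw [hmap, Measure.map_addHaar_smul μ hR.ne', lintegral_smul_measure, smul_eq_mul, ← mul_assoc,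
    ← ENNReal.ofReal_mul (by positivity), abs_of_pos (by positivity), Real.rpow_natCast,
    mul_inv_cancel₀ (by positivity), ENNReal.ofReal_one, one_mul]

open scoped Pointwise in
lemma setLIntegral_smul_norm_rpow {R : ℝ} (hR : 0 < R) {S : Set E} (hS : MeasurableSet S) (β : ℝ) :
    ∫⁻ z in R • S, ENNReal.ofReal (‖z‖ ^ β) ∂μ =
      ENNReal.ofReal (R ^ (finrank ℝ E + β)) * ∫⁻ z in S, ENNReal.ofReal (‖z‖ ^ β) ∂μ := by
  have hscale : ∀ z : E, (R • S).indicator (fun z => ENNReal.ofReal (‖z‖ ^ β)) (R • z) =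
      ENNReal.ofReal (R ^ β) * S.indicator (fun z => ENNReal.ofReal (‖z‖ ^ β)) z := by
    intro z
    have hmem : R • z ∈ R • S ↔ z ∈ S := smul_mem_smul_set_iff₀ hR.ne' S z
    by_cases hz : z ∈ S
    · rw [indicator_of_mem hz, indicator_of_mem (hmem.2 hz), norm_smul, Real.norm_of_nonneg hR.le,
        Real.mul_rpow hR.le (norm_nonneg z), ENNReal.ofReal_mul (Real.rpow_nonneg hR.le β)]
    · rw [indicator_of_notMem hz, indicator_of_notMem (mt hmem.1 hz), mul_zero]
  rw [← lintegral_indicator (hS.const_smul₀ R), lintegral_comp_smul_of_pos μ hR,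
    lintegral_congr hscale, lintegral_const_mul' _ _ ENNReal.ofReal_ne_top, lintegral_indicator hS,
    ← mul_assoc, ← ENNReal.ofReal_mul (by positivity), ← Real.rpow_add hR]

open scoped Pointwise in
lemma exists_setLIntegral_smul_norm_rpow_le {S : Set E} (hS : MeasurableSet S) {β : ℝ}
    (hfin : ∫⁻ z in S, ENNReal.ofReal (‖z‖ ^ β) ∂μ ≠ ∞) :
    ∃ C : ℝ, 0 < C ∧ ∀ R : ℝ, 0 < R →
      ∫⁻ z in R • S, ENNReal.ofReal (‖z‖ ^ β) ∂μ ≤ ENNReal.ofReal (C * R ^ (finrank ℝ E + β)) := by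
  refine ⟨(∫⁻ z in S, ENNReal.ofReal (‖z‖ ^ β) ∂μ).toReal + 1, by positivity, fun R hR => ?_⟩
  rw [setLIntegral_smul_norm_rpow μ hR hS, mul_comm, ENNReal.ofReal_mul (by positivity)]
  gcongr
  rw [← ENNReal.ofReal_toReal hfin]
  exact ENNReal.ofReal_le_ofReal (by simp)

lemma exists_setLIntegral_ball_norm_rpow_le [Nontrivial E] {β : ℝ} (hβ : -finrank ℝ E < β) :
    ∃ C : ℝ, 0 < C ∧ ∀ R : ℝ, 0 < R → ∫⁻ z in Metric.ball (0 : E) R, ENNReal.ofReal (‖z‖ ^ β) ∂μ ≤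
      ENNReal.ofReal (C * R ^ (finrank ℝ E + β)) := by
  have hint : IntegrableOn (fun z : E => ‖z‖ ^ β) (Metric.ball 0 1) μ :=
    integrableOn_ball_of_norm_le_rpow (C := 1) (α := -β) Module.finrank_pos (by linarith)
      (ae_of_all _ fun z => by simp [Real.abs_rpow_of_nonneg])
      (Measurable.aestronglyMeasurable (by fun_prop))
  obtain ⟨C, hC, h⟩ := exists_setLIntegral_smul_norm_rpow_le μ Metric.isOpen_ball.measurableSet
    hint.lintegral_lt_top.ne
  refine ⟨C, hC, fun R hR => ?_⟩
  simpa [smul_ball hR.ne', abs_of_pos hR] using h R hR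

lemma exists_setLIntegral_compl_ball_norm_rpow_le {β : ℝ} (hβ : β < -finrank ℝ E) :
    ∃ C : ℝ, 0 < C ∧ ∀ R : ℝ, 0 < R →
      ∫⁻ z in (Metric.ball (0 : E) R)ᶜ, ENNReal.ofReal (‖z‖ ^ β) ∂μ ≤
        ENNReal.ofReal (C * R ^ (finrank ℝ E + β)) := by
  have hβ0 : β ≤ 0 := hβ.le.trans (neg_nonpos.2 (Nat.cast_nonneg _))
  have hmeas : MeasurableSet (Metric.ball (0 : E) 1)ᶜ := Metric.isOpen_ball.measurableSet.compl
  have hint : Integrable (fun z : E => (1 + ‖z‖) ^ (- -β) / 2 ^ β) μ :=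
    (integrable_one_add_norm (by linarith)).div_const _
  have hfin : ∫⁻ z in (Metric.ball (0 : E) 1)ᶜ, ENNReal.ofReal (‖z‖ ^ β) ∂μ ≠ ∞ := by
    refine ((setLIntegral_mono' hmeas fun z hz => ENNReal.ofReal_le_ofReal ?_).trans
      (setLIntegral_le_lintegral _ _)).trans_lt hint.lintegral_lt_top |>.ne
    have hz1 : 1 ≤ ‖z‖ := by simpa using hz
    rw [neg_neg, ← Real.div_rpow (by positivity) zero_le_two]
    exact Real.rpow_le_rpow_of_nonpos (by positivity) (by linarith) hβ0
  obtain ⟨C, hC, h⟩ := exists_setLIntegral_smul_norm_rpow_le μ hmeas hfin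
  refine ⟨C, hC, fun R hR => ?_⟩
  simpa [compl_eq_univ_sdiff, smul_set_sdiff₀ hR.ne', smul_set_univ₀ hR.ne', smul_ball hR.ne',
    abs_of_pos hR] using h R hR

lemma setLIntegral_preimage_sub_left (x : E) (S : Set E) (g : E → ℝ≥0∞) :
    ∫⁻ y in (x - ·) ⁻¹' S, g (x - y) ∂μ = ∫⁻ z in S, g z ∂μ :=
  (Measure.measurePreserving_sub_left μ x).setLIntegral_comp_preimage_emb
    (MeasurableEquiv.subLeft x).measurableEmbedding g S

lemma exists_setLIntegral_ball_norm_sub_rpow_le [Nontrivial E] {β : ℝ} (hβ : -finrank ℝ E < β) :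
    ∃ C : ℝ, 0 < C ∧ ∀ R : ℝ, 0 < R → ∀ x : E,
      ∫⁻ y in Metric.ball x R, ENNReal.ofReal (‖x - y‖ ^ β) ∂μ ≤
        ENNReal.ofReal (C * R ^ (finrank ℝ E + β)) := by
  obtain ⟨C, hC, h⟩ := exists_setLIntegral_ball_norm_rpow_le μ hβ
  refine ⟨C, hC, fun R hR x => (h R hR).trans_eq' ?_⟩
  rw [← setLIntegral_preimage_sub_left μ x]
  congr 3
  ext y
  simp [dist_eq_norm, norm_sub_rev y]

lemma exists_setLIntegral_compl_ball_mul_le {σ p : ℝ} (hp : 1 < p) (hpσ : p * σ < finrank ℝ E) :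
    ∃ C : ℝ, 0 < C ∧ ∀ R : ℝ, 0 < R → ∀ (x : E) (f : E → ℝ≥0∞), Measurable f →
      ∫⁻ y in (Metric.ball x R)ᶜ, ENNReal.ofReal (‖x - y‖ ^ (σ - finrank ℝ E)) * f y ∂μ ≤
        ENNReal.ofReal (C * R ^ (σ - finrank ℝ E / p)) * (∫⁻ y, f y ^ p ∂μ) ^ (1 / p) := by
  have : 0 < p := by linarith
  set q := p / (p - 1) with hq
  have hpq : q.HolderConjugate p := (Real.HolderConjugate.conjExponent hp).symm
  have hqinv : 1 / q = 1 - 1 / p := by rw [hq]; field_simp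
  have hβ : (σ - finrank ℝ E) * q < -finrank ℝ E := by
    rw [hq, mul_div_assoc', div_lt_iff₀ (by linarith)]
    linarith
  obtain ⟨K, hK, hfar⟩ := exists_setLIntegral_compl_ball_norm_rpow_le μ hβ
  refine ⟨K ^ (1 / q), by positivity, fun R hR x f hf => ?_⟩
  have hkernel : ∫⁻ y in (Metric.ball x R)ᶜ, ENNReal.ofReal (‖x - y‖ ^ (σ - finrank ℝ E)) ^ q ∂μ ≤
      ENNReal.ofReal (K * R ^ (finrank ℝ E + (σ - finrank ℝ E) * q)) := by
    refine (hfar R hR).trans_eq' ?_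
    rw [← setLIntegral_preimage_sub_left μ x, preimage_compl,
      show (x - ·) ⁻¹' Metric.ball (0 : E) R = Metric.ball x R by
        ext y; simp [dist_eq_norm, norm_sub_rev y]]
    refine lintegral_congr fun y => ?_
    rw [ENNReal.ofReal_rpow_of_nonneg (by positivity) hpq.nonneg, ← Real.rpow_mul (norm_nonneg _)]
  have hexp : (finrank ℝ E + (σ - finrank ℝ E) * q) * (1 / q) = σ - finrank ℝ E / p := by
    rw [add_mul, mul_assoc, mul_one_div_cancel hpq.ne_zero, hqinv]
    ring
  calc _ ≤ (∫⁻ y in (Metric.ball x R)ᶜ,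
          ENNReal.ofReal (‖x - y‖ ^ (σ - finrank ℝ E)) ^ q ∂μ) ^ (1 / q) *
        (∫⁻ y in (Metric.ball x R)ᶜ, f y ^ p ∂μ) ^ (1 / p) :=
        ENNReal.lintegral_mul_le_Lp_mul_Lq _ hpq
          (Measurable.aemeasurable (by fun_prop)) hf.aemeasurable
    _ ≤ ENNReal.ofReal (K * R ^ (finrank ℝ E + (σ - finrank ℝ E) * q)) ^ (1 / q) *
        (∫⁻ y, f y ^ p ∂μ) ^ (1 / p) := by
        gcongr
        exact Measure.restrict_le_self
    _ = _ := by
        have hq0 := hpq.one_div_nonneg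
        rw [ENNReal.ofReal_rpow_of_nonneg (by positivity) hq0,
          Real.mul_rpow hK.le (by positivity), ← Real.rpow_mul hR.le, hexp]

lemma lintegral_lintegral_sub_mul {k g : E → ℝ≥0∞} (hk : Measurable k) (hg : Measurable g) :
    ∫⁻ x, ∫⁻ y, k (x - y) * g y ∂μ ∂μ = (∫⁻ z, k z ∂μ) * ∫⁻ y, g y ∂μ := by
  rw [lintegral_lintegral_swap
    ((hk.comp measurable_sub).mul (hg.comp measurable_snd)).aemeasurable,
    ← lintegral_const_mul _ hg]
  refine lintegral_congr fun y => ?_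
  have hky : Measurable fun x => k (x - y) := hk.comp (measurable_id.sub_const y)
  rw [lintegral_mul_const _ hky, lintegral_sub_right_eq_self k y]

/-- At the radius `t ^ (-p / d)` the contribution of the far points, estimated by Hölder's
inequality, balances that of the near points at which `f ≤ t`. -/
lemma exists_rieszPotential_le_add_setLIntegral {σ p : ℝ} (hσ : 0 < σ) (hp : 1 < p)
    (hpσ : p * σ < finrank ℝ E) :
    ∃ C : ℝ, 0 < C ∧ ∀ f : E → ℝ≥0∞, Measurable f → ∫⁻ y, f y ^ p ∂μ ≤ 1 → ∀ t : ℝ, 0 < t → ∀ x,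
      rieszPotential μ σ f x ≤ ENNReal.ofReal (C * t ^ (1 - p * σ / finrank ℝ E)) +
        ∫⁻ y in Metric.ball x (t ^ (-(p / finrank ℝ E))),
          ENNReal.ofReal (‖x - y‖ ^ (σ - finrank ℝ E)) *
            {y | ENNReal.ofReal t < f y}.indicator f y ∂μ := by
  have hd : (0 : ℝ) < finrank ℝ E := (by positivity : 0 < p * σ).trans hpσ
  have : Nontrivial E := Module.nontrivial_of_finrank_pos (R := ℝ) (by exact_mod_cast hd)
  obtain ⟨K₁, hK₁, hfar⟩ := exists_setLIntegral_compl_ball_mul_le μ hp hpσ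
  obtain ⟨K₂, hK₂, hnear⟩ := exists_setLIntegral_ball_norm_sub_rpow_le μ
    (β := σ - finrank ℝ E) (by linarith)
  refine ⟨K₁ + K₂, by positivity, fun f hf hf1 t ht x => ?_⟩
  set ρ := 1 - p * σ / finrank ℝ E with hρ
  set R := t ^ (-(p / finrank ℝ E)) with hR
  have hR0 : 0 < R := Real.rpow_pos_of_pos ht _
  have hRfar : R ^ (σ - finrank ℝ E / p) = t ^ ρ := by
    rw [hR, ← Real.rpow_mul ht.le, hρ]
    congr 1
    field_simp
    ring
  have hRnear : R ^ (finrank ℝ E + (σ - finrank ℝ E)) * t = t ^ ρ := by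
    rw [hR, ← Real.rpow_mul ht.le, ← Real.rpow_add_one ht.ne', hρ]
    congr 1
    ring
  refine (rieszPotential_le_add μ σ R t x).trans ?_
  rw [← add_assoc, add_mul, ENNReal.ofReal_add (by positivity) (by positivity)]
  gcongr
  · refine (hfar R hR0 x f hf).trans ?_
    rw [hRfar]
    exact mul_le_of_le_one_right' (ENNReal.rpow_le_one hf1 (by positivity))
  · refine (mul_le_mul_left (hnear R hR0 x) _).trans_eq ?_
    rw [← ENNReal.ofReal_mul (by positivity), mul_assoc, hRnear]

lemma exists_meas_lt_rieszPotential_le {σ p : ℝ} (hσ : 0 < σ) (hp : 1 < p)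
    (hpσ : p * σ < finrank ℝ E) :
    ∃ K : ℝ, 0 < K ∧ ∀ f : E → ℝ≥0∞, Measurable f → ∫⁻ y, f y ^ p ∂μ ≤ 1 → ∀ t : ℝ, 0 < t →
      μ {x | ENNReal.ofReal (K * t ^ (1 - p * σ / finrank ℝ E)) < rieszPotential μ σ f x} ≤
        (∫⁻ y in {y | ENNReal.ofReal t < f y}, f y ∂μ) / ENNReal.ofReal t := by
  have hd : (0 : ℝ) < finrank ℝ E := (by positivity : 0 < p * σ).trans hpσ
  have : Nontrivial E := Module.nontrivial_of_finrank_pos (R := ℝ) (by exact_mod_cast hd)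
  obtain ⟨K₁, hK₁, hsplit⟩ := exists_rieszPotential_le_add_setLIntegral μ hσ hp hpσ
  obtain ⟨K₂, hK₂, hnear⟩ := exists_setLIntegral_ball_norm_rpow_le μ
    (β := σ - finrank ℝ E) (by linarith)
  refine ⟨K₁ + K₂, by positivity, fun f hf hf1 t ht => ?_⟩
  set ρ := 1 - p * σ / finrank ℝ E with hρ
  set R := t ^ (-(p / finrank ℝ E)) with hR
  have hR0 : 0 < R := Real.rpow_pos_of_pos ht _
  have hRt : R ^ (finrank ℝ E + (σ - finrank ℝ E)) * t = t ^ ρ := by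
    rw [hR, ← Real.rpow_mul ht.le, ← Real.rpow_add_one ht.ne', hρ]
    congr 1
    ring
  set S := {y | ENNReal.ofReal t < f y}
  have hS : MeasurableSet S := measurableSet_lt measurable_const hf
  set κ : E → ℝ≥0∞ := fun z => ENNReal.ofReal (‖z‖ ^ (σ - finrank ℝ E))
  set k : E → ℝ≥0∞ := (Metric.ball 0 R).indicator κ
  have hk : Measurable k := Measurable.indicator (by fun_prop) Metric.isOpen_ball.measurableSet
  set h : E → ℝ≥0∞ := fun x => ∫⁻ y, k (x - y) * S.indicator f y ∂μ
  have hh : Measurable h := Measurable.lintegral_prod_right <|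
    (hk.comp measurable_sub).mul ((hf.indicator hS).comp measurable_snd)
  calc μ {x | ENNReal.ofReal ((K₁ + K₂) * t ^ ρ) < rieszPotential μ σ f x}
      ≤ μ {x | ENNReal.ofReal (K₂ * t ^ ρ) ≤ h x} := by
        refine measure_mono fun x hx => mem_ofPred_eq ▸ le_of_lt ?_
        rw [mem_ofPred_eq, add_mul, ENNReal.ofReal_add (by positivity) (by positivity)] at hx
        refine lt_of_add_lt_add_left (hx.trans_le ((hsplit f hf hf1 t ht x).trans_eq ?_))
        rw [setLIntegral_ball_sub_mul μ κ]
    _ ≤ (∫⁻ x, h x ∂μ) / ENNReal.ofReal (K₂ * t ^ ρ) :=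
        meas_ge_le_lintegral_div hh.aemeasurable (by simpa using by positivity)
          ENNReal.ofReal_ne_top
    _ ≤ ENNReal.ofReal (K₂ * R ^ (finrank ℝ E + (σ - finrank ℝ E))) * (∫⁻ y in S, f y ∂μ) /
          ENNReal.ofReal (K₂ * t ^ ρ) := by
        rw [lintegral_lintegral_sub_mul μ hk (hf.indicator hS), lintegral_indicator hS,
          lintegral_indicator Metric.isOpen_ball.measurableSet]
        gcongr
        exact hnear R hR0
    _ = (∫⁻ y in S, f y ∂μ) / ENNReal.ofReal t := by
        rw [← hRt, ← mul_assoc K₂, ENNReal.ofReal_mul (p := K₂ * _) (by positivity)]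
        exact ENNReal.mul_div_mul_left _ _ (by simpa using by positivity) ENNReal.ofReal_ne_top

lemma exists_lintegral_rieszPotential_rpow_le {σ p q : ℝ} (hσ : 0 < σ) (hp : 1 < p)
    (hpσ : p * σ < finrank ℝ E) (hq : 1 / q = 1 / p - σ / finrank ℝ E) :
    ∃ C : ℝ≥0, ∀ f : E → ℝ≥0∞, Measurable f → ∫⁻ y, f y ^ p ∂μ ≤ 1 →
      ∫⁻ x, rieszPotential μ σ f x ^ q ∂μ ≤ C := by
  have : 0 < p := by linarith
  have hd : (0 : ℝ) < finrank ℝ E := (by positivity : 0 < p * σ).trans hpσ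
  obtain ⟨K, hK, hweak⟩ := exists_meas_lt_rieszPotential_le μ hσ hp hpσ
  set ρ := 1 - p * σ / finrank ℝ E with hρ
  have hρ0 : 0 < ρ := sub_pos.2 ((div_lt_one hd).2 hpσ)
  have hqρ : q = ρ⁻¹ * p := by
    rw [← one_div_one_div q, hq, hρ]
    field_simp
  have hq0 : 0 < q := by rw [hqρ]; positivity
  refine ⟨(K ^ q * (p / (p - 1))).toNNReal, fun f hf hf1 => ?_⟩
  have hlevel : ∀ t : ℝ, 0 < t → ∀ x,
      ENNReal.ofReal t < ((ENNReal.ofReal K)⁻¹ * rieszPotential μ σ f x) ^ ρ⁻¹ ↔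
        ENNReal.ofReal (K * t ^ ρ) < rieszPotential μ σ f x := fun t ht x => by
    rw [ENNReal.lt_rpow_inv_iff hρ0, ← ENNReal.div_eq_inv_mul, ENNReal.lt_div_iff_mul_lt
      (by simp [hK]) (by simp), ENNReal.ofReal_rpow_of_pos ht, mul_comm,
      ← ENNReal.ofReal_mul hK.le]
  have hstrong := lintegral_rpow_le_of_forall_meas_lt_le (μ := μ)
    (F := fun x => ((ENNReal.ofReal K)⁻¹ * rieszPotential μ σ f x) ^ ρ⁻¹)
    (((measurable_rieszPotential μ σ hf).const_mul _).pow_const _) hf hp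
    fun t ht => by simpa only [hlevel t ht] using hweak f hf hf1 t ht
  calc ∫⁻ x, rieszPotential μ σ f x ^ q ∂μ
      = ENNReal.ofReal K ^ q *
          ∫⁻ x, (((ENNReal.ofReal K)⁻¹ * rieszPotential μ σ f x) ^ ρ⁻¹) ^ p ∂μ := by
        rw [← lintegral_const_mul' _ _ (by simp [hq0.le])]
        refine lintegral_congr fun x => ?_
        rw [← ENNReal.rpow_mul, ← hqρ, ← ENNReal.mul_rpow_of_nonneg _ _ hq0.le,
          ENNReal.mul_inv_cancel_left (by simpa using hK) ENNReal.ofReal_ne_top]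
    _ ≤ ENNReal.ofReal K ^ q * (ENNReal.ofReal (p / (p - 1)) * 1) := by
        gcongr
        exact hstrong.trans (by gcongr)
    _ = _ := by
        rw [mul_one, ENNReal.ofReal_rpow_of_pos hK, ← ENNReal.ofReal_mul (by positivity)]
        rfl

theorem exists_eLpNorm_rieszPotential_le {σ p q : ℝ} (hσ : 0 < σ) (hp : 1 < p)
    (hpσ : p * σ < finrank ℝ E) (hq : 1 / q = 1 / p - σ / finrank ℝ E) :
    ∃ C : ℝ≥0, ∀ f : E → ℝ≥0∞, AEMeasurable f μ →
      eLpNorm (rieszPotential μ σ f) (ENNReal.ofReal q) μ ≤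
        C * eLpNorm f (ENNReal.ofReal p) μ := by
  have hp0 : 0 < p := by linarith
  have hd : (0 : ℝ) < finrank ℝ E := (by positivity : 0 < p * σ).trans hpσ
  have hq0 : 0 < q := one_div_pos.1 <| by
    rw [hq, sub_pos, div_lt_div_iff₀ hd hp0]
    linarith
  obtain ⟨C, hC⟩ := exists_lintegral_rieszPotential_rpow_le μ hσ hp hpσ hq
  refine ⟨(C + 1) ^ (1 / q), fun f hf => ?_⟩
  rw [rieszPotential_congr_ae hf.ae_eq_mk, eLpNorm_congr_ae hf.ae_eq_mk]
  have hg : Measurable (hf.mk f) := hf.measurable_mk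
  set g := hf.mk f
  obtain ⟨A, hA⟩ : ∃ A, A = (∫⁻ y, g y ^ p ∂μ) ^ (1 / p) := ⟨_, rfl⟩
  rw [eLpNorm_ofReal_eq_lintegral hp0, ← hA]
  rcases eq_or_ne (∫⁻ y, g y ^ p ∂μ) 0 with hzero | hzero
  · rw [rieszPotential_congr_ae (ENNReal.ae_eq_zero_of_lintegral_rpow_eq_zero hp0.le
      hg.aemeasurable hzero)]
    simp [rieszPotential, eLpNorm_ofReal_eq_lintegral hq0, hq0]
  rcases eq_or_ne (∫⁻ y, g y ^ p ∂μ) ∞ with htop | htop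
  · rw [hA, htop, ENNReal.top_rpow_of_pos (by positivity), ENNReal.mul_top (by positivity)]
    exact le_top
  lift A to ℝ≥0 using hA ▸ ENNReal.rpow_ne_top_of_nonneg (by positivity) htop
  have hscale : ∀ x, rieszPotential μ σ g x =
      A * rieszPotential μ σ (ENNReal.funMulInvSnorm g p μ) x := fun x => by
    rw [← rieszPotential_const_mul μ ENNReal.coe_ne_top]
    congr 1
    funext y
    rw [hA, mul_comm, ← ENNReal.fun_eq_funMulInvSnorm_mul_eLpNorm g hzero htop]
  have hunit := hC _ (hg.mul_const _)
    (ENNReal.lintegral_rpow_funMulInvSnorm_eq_one hp0 hzero htop).le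
  calc eLpNorm (rieszPotential μ σ g) (ENNReal.ofReal q) μ
      ≤ A • eLpNorm (rieszPotential μ σ (ENNReal.funMulInvSnorm g p μ)) (ENNReal.ofReal q) μ :=
        eLpNorm_le_nnreal_smul_eLpNorm_of_ae_le_mul' (ae_of_all _ fun x => (hscale x).le) _
    _ ≤ A * (C + 1 : ℝ≥0) ^ (1 / q) := by
        rw [eLpNorm_ofReal_eq_lintegral hq0, ENNReal.smul_def, smul_eq_mul]
        gcongr
        exact hunit.trans (by exact_mod_cast le_self_add)
    _ = ((C + 1) ^ (1 / q) : ℝ≥0) * A := by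
        rw [mul_comm, ENNReal.coe_rpow_of_nonneg _ (by positivity)]

end RieszPotential

section KernelOp

variable {X : Type*} [MeasurableSpace X] {μ : Measure X} {K K' : X → X → ℝ≥0∞} {g h : X → ℝ≥0∞}

/-- The integral operator with nonnegative kernel `K` on nonnegative functions. Working with values
in `[0, ∞]` keeps integrability questions out of all comparisons between kernels. -/
noncomputable def kernelOp (μ : Measure X) (K : X → X → ℝ≥0∞) (g : X → ℝ≥0∞) (x : X) : ℝ≥0∞ :=
  ∫⁻ y, K x y * g y ∂μ

lemma kernelOp_mono_ae (hgh : g ≤ᵐ[μ] h) (x : X) : kernelOp μ K g x ≤ kernelOp μ K h x :=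
  lintegral_mono_ae (hgh.mono fun _ hy => mul_le_mul_right hy _)

lemma kernelOp_const_mul {c : ℝ≥0∞} (hc : c ≠ ∞) (g : X → ℝ≥0∞) (x : X) :
    kernelOp μ K (fun y => c * g y) x = c * kernelOp μ K g x := by
  simp only [kernelOp, mul_left_comm _ c, lintegral_const_mul' _ _ hc]

lemma kernelOp_le_of_ae_le {c : ℝ≥0} {x : X} (hK : ∀ᵐ y ∂μ, K x y ≤ c * K' x y)
    (g : X → ℝ≥0∞) : kernelOp μ K g x ≤ c * kernelOp μ K' g x := by
  rw [kernelOp, kernelOp, ← lintegral_const_mul' _ _ ENNReal.coe_ne_top]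
  refine lintegral_mono_ae (hK.mono fun y hy => ?_)
  rw [← mul_assoc]
  gcongr

lemma kernelOp_mul_eq (v w : X → ℝ≥0∞) {x : X} (hv : v x ≠ ∞) (g : X → ℝ≥0∞) :
    kernelOp μ (fun x y => v x * w y) g x = v x * ∫⁻ y, w y * g y ∂μ := by
  simp only [kernelOp, mul_assoc, lintegral_const_mul' _ _ hv]

lemma lintegral_mul_rpow_le {p : ℝ} (hp : 1 ≤ p) {k : X → ℝ≥0∞} (hk : AEMeasurable k μ)
    (hg : AEMeasurable g μ) :
    (∫⁻ y, k y * g y ∂μ) ^ p ≤ (∫⁻ y, k y ∂μ) ^ (p - 1) * ∫⁻ y, k y * g y ^ p ∂μ := by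
  have hp0 : 0 < p := by linarith
  have hJensen := eLpNorm'_le_eLpNorm'_mul_rpow_measure_univ zero_lt_one hp
    (hg.aestronglyMeasurable.mono_ac (withDensity_absolutelyContinuous μ k))
  simp only [eLpNorm', enorm_eq_self, ENNReal.rpow_one, div_one, withDensity_apply _ .univ,
    Measure.restrict_univ, lintegral_withDensity_eq_lintegral_mul₀ hk hg,
    lintegral_withDensity_eq_lintegral_mul₀ hk (hg.pow_const p), Pi.mul_apply] at hJensen
  refine (ENNReal.rpow_le_rpow hJensen hp0.le).trans_eq ?_
  rw [ENNReal.mul_rpow_of_nonneg _ _ hp0.le, ← ENNReal.rpow_mul, ← ENNReal.rpow_mul,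
    one_div_mul_cancel hp0.ne', ENNReal.rpow_one, mul_comm]
  congr 2
  field_simp

lemma aemeasurable_uncurry_kernel_mul (hK : Measurable (Function.uncurry K))
    (hg : AEMeasurable g μ) :
    AEMeasurable (fun z : X × X => K z.1 z.2 * g z.2) (μ.prod μ) :=
  hK.aemeasurable.mul hg.comp_snd

variable [SFinite μ]

lemma aemeasurable_kernelOp (hK : Measurable (Function.uncurry K)) (hg : AEMeasurable g μ) :
    AEMeasurable (kernelOp μ K g) μ :=
  (aemeasurable_uncurry_kernel_mul hK hg).lintegral_prod_right'

lemma lintegral_mul_kernelOp (hK : Measurable (Function.uncurry K)) (hsymm : ∀ x y, K x y = K y x)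
    (hg : AEMeasurable g μ) (hh : AEMeasurable h μ) :
    ∫⁻ x, h x * kernelOp μ K g x ∂μ = ∫⁻ x, kernelOp μ K h x * g x ∂μ := by
  have hmeas : AEMeasurable (fun z : X × X => h z.1 * (K z.1 z.2 * g z.2)) (μ.prod μ) :=
    hh.comp_fst.mul (aemeasurable_uncurry_kernel_mul hK hg)
  have hKx : ∀ x, Measurable (K x) := fun x => hK.comp measurable_prodMk_left
  calc ∫⁻ x, h x * kernelOp μ K g x ∂μ
      = ∫⁻ x, ∫⁻ y, h x * (K x y * g y) ∂μ ∂μ := lintegral_congr fun x =>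
        (lintegral_const_mul'' _ ((hKx x).aemeasurable.mul hg)).symm
    _ = ∫⁻ y, ∫⁻ x, h x * (K x y * g y) ∂μ ∂μ := lintegral_lintegral_swap hmeas
    _ = ∫⁻ y, kernelOp μ K h y * g y ∂μ := lintegral_congr fun y => by
        refine Eq.trans ?_ (lintegral_mul_const'' (g y) ((hKx y).aemeasurable.mul hh))
        refine lintegral_congr fun x => ?_
        simp only [hsymm x y]
        ring

lemma lintegral_kernelOp (hK : Measurable (Function.uncurry K)) (hg : AEMeasurable g μ) :
    ∫⁻ x, kernelOp μ K g x ∂μ = ∫⁻ y, (∫⁻ x, K x y ∂μ) * g y ∂μ := by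
  have hKy : ∀ y, Measurable fun x => K x y := fun y => hK.comp measurable_prodMk_right
  simp only [kernelOp, ← lintegral_mul_const _ (hKy _)]
  exact lintegral_lintegral_swap (aemeasurable_uncurry_kernel_mul hK hg)

lemma kernelOp_kernelOp (hK : Measurable (Function.uncurry K))
    (hK' : Measurable (Function.uncurry K')) (hg : AEMeasurable g μ) (x : X) :
    kernelOp μ K (kernelOp μ K' g) x =
      kernelOp μ (fun x y => ∫⁻ z, K x z * K' z y ∂μ) g x := by
  have hKx : ∀ x, Measurable (K x) := fun x => hK.comp measurable_prodMk_left
  have hK'x : ∀ x, Measurable (K' x) := fun x => hK'.comp measurable_prodMk_left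
  have hK'y : ∀ y, Measurable fun z => K' z y := fun y => hK'.comp measurable_prodMk_right
  calc kernelOp μ K (kernelOp μ K' g) x
      = ∫⁻ z, ∫⁻ y, K x z * (K' z y * g y) ∂μ ∂μ := lintegral_congr fun z =>
        (lintegral_const_mul'' _ ((hK'x z).aemeasurable.mul hg)).symm
    _ = ∫⁻ y, ∫⁻ z, K x z * (K' z y * g y) ∂μ ∂μ := lintegral_lintegral_swap
        ((hKx x).aemeasurable.comp_fst.mul (aemeasurable_uncurry_kernel_mul hK' hg))
    _ = ∫⁻ y, (∫⁻ z, K x z * K' z y ∂μ) * g y ∂μ := lintegral_congr fun y => by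
        simp only [← mul_assoc]
        exact lintegral_mul_const _ ((hKx x).mul (hK'y y))

lemma lintegral_kernelOp_rpow_le {p : ℝ} (hp : 1 ≤ p) (hK : Measurable (Function.uncurry K))
    {A B : ℝ≥0∞} (hA : ∀ᵐ x ∂μ, ∫⁻ y, K x y ∂μ ≤ A) (hB : ∀ᵐ y ∂μ, ∫⁻ x, K x y ∂μ ≤ B)
    (hg : AEMeasurable g μ) :
    ∫⁻ x, kernelOp μ K g x ^ p ∂μ ≤ A ^ (p - 1) * (B * ∫⁻ y, g y ^ p ∂μ) := by
  have hKx : ∀ x, Measurable (K x) := fun x => hK.comp measurable_prodMk_left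
  have hgp : AEMeasurable (fun y => g y ^ p) μ := hg.pow_const p
  calc ∫⁻ x, kernelOp μ K g x ^ p ∂μ
      ≤ ∫⁻ x, A ^ (p - 1) * kernelOp μ K (fun y => g y ^ p) x ∂μ := by
        refine lintegral_mono_ae (hA.mono fun x hx => ?_)
        exact (lintegral_mul_rpow_le hp (hKx x).aemeasurable hg).trans
          (mul_le_mul_left (ENNReal.rpow_le_rpow hx (by linarith)) _)
    _ = A ^ (p - 1) * ∫⁻ y, (∫⁻ x, K x y ∂μ) * g y ^ p ∂μ := by
        rw [← lintegral_kernelOp hK hgp]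
        exact lintegral_const_mul'' _ (aemeasurable_kernelOp hK hgp)
    _ ≤ A ^ (p - 1) * (B * ∫⁻ y, g y ^ p ∂μ) := by
        rw [← lintegral_const_mul'' _ hgp]
        gcongr 1
        exact lintegral_mono_ae (hB.mono fun y hy => mul_le_mul_left hy _)

lemma eLpNorm_kernelOp_le {p : ℝ} (hp : 1 ≤ p) (hK : Measurable (Function.uncurry K)) {A : ℝ≥0∞}
    (hA : ∀ᵐ y ∂μ, ∫⁻ x, K x y ^ p ∂μ ≤ A) (hg : AEMeasurable g μ) :
    eLpNorm (kernelOp μ K g) (ENNReal.ofReal p) μ ≤ A ^ (1 / p) * ∫⁻ y, g y ∂μ := by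
  have hp0 : 0 < p := by linarith
  have hKx : ∀ x, Measurable (K x) := fun x => hK.comp measurable_prodMk_left
  have hKp : Measurable (Function.uncurry fun x y => K x y ^ p) := hK.pow_const p
  set N := ∫⁻ y, g y ∂μ
  have hLp : ∫⁻ x, kernelOp μ K g x ^ p ∂μ ≤ A * N ^ p := by
    calc ∫⁻ x, kernelOp μ K g x ^ p ∂μ
        ≤ ∫⁻ x, N ^ (p - 1) * kernelOp μ (fun x y => K x y ^ p) g x ∂μ := by
          refine lintegral_mono fun x => ?_
          simp only [kernelOp, mul_comm _ (g _)]
          exact lintegral_mul_rpow_le hp hg (hKx x).aemeasurable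
      _ = N ^ (p - 1) * ∫⁻ y, (∫⁻ x, K x y ^ p ∂μ) * g y ∂μ := by
          rw [lintegral_const_mul'' _ (aemeasurable_kernelOp hKp hg), lintegral_kernelOp hKp hg]
      _ ≤ N ^ (p - 1) * (A * N) := by
          rw [← lintegral_const_mul'' _ hg]
          gcongr 1
          exact lintegral_mono_ae (hA.mono fun y hy => mul_le_mul_left hy _)
      _ = A * N ^ p := by
          have hsplit : N ^ p = N ^ (p - 1) * N := by
            simpa using ENNReal.rpow_add_of_nonneg (x := N) (p - 1) 1 (by linarith) zero_le_one
          rw [hsplit, mul_left_comm]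
  rw [eLpNorm_ofReal_eq_lintegral hp0]
  refine (ENNReal.rpow_le_rpow hLp (by positivity)).trans_eq ?_
  rw [ENNReal.mul_rpow_of_nonneg _ _ (by positivity), ← ENNReal.rpow_mul,
    mul_one_div_cancel hp0.ne', ENNReal.rpow_one]

end KernelOp

section MultiplierOp

variable {ι 𝕜 H : Type*} [RCLike 𝕜] [NormedAddCommGroup H] [InnerProductSpace 𝕜 H]

/-- The operator that is diagonal in the Hilbert basis `b`, with eigenvalues `m`. The sum converges
when `m` is bounded; otherwise it may take the junk value `0`. -/
noncomputable def multiplierOp (b : HilbertBasis ι 𝕜 H) (m : ι → 𝕜) (ψ : H) : H :=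
  ∑' j, (m j * inner 𝕜 (b j) ψ) • b j

variable (b : HilbertBasis ι 𝕜 H) {m : ι → 𝕜} {B : ℝ}

lemma eq_of_forall_inner_hilbertBasis_eq {v w : H} (h : ∀ j, inner 𝕜 (b j) v = inner 𝕜 (b j) w) :
    v = w :=
  b.repr.injective (lp.ext (funext fun j => by simp only [b.repr_apply_apply, h j]))

lemma inner_hilbertBasis_eq_ite [DecidableEq ι] (i j : ι) :
    inner 𝕜 (b i) (b j) = if i = j then (1 : 𝕜) else 0 :=
  orthonormal_iff_ite.1 b.orthonormal i j

lemma norm_mul_repr_rpow_le (hm : ∀ j, ‖m j‖ ≤ B) (ψ : H) (j : ι) :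
    ‖m j * b.repr ψ j‖ ^ (2 : ℝ≥0∞).toReal ≤
      B ^ (2 : ℝ≥0∞).toReal * ‖b.repr ψ j‖ ^ (2 : ℝ≥0∞).toReal := by
  have hB : 0 ≤ B := (norm_nonneg _).trans (hm j)
  rw [norm_mul, ← Real.mul_rpow hB (norm_nonneg _)]
  have := hm j
  gcongr

lemma exists_repr_symm_eq_multiplierOp (hm : ∀ j, ‖m j‖ ≤ B) (ψ : H) :
    ∃ a : lp (fun _ : ι => 𝕜) 2, (∀ j, a j = m j * b.repr ψ j) ∧
      multiplierOp b m ψ = b.repr.symm a := by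
  have hmem : Memℓp (fun j => m j * b.repr ψ j) 2 :=
    memℓp_gen (Summable.of_nonneg_of_le (fun j => by positivity) (norm_mul_repr_rpow_le b hm ψ)
      (((lp.memℓp (b.repr ψ)).summable (by norm_num)).mul_left _))
  refine ⟨⟨_, hmem⟩, fun _ => rfl, ?_⟩
  rw [← (b.hasSum_repr_symm ⟨_, hmem⟩).tsum_eq]
  simp only [multiplierOp, b.repr_apply_apply]

lemma inner_multiplierOp (hm : ∀ j, ‖m j‖ ≤ B) (ψ : H) (k : ι) :
    inner 𝕜 (b k) (multiplierOp b m ψ) = m k * inner 𝕜 (b k) ψ := by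
  obtain ⟨a, ha, heq⟩ := exists_repr_symm_eq_multiplierOp b hm ψ
  rw [heq, ← b.repr_apply_apply, LinearIsometryEquiv.apply_symm_apply, ha, b.repr_apply_apply]

lemma norm_multiplierOp_le [Nonempty ι] (hm : ∀ j, ‖m j‖ ≤ B) (ψ : H) :
    ‖multiplierOp b m ψ‖ ≤ B * ‖ψ‖ := by
  have hB : 0 ≤ B := (norm_nonneg _).trans (hm (Classical.arbitrary ι))
  have htwo : 0 < (2 : ℝ≥0∞).toReal := by norm_num
  obtain ⟨a, ha, heq⟩ := exists_repr_symm_eq_multiplierOp b hm ψ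
  rw [heq, LinearIsometryEquiv.norm_map]
  refine lp.norm_le_of_forall_sum_le htwo (by positivity) fun S => ?_
  calc ∑ j ∈ S, ‖a j‖ ^ (2 : ℝ≥0∞).toReal
      ≤ ∑ j ∈ S, B ^ (2 : ℝ≥0∞).toReal * ‖b.repr ψ j‖ ^ (2 : ℝ≥0∞).toReal :=
        Finset.sum_le_sum fun j _ => ha j ▸ norm_mul_repr_rpow_le b hm ψ j
    _ ≤ B ^ (2 : ℝ≥0∞).toReal * ‖b.repr ψ‖ ^ (2 : ℝ≥0∞).toReal := by
        rw [← Finset.mul_sum]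
        gcongr
        exact lp.sum_rpow_le_norm_rpow htwo _ _
    _ = (B * ‖ψ‖) ^ (2 : ℝ≥0∞).toReal := by
        rw [LinearIsometryEquiv.norm_map, Real.mul_rpow hB (norm_nonneg _)]

lemma multiplierOp_basis (hm : ∀ j, ‖m j‖ ≤ B) (j : ι) : multiplierOp b m (b j) = m j • b j := by
  classical
  refine eq_of_forall_inner_hilbertBasis_eq b fun k => ?_
  rw [inner_multiplierOp b hm, inner_smul_right, inner_hilbertBasis_eq_ite]
  split_ifs with hkj
  · rw [hkj]
  · simp

lemma inner_iterate_multiplierOp (hm : ∀ j, ‖m j‖ ≤ B) (i : ℕ) (ψ : H) (k : ι) :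
    inner 𝕜 (b k) ((multiplierOp b m)^[i] ψ) = m k ^ i * inner 𝕜 (b k) ψ := by
  induction i with
  | zero => simp
  | succ i ih =>
    rw [Function.iterate_succ_apply', inner_multiplierOp b hm, ih, pow_succ', mul_assoc]

end MultiplierOp

section Resolvent

variable {ev : ℕ → ℝ} {lam : ℝ} {I : ℕ}

lemma sum_pow_mul_inv_pow_add {t e : ℝ} (he : e ≠ 0) (het : e - t ≠ 0) (N : ℕ) :
    ∑ i ∈ Finset.range N, t ^ i * e⁻¹ ^ (i + 1) + t ^ N * (e⁻¹ ^ N * (e - t)⁻¹) = (e - t)⁻¹ := by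
  induction N with
  | zero => simp
  | succ N ih =>
    conv_rhs => rw [← ih]
    rw [Finset.sum_range_succ, add_assoc]
    have hcancel : (e - t)⁻¹ = e⁻¹ + t * (e⁻¹ * (e - t)⁻¹) := by
      field_simp
      rw [sub_add_cancel]
    congr 1
    conv_rhs => rw [hcancel]
    ring

lemma norm_inv_le (hpos : ∀ j, 0 < ev j) (hmono : Monotone ev) (j : ℕ) :
    ‖ev⁻¹ j‖ ≤ (ev 0)⁻¹ := by
  rw [Pi.inv_apply, Real.norm_of_nonneg (inv_pos.2 (hpos j)).le]
  exact inv_anti₀ (hpos 0) (hmono (Nat.zero_le j))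

lemma norm_inv_sub_le (hmono : Monotone ev) (hlam : lam ≤ ev I) (hgap : ev I < ev (I + 1))
    {j : ℕ} (hj : I < j) : ‖(ev j - lam)⁻¹‖ ≤ (ev (I + 1) - ev I)⁻¹ := by
  have hle : ev (I + 1) ≤ ev j := hmono hj
  rw [Real.norm_of_nonneg (inv_pos.2 (by linarith)).le]
  exact inv_anti₀ (by linarith) (by linarith)

lemma exists_forall_norm_inv_sub_le (hmono : Monotone ev) (hlam : lam ≤ ev I)
    (hgap : ev I < ev (I + 1)) : ∃ B, ∀ j, ‖(ev j - lam)⁻¹‖ ≤ B := by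
  have hinv : 0 ≤ (ev (I + 1) - ev I)⁻¹ := (inv_pos.2 (by linarith)).le
  refine ⟨∑ i ∈ Finset.range (I + 1), ‖(ev i - lam)⁻¹‖ + (ev (I + 1) - ev I)⁻¹, fun j => ?_⟩
  rcases le_or_gt j I with hj | hj
  · have hterm := Finset.single_le_sum (f := fun i => ‖(ev i - lam)⁻¹‖)
      (fun i _ => norm_nonneg _) (Finset.mem_range.2 (Nat.lt_succ_of_le hj))
    exact hterm.trans (le_add_of_nonneg_right hinv)
  · exact (norm_inv_sub_le hmono hlam hgap hj).trans
      (le_add_of_nonneg_left (Finset.sum_nonneg fun _ _ => norm_nonneg _))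

/-- The multiplier of the resolvent at `lam` restricted to the modes above the index `I`. -/
noncomputable def upperResolvent (ev : ℕ → ℝ) (I : ℕ) (lam : ℝ) (j : ℕ) : ℝ :=
  if j ≤ I then 0 else (ev j - lam)⁻¹

lemma norm_upperResolvent_le (hmono : Monotone ev) (hlam : lam ≤ ev I) (hgap : ev I < ev (I + 1))
    (j : ℕ) : ‖upperResolvent ev I lam j‖ ≤ (ev (I + 1) - ev I)⁻¹ := by
  rw [upperResolvent]
  split_ifs with hj
  · rw [norm_zero]
    exact (inv_pos.2 (by linarith)).le
  · exact norm_inv_sub_le hmono hlam hgap (not_le.1 hj)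

variable {H : Type*} [NormedAddCommGroup H] [InnerProductSpace ℝ H] (b : HilbertBasis ℕ ℝ H)

/-- Only the coefficients `d`, which sit on the finitely many modes up to `I`, can blow up as `lam`
approaches an eigenvalue. -/
lemma exists_multiplierOp_inv_sub_eq (hpos : ∀ j, 0 < ev j) (hmono : Monotone ev)
    (hlam : lam ∉ range ev) (hlamI : lam ≤ ev I) (hgap : ev I < ev (I + 1)) (a : ℕ) (ψ : H) :
    ∃ d : ℕ → ℝ, multiplierOp b (fun j => (ev j - lam)⁻¹) ψ =
      (∑ i ∈ Finset.range (2 * a), lam ^ i • (multiplierOp b ev⁻¹)^[i + 1] ψ +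
        lam ^ (2 * a) • (multiplierOp b ev⁻¹)^[a]
          (multiplierOp b (upperResolvent ev I lam) ((multiplierOp b ev⁻¹)^[a] ψ))) +
      ∑ j ∈ Finset.range (I + 1), d j • b j := by
  have hinv := norm_inv_le hpos hmono
  obtain ⟨B, hB⟩ := exists_forall_norm_inv_sub_le hmono hlamI hgap
  refine ⟨fun k => ((ev k - lam)⁻¹ - ∑ i ∈ Finset.range (2 * a), lam ^ i * (ev k)⁻¹ ^ (i + 1)) *
    inner ℝ (b k) ψ, eq_of_forall_inner_hilbertBasis_eq b fun k => ?_⟩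
  have hne : ev k - lam ≠ 0 := fun h => hlam ⟨k, sub_eq_zero.1 h⟩
  simp only [inner_add_right, inner_sum, inner_smul_right, inner_multiplierOp b hB,
    inner_iterate_multiplierOp b hinv, inner_hilbertBasis_eq_ite, mul_ite, mul_one, mul_zero,
    inner_multiplierOp b (norm_upperResolvent_le hmono hlamI hgap), Finset.sum_ite_eq,
    Finset.mem_range, Nat.lt_succ_iff, Pi.inv_apply, ← mul_assoc, ← Finset.sum_mul]
  rcases le_or_gt k I with hk | hk
  · simp only [upperResolvent, if_pos hk]
    ring
  · rw [upperResolvent, if_neg hk.not_ge, if_neg hk.not_ge, add_zero, ← add_mul]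
    congr 1
    conv_lhs => rw [← sum_pow_mul_inv_pow_add (hpos k).ne' hne (2 * a), two_mul, pow_add (ev k)⁻¹]
    ring_nf

end Resolvent

section KernelDominated

variable {X : Type*} [MeasurableSpace X] {μ : Measure X} {K K' : X → X → ℝ≥0∞} {C C' : ℝ≥0}
  {T T' : Lp ℝ 2 μ → Lp ℝ 2 μ}

/-- The operator `T` on `L²(μ)` is pointwise bounded by `C` times the integral operator with the
nonnegative kernel `K`. -/
def KernelDominated (μ : Measure X) (K : X → X → ℝ≥0∞) (C : ℝ≥0) (T : Lp ℝ 2 μ → Lp ℝ 2 μ) : Prop :=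
  ∀ ψ, ∀ᵐ x ∂μ, ‖T ψ x‖ₑ ≤ C * kernelOp μ K (fun y => ‖ψ y‖ₑ) x

namespace KernelDominated

lemma mono (hT : KernelDominated μ K C T) (hC : C ≤ C') : KernelDominated μ K C' T := fun ψ => by
  filter_upwards [hT ψ] with x hx
  exact hx.trans (by gcongr)

lemma mono_kernel (hT : KernelDominated μ K C T)
    (hK : ∀ᵐ x ∂μ, ∀ᵐ y ∂μ, K x y ≤ C' * K' x y) : KernelDominated μ K' (C * C') T := fun ψ => by
  filter_upwards [hT ψ, hK] with x hTx hKx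
  refine hTx.trans ?_
  rw [ENNReal.coe_mul, mul_assoc]
  gcongr
  exact kernelOp_le_of_ae_le hKx _

lemma zero : KernelDominated μ K 0 fun _ => 0 := fun ψ => by
  filter_upwards [Lp.coeFn_zero ℝ 2 μ] with x hx
  simp only [hx, Pi.zero_apply, enorm_zero, zero_le]

lemma add (hT : KernelDominated μ K C T) (hT' : KernelDominated μ K C' T') :
    KernelDominated μ K (C + C') fun ψ => T ψ + T' ψ := fun ψ => by
  filter_upwards [hT ψ, hT' ψ, Lp.coeFn_add (T ψ) (T' ψ)] with x hx hx' hadd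
  rw [hadd, Pi.add_apply, ENNReal.coe_add, add_mul]
  exact (enorm_add_le _ _).trans (add_le_add hx hx')

lemma const_smul (hT : KernelDominated μ K C T) (c : ℝ) :
    KernelDominated μ K (‖c‖₊ * C) fun ψ => c • T ψ := fun ψ => by
  filter_upwards [hT ψ, Lp.coeFn_smul c (T ψ)] with x hx hsmul
  rw [hsmul, Pi.smul_apply, enorm_smul, ENNReal.coe_mul, mul_assoc]
  exact mul_le_mul_right hx _

lemma sum {ι : Type*} {T : ι → Lp ℝ 2 μ → Lp ℝ 2 μ} {C : ι → ℝ≥0} (s : Finset ι)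
    (hT : ∀ i, KernelDominated μ K (C i) (T i)) :
    KernelDominated μ K (∑ i ∈ s, C i) fun ψ => ∑ i ∈ s, T i ψ := by
  classical
  induction s using Finset.induction_on with
  | empty => simpa using zero
  | insert i s hi ih => simpa only [Finset.sum_insert hi] using (hT i).add ih

lemma comp [SFinite μ] {K'' : X → X → ℝ≥0∞} {C'' : ℝ≥0} (hT : KernelDominated μ K C T)
    (hT' : KernelDominated μ K' C' T') (hK : Measurable (Function.uncurry K))
    (hK' : Measurable (Function.uncurry K'))
    (hKK' : ∀ᵐ x ∂μ, ∀ᵐ y ∂μ, ∫⁻ z, K x z * K' z y ∂μ ≤ C'' * K'' x y) :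
    KernelDominated μ K'' (C * C' * C'') (T ∘ T') := fun ψ => by
  filter_upwards [hT (T' ψ), hKK'] with x hTx hKx
  calc ‖(T ∘ T') ψ x‖ₑ ≤ C * kernelOp μ K (fun y => ‖T' ψ y‖ₑ) x := hTx
    _ ≤ C * kernelOp μ K (fun y => C' * kernelOp μ K' (fun z => ‖ψ z‖ₑ) y) x := by
        gcongr
        exact kernelOp_mono_ae (hT' ψ) x
    _ = C * (C' * kernelOp μ (fun x y => ∫⁻ z, K x z * K' z y ∂μ) (fun z => ‖ψ z‖ₑ) x) := by
        rw [kernelOp_const_mul ENNReal.coe_ne_top,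
          kernelOp_kernelOp hK hK' (Lp.aestronglyMeasurable ψ).enorm]
    _ ≤ C * (C' * (C'' * kernelOp μ K'' (fun z => ‖ψ z‖ₑ) x)) := by
        gcongr
        exact kernelOp_le_of_ae_le hKx _
    _ = (C * C' * C'' : ℝ≥0) * kernelOp μ K'' (fun z => ‖ψ z‖ₑ) x := by
        push_cast
        ring

end KernelDominated

end KernelDominated

section KernelSmoothing

variable {X : Type*} [MeasurableSpace X] {μ : Measure X} {K : X → X → ℝ≥0∞} {w u f : X → ℝ}
  {T : Lp ℝ 2 μ → Lp ℝ 2 μ}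

lemma lintegral_enorm_mul_enorm_Lp_le (hw : MemLp w 2 μ) (v : Lp ℝ 2 μ) :
    ∫⁻ x, ‖w x‖ₑ * ‖v x‖ₑ ∂μ ≤ eLpNorm w 2 μ * ‖v‖ₑ := by
  simp only [Lp.enorm_def, eLpNorm_eq_lintegral_rpow_enorm_toReal two_ne_zero ENNReal.ofNat_ne_top,
    ENNReal.toReal_ofNat]
  exact ENNReal.lintegral_mul_le_Lp_mul_Lq μ Real.HolderConjugate.two_two hw.1.enorm
    (Lp.aestronglyMeasurable v).enorm

lemma kernelOp_enorm_mul_enorm (g : X → ℝ≥0∞) (x : X) :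
    kernelOp μ (fun x y => ‖w x‖ₑ * ‖w y‖ₑ) g x = ‖w x‖ₑ * ∫⁻ y, ‖w y‖ₑ * g y ∂μ :=
  kernelOp_mul_eq (fun x => ‖w x‖ₑ) _ enorm_ne_top g

namespace KernelDominated

lemma enorm_apply_le_of_rankOne {C : ℝ≥0}
    (hT : KernelDominated μ (fun x y => ‖w x‖ₑ * ‖w y‖ₑ) C T) (hw : MemLp w 2 μ)
    (ψ : Lp ℝ 2 μ) : ‖T ψ‖ₑ ≤ C * eLpNorm w 2 μ * ∫⁻ y, ‖w y‖ₑ * ‖ψ y‖ₑ ∂μ := by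
  set J := ∫⁻ y, ‖w y‖ₑ * ‖ψ y‖ₑ ∂μ with hJ
  have hJ_top : J ≠ ∞ := ne_top_of_le_ne_top (ENNReal.mul_ne_top hw.eLpNorm_ne_top enorm_ne_top)
    (lintegral_enorm_mul_enorm_Lp_le hw ψ)
  have hpoint : ∀ᵐ x ∂μ, ‖T ψ x‖ₑ ≤ (C * J.toNNReal : ℝ≥0) * ‖w x‖ₑ := by
    filter_upwards [hT ψ] with x hx
    rw [kernelOp_enorm_mul_enorm, ← hJ] at hx
    rwa [ENNReal.coe_mul, ENNReal.coe_toNNReal hJ_top, mul_assoc, mul_comm J]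
  rw [Lp.enorm_def]
  refine (eLpNorm_le_nnreal_smul_eLpNorm_of_ae_le_mul' hpoint 2).trans_eq ?_
  rw [ENNReal.smul_def, smul_eq_mul, ENNReal.coe_mul, ENNReal.coe_toNNReal hJ_top]
  ring

/-- The factor `T'` in the middle only enters through its `L²` bound. -/
lemma comp_comp_of_rankOne {A J : ℝ≥0} {T' : Lp ℝ 2 μ → Lp ℝ 2 μ}
    (hT : KernelDominated μ (fun x y => ‖w x‖ₑ * ‖w y‖ₑ) A T) (hw : MemLp w 2 μ)
    (hT' : ∀ ψ, ‖T' ψ‖ₑ ≤ J * ‖ψ‖ₑ) :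
    KernelDominated μ (fun x y => ‖w x‖ₑ * ‖w y‖ₑ) (A ^ 2 * (eLpNorm w 2 μ).toNNReal ^ 2 * J)
      fun ψ => T (T' (T ψ)) := fun ψ => by
  filter_upwards [hT (T' (T ψ))] with x hx
  rw [kernelOp_enorm_mul_enorm] at hx ⊢
  push_cast
  rw [ENNReal.coe_toNNReal hw.eLpNorm_ne_top]
  calc ‖T (T' (T ψ)) x‖ₑ
      ≤ A * (‖w x‖ₑ * ∫⁻ y, ‖w y‖ₑ * ‖T' (T ψ) y‖ₑ ∂μ) := hx
    _ ≤ A * (‖w x‖ₑ * (eLpNorm w 2 μ * (J *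
          (A * eLpNorm w 2 μ * ∫⁻ y, ‖w y‖ₑ * ‖ψ y‖ₑ ∂μ)))) := by
        gcongr
        refine (lintegral_enorm_mul_enorm_Lp_le hw _).trans ?_
        gcongr
        refine (hT' _).trans ?_
        gcongr
        exact hT.enorm_apply_le_of_rankOne hw ψ
    _ = A ^ 2 * eLpNorm w 2 μ ^ 2 * J * (‖w x‖ₑ * ∫⁻ y, ‖w y‖ₑ * ‖ψ y‖ₑ ∂μ) := by ring

end KernelDominated

/-- All iterates of `T` are pointwise dominated by the kernel `K`, and one of them even by the rank
one kernel `w ⊗ w`, where the weight `w` is square integrable and `w ⊗ w` lies below `K`. This turns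
`L²` bounds for functions of `T` into pointwise bounds by `K`. -/
structure IsKernelSmoothing (μ : Measure X) (K : X → X → ℝ≥0∞) (w : X → ℝ)
    (T : Lp ℝ 2 μ → Lp ℝ 2 μ) : Prop where
  weight_pos : ∀ᵐ x ∂μ, 0 < w x
  memLp_weight : MemLp w 2 μ
  weight_mul_le : ∃ P : ℝ≥0, ∀ᵐ x ∂μ, ∀ᵐ y ∂μ, ‖w x‖ₑ * ‖w y‖ₑ ≤ P * K x y
  iterate : ∀ i, ∃ C, KernelDominated μ K C T^[i + 1]
  smoothing : ∃ a C, KernelDominated μ (fun x y => ‖w x‖ₑ * ‖w y‖ₑ) C T^[a]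

namespace IsKernelSmoothing

variable {b : HilbertBasis ℕ ℝ (Lp ℝ 2 μ)} {ev : ℕ → ℝ} {I : ℕ}

/-- The bound for the first summand in `exists_multiplierOp_inv_sub_eq` is uniform in `lam`, since
the upper part of the resolvent is bounded on `L²` by the inverse spectral gap. -/
lemma exists_multiplierOp_inv_sub_decomposition (h : IsKernelSmoothing μ K w (multiplierOp b ev⁻¹))
    (hpos : ∀ j, 0 < ev j) (hmono : Monotone ev) (hgap : ev I < ev (I + 1)) (m : ℝ) :
    ∃ C : ℝ≥0, ∀ lam ∉ range ev, -m ≤ lam → lam ≤ ev I →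
      ∃ R : Lp ℝ 2 μ → Lp ℝ 2 μ, KernelDominated μ K C R ∧ ∀ ψ, ∃ d : ℕ → ℝ,
        multiplierOp b (fun j => (ev j - lam)⁻¹) ψ =
          R ψ + ∑ j ∈ Finset.range (I + 1), d j • b j := by
  obtain ⟨a, A, hsmoothing⟩ := h.smoothing
  obtain ⟨P, hP⟩ := h.weight_mul_le
  choose D hD using h.iterate
  set Λ : ℝ≥0 := max ‖-m‖₊ ‖ev I‖₊
  set J : ℝ≥0 := ‖(ev (I + 1) - ev I)⁻¹‖₊
  refine ⟨∑ i ∈ Finset.range (2 * a), Λ ^ i * D i +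
    Λ ^ (2 * a) * (A ^ 2 * (eLpNorm w 2 μ).toNNReal ^ 2 * J * P), fun lam hlam hm hlamI => ?_⟩
  have hupper := (hsmoothing.comp_comp_of_rankOne h.memLp_weight (J := J)
    (T' := multiplierOp b (upperResolvent ev I lam)) fun ψ => ?_).mono_kernel hP
  · refine ⟨_, ((KernelDominated.sum (Finset.range (2 * a)) fun i =>
      (hD i).const_smul (lam ^ i)).add (hupper.const_smul (lam ^ (2 * a)))).mono ?_,
      exists_multiplierOp_inv_sub_eq b hpos hmono hlam hlamI hgap a⟩
    have hΛ : ‖lam‖₊ ≤ Λ := by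
      have hmax := abs_le_max_abs_abs hm hlamI
      simpa only [← NNReal.coe_le_coe, NNReal.coe_max, coe_nnnorm, Real.norm_eq_abs, Λ] using hmax
    simp only [nnnorm_pow]
    gcongr
  · have hnorm := norm_multiplierOp_le b (norm_upperResolvent_le hmono hlamI hgap) ψ
    rw [← Real.norm_of_nonneg (inv_pos.2 (sub_pos.2 hgap)).le] at hnorm
    simpa only [enorm_eq_nnnorm, ← ENNReal.coe_mul, ENNReal.coe_le_coe, ← NNReal.coe_le_coe,
      NNReal.coe_mul, coe_nnnorm, J] using hnorm

lemma exists_abs_basis_le (h : IsKernelSmoothing μ K w (multiplierOp b ev⁻¹))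
    (hpos : ∀ j, 0 < ev j) (hmono : Monotone ev) (j : ℕ) :
    ∃ M : ℝ, ∀ᵐ x ∂μ, |b j x| ≤ M * w x := by
  obtain ⟨a, A, hsmoothing⟩ := h.smoothing
  set J := ∫⁻ y, ‖w y‖ₑ * ‖b j y‖ₑ ∂μ with hJ
  have hJ_top : J ≠ ∞ := ne_top_of_le_ne_top
    (ENNReal.mul_ne_top h.memLp_weight.eLpNorm_ne_top enorm_ne_top)
    (lintegral_enorm_mul_enorm_Lp_le h.memLp_weight (b j))
  have hbasis : b j = ev j ^ a • (multiplierOp b ev⁻¹)^[a] (b j) :=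
    eq_of_forall_inner_hilbertBasis_eq b fun k => by
      rw [inner_smul_right, inner_iterate_multiplierOp b (norm_inv_le hpos hmono),
        inner_hilbertBasis_eq_ite]
      split_ifs with hkj
      · simp [hkj, mul_inv_cancel₀ (pow_pos (hpos j) a).ne']
      · simp
  have hsmul := Lp.coeFn_smul (ev j ^ a) ((multiplierOp b ev⁻¹)^[a] (b j))
  rw [← hbasis] at hsmul
  refine ⟨ev j ^ a * (A * J.toReal), ?_⟩
  filter_upwards [hsmul, hsmoothing (b j), h.weight_pos] with x hx hle hwx
  rw [kernelOp_enorm_mul_enorm, ← hJ] at hle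
  have hle_real := ENNReal.toReal_mono (by finiteness) hle
  simp only [toReal_enorm, ENNReal.toReal_mul, ENNReal.coe_toReal] at hle_real
  rw [hx, Pi.smul_apply, smul_eq_mul, abs_mul, abs_of_pos (pow_pos (hpos j) a)]
  calc ev j ^ a * |(multiplierOp b ev⁻¹)^[a] (b j) x|
      ≤ ev j ^ a * (A * (‖w x‖ * J.toReal)) :=
        mul_le_mul_of_nonneg_left hle_real (pow_pos (hpos j) a).le
    _ = ev j ^ a * (A * J.toReal) * w x := by
        rw [Real.norm_of_nonneg hwx.le]
        ring

end IsKernelSmoothing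

section Duality

lemma aemeasurable_of_integrable_mul (hwpos : ∀ᵐ x ∂μ, 0 < w x) (hw : AEMeasurable w μ)
    (hu : Integrable (fun x => u x * w x) μ) : AEMeasurable u μ :=
  (hu.aemeasurable.div hw).congr <| by
    filter_upwards [hwpos] with x hx
    exact mul_div_cancel_right₀ _ hx.ne'

lemma integrable_mul_of_abs_le (hwpos : ∀ᵐ x ∂μ, 0 < w x) (hw : AEMeasurable w μ)
    (hu : Integrable (fun x => u x * w x) μ) {g : X → ℝ} (hg : AEStronglyMeasurable g μ) {M : ℝ}
    (hM : ∀ᵐ x ∂μ, |g x| ≤ M * w x) : Integrable (fun x => u x * g x) μ := by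
  refine (hu.norm.const_mul M).mono'
    ((aemeasurable_of_integrable_mul hwpos hw hu).aestronglyMeasurable.mul hg) ?_
  filter_upwards [hM, hwpos] with x hx hwx
  rw [norm_mul, norm_mul, Real.norm_of_nonneg hwx.le]
  calc ‖u x‖ * ‖g x‖ ≤ ‖u x‖ * (M * w x) := by gcongr; exact hx
    _ = M * (‖u x‖ * w x) := by ring

/-- The test function is the sign of `u` times `w`, cut off to `S`. -/
lemma exists_Lp_forall_mul_eq_indicator (hwpos : ∀ᵐ x ∂μ, 0 < w x) (hw : MemLp w 2 μ)
    (hu : AEMeasurable u μ) {S : Set X} (hS : MeasurableSet S) :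
    ∃ ψ : Lp ℝ 2 μ, (∀ᵐ x ∂μ, |ψ x| ≤ S.indicator w x) ∧
      ∀ᵐ x ∂μ, u x * ψ x = S.indicator (fun x => ‖u x * w x‖) x := by
  set g : X → ℝ := S.indicator fun x => u x / |u x| * w x
  have hgm : AEStronglyMeasurable g μ :=
    (((hu.div hu.norm).mul hw.1.aemeasurable).indicator hS).aestronglyMeasurable
  have hg_le : ∀ᵐ x ∂μ, |g x| ≤ S.indicator w x := by
    filter_upwards [hwpos] with x hx
    simp only [g, indicator]
    split_ifs
    · rw [abs_mul, abs_div, abs_abs, abs_of_pos hx]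
      exact mul_le_of_le_one_left hx.le (div_self_le_one _)
    · exact abs_zero.le
  have hg : MemLp g 2 μ := hw.mono hgm <| by
    filter_upwards [hg_le, hwpos] with x hx hwx
    exact hx.trans ((indicator_le_self' (fun _ _ => hwx.le) x).trans (le_abs_self _))
  refine ⟨hg.toLp g, ?_, ?_⟩ <;> filter_upwards [hg.coeFn_toLp, hg_le, hwpos] with x hψ hle hx
  · rwa [hψ]
  · rw [hψ]
    simp only [g, indicator]
    split_ifs
    · rw [norm_mul, Real.norm_eq_abs, Real.norm_of_nonneg hx.le, ← mul_assoc, mul_div_assoc',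
        ← abs_mul_abs_self, mul_self_div_self]
    · exact mul_zero _

lemma ae_enorm_le_of_forall_enorm_integral_mul_le [SigmaFinite μ] (hwpos : ∀ᵐ x ∂μ, 0 < w x)
    (hw : MemLp w 2 μ) (hu : Integrable (fun x => u x * w x) μ) {F : X → ℝ≥0∞}
    (huF : ∀ ψ : Lp ℝ 2 μ, (∃ M : ℝ, ∀ᵐ x ∂μ, |ψ x| ≤ M * w x) →
      ‖∫ x, u x * ψ x ∂μ‖ₑ ≤ ∫⁻ x, F x * ‖ψ x‖ₑ ∂μ) :
    ∀ᵐ x ∂μ, ‖u x‖ₑ ≤ F x := by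
  have hum := aemeasurable_of_integrable_mul hwpos hw.1.aemeasurable hu
  have hweighted : (fun x => ‖u x * w x‖ₑ) ≤ᵐ[μ] fun x => F x * ‖w x‖ₑ := by
    refine ae_le_of_forall_setLIntegral_le_of_sigmaFinite₀ hu.1.enorm fun S hS _ => ?_
    obtain ⟨ψ, hψ, huψ⟩ := exists_Lp_forall_mul_eq_indicator hwpos hw hum hS
    have hψw : ∀ᵐ x ∂μ, |ψ x| ≤ 1 * w x := by
      filter_upwards [hψ, hwpos] with x hx hwx
      rw [one_mul]
      exact hx.trans (indicator_le_self' (fun _ _ => hwx.le) x)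
    calc ∫⁻ x in S, ‖u x * w x‖ₑ ∂μ = ‖∫ x, u x * ψ x ∂μ‖ₑ := by
          rw [integral_congr_ae huψ, integral_indicator hS,
            Real.enorm_of_nonneg (integral_nonneg fun _ => norm_nonneg _),
            ofReal_integral_norm_eq_lintegral_enorm hu.integrableOn]
      _ ≤ ∫⁻ x, F x * ‖ψ x‖ₑ ∂μ := huF ψ ⟨1, hψw⟩
      _ ≤ ∫⁻ x, S.indicator (fun x => F x * ‖w x‖ₑ) x ∂μ := by
          refine lintegral_mono_ae ?_
          filter_upwards [hψ] with x hx
          rw [← ofReal_norm, Real.norm_eq_abs]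
          by_cases hxS : x ∈ S
          · simp only [indicator_of_mem hxS] at hx ⊢
            gcongr
            rw [← ofReal_norm]
            exact ENNReal.ofReal_le_ofReal (hx.trans (le_abs_self _))
          · simp only [indicator_of_notMem hxS, abs_nonpos_iff] at hx ⊢
            simp [hx]
      _ = ∫⁻ x in S, F x * ‖w x‖ₑ ∂μ := lintegral_indicator hS _
  filter_upwards [hweighted, hwpos] with x hx hwx
  rw [enorm_mul] at hx
  exact (ENNReal.mul_le_mul_iff_left (enorm_ne_zero.2 hwx.ne') enorm_ne_top).1 hx

lemma integrable_mul_sum_smul {v : ℕ → Lp ℝ 2 μ} {N : ℕ}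
    (hint : ∀ j ≤ N, Integrable (fun x => f x * v j x) μ) (hzero : ∀ j ≤ N, ∫ x, f x * v j x ∂μ = 0)
    (d : ℕ → ℝ) :
    Integrable (fun x => f x * (∑ j ∈ Finset.range (N + 1), d j • v j : Lp ℝ 2 μ) x) μ ∧
      ∫ x, f x * (∑ j ∈ Finset.range (N + 1), d j • v j : Lp ℝ 2 μ) x ∂μ = 0 := by
  have hmem : ∀ j ∈ Finset.range (N + 1), j ≤ N := fun j hj => Finset.mem_range_succ_iff.1 hj
  have hsmul : ∀ᵐ x ∂μ, ∀ j, (d j • v j) x = d j * v j x :=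
    ae_all_iff.2 fun j => Lp.coeFn_smul (d j) (v j)
  have hexpand : (fun x => f x * (∑ j ∈ Finset.range (N + 1), d j • v j : Lp ℝ 2 μ) x) =ᵐ[μ]
      fun x => ∑ j ∈ Finset.range (N + 1), d j * (f x * v j x) := by
    filter_upwards [Lp.coeFn_finsetSum (Finset.range (N + 1)) fun j => d j • v j, hsmul]
      with x hsum hx
    simp only [hsum, Finset.sum_apply, hx, Finset.mul_sum, mul_left_comm (f x)]
  have hterm : ∀ j ∈ Finset.range (N + 1), Integrable (fun x => d j * (f x * v j x)) μ :=
    fun j hj => (hint j (hmem j hj)).const_mul (d j)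
  refine ⟨(integrable_finsetSum _ hterm).congr hexpand.symm, ?_⟩
  rw [integral_congr_ae hexpand, integral_finsetSum _ hterm]
  refine Finset.sum_eq_zero fun j hj => ?_
  rw [integral_const_mul, hzero j (hmem j hj), mul_zero]

lemma KernelDominated.lintegral_enorm_mul_le {C : ℝ≥0} (hT : KernelDominated μ K C T)
    (ψ : Lp ℝ 2 μ) :
    ∫⁻ x, ‖f x * T ψ x‖ₑ ∂μ ≤ C * ∫⁻ x, ‖f x‖ₑ * kernelOp μ K (fun y => ‖ψ y‖ₑ) x ∂μ := by
  rw [← lintegral_const_mul' _ _ ENNReal.coe_ne_top]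
  refine lintegral_mono_ae ?_
  filter_upwards [hT ψ] with x hx
  rw [enorm_mul, mul_left_comm]
  gcongr

lemma enorm_integral_mul_add_le {v e : Lp ℝ 2 μ} (hf : AEMeasurable f μ)
    (he : Integrable (fun x => f x * e x) μ) (hzero : ∫ x, f x * e x ∂μ = 0) :
    ‖∫ x, f x * (v + e) x ∂μ‖ₑ ≤ ∫⁻ x, ‖f x * v x‖ₑ ∂μ := by
  rcases eq_or_ne (∫⁻ x, ‖f x * v x‖ₑ ∂μ) ∞ with htop | hne_top
  · rw [htop]
    exact le_top
  have hv : Integrable (fun x => f x * v x) μ :=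
    ⟨hf.aestronglyMeasurable.mul (Lp.aestronglyMeasurable v), hne_top.lt_top⟩
  have hsplit : (fun x => f x * (v + e) x) =ᵐ[μ] fun x => f x * v x + f x * e x := by
    filter_upwards [Lp.coeFn_add v e] with x hx
    rw [hx, Pi.add_apply, mul_add]
  rw [integral_congr_ae hsplit, integral_add hv he, hzero, add_zero]
  exact enorm_integral_le_lintegral_enorm _

end Duality

namespace IsKernelSmoothing

variable {b : HilbertBasis ℕ ℝ (Lp ℝ 2 μ)} {ev : ℕ → ℝ} {I : ℕ}

theorem exists_ae_enorm_le_kernelOp [SigmaFinite μ]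
    (h : IsKernelSmoothing μ K w (multiplierOp b ev⁻¹)) (hK : Measurable (Function.uncurry K))
    (hsymm : ∀ x y, K x y = K y x) (hpos : ∀ j, 0 < ev j) (hmono : Monotone ev)
    (hgap : ev I < ev (I + 1)) (m : ℝ) :
    ∃ C : ℝ≥0, ∀ lam ∉ range ev, -m ≤ lam → lam ≤ ev I → ∀ f u : X → ℝ,
      Integrable (fun x => f x * w x) μ → (∀ j ≤ I, ∫ x, f x * b j x ∂μ = 0) →
      Integrable (fun x => u x * w x) μ →
      (∀ ψ : Lp ℝ 2 μ, (∃ M : ℝ, ∀ᵐ x ∂μ, |ψ x| ≤ M * w x) →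
        ∫ x, u x * ψ x ∂μ = ∫ x, f x * multiplierOp b (fun j => (ev j - lam)⁻¹) ψ x ∂μ) →
      ∀ᵐ x ∂μ, ‖u x‖ₑ ≤ C * kernelOp μ K (fun y => ‖f y‖ₑ) x := by
  obtain ⟨C, hC⟩ := h.exists_multiplierOp_inv_sub_decomposition hpos hmono hgap m
  refine ⟨C, fun lam hlam hm hlamI f u hf hfb hu hweak => ?_⟩
  obtain ⟨R, hR, hdec⟩ := hC lam hlam hm hlamI
  have hw := h.memLp_weight
  have hfm := aemeasurable_of_integrable_mul h.weight_pos hw.1.aemeasurable hf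
  refine ae_enorm_le_of_forall_enorm_integral_mul_le h.weight_pos hw hu fun ψ hψ => ?_
  obtain ⟨d, hd⟩ := hdec ψ
  obtain ⟨hint, hzero⟩ := integrable_mul_sum_smul (fun j _ => by
    obtain ⟨M, hM⟩ := h.exists_abs_basis_le hpos hmono j
    exact integrable_mul_of_abs_le h.weight_pos hw.1.aemeasurable hf (Lp.aestronglyMeasurable _)
      hM) hfb d
  rw [hweak ψ hψ, hd]
  calc ‖∫ x, f x * (R ψ + ∑ j ∈ Finset.range (I + 1), d j • b j) x ∂μ‖ₑ
      ≤ ∫⁻ x, ‖f x * R ψ x‖ₑ ∂μ := enorm_integral_mul_add_le hfm hint hzero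
    _ ≤ C * ∫⁻ x, ‖f x‖ₑ * kernelOp μ K (fun y => ‖ψ y‖ₑ) x ∂μ := hR.lintegral_enorm_mul_le ψ
    _ = ∫⁻ x, C * kernelOp μ K (fun y => ‖f y‖ₑ) x * ‖ψ x‖ₑ ∂μ := by
        simp only [mul_assoc, lintegral_const_mul' _ _ ENNReal.coe_ne_top]
        rw [lintegral_mul_kernelOp hK hsymm (Lp.aestronglyMeasurable ψ).enorm hfm.enorm]

lemma integral_mul_basis_eq_zero (h : IsKernelSmoothing μ K w (multiplierOp b ev⁻¹))
    (hpos : ∀ j, 0 < ev j) (hmono : Monotone ev) (hgap : ev I < ev (I + 1)) {lam : ℝ}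
    (hlamI : lam ≤ ev I) (hweak : ∀ ψ : Lp ℝ 2 μ, (∃ M : ℝ, ∀ᵐ x ∂μ, |ψ x| ≤ M * w x) →
      ∫ x, u x * ψ x ∂μ = ∫ x, f x * multiplierOp b (fun j => (ev j - lam)⁻¹) ψ x ∂μ) {j : ℕ}
    (hfj : ∫ x, f x * b j x ∂μ = 0) : ∫ x, u x * b j x ∂μ = 0 := by
  obtain ⟨B, hB⟩ := exists_forall_norm_inv_sub_le hmono hlamI hgap
  have hsmul : (fun x => f x * ((ev j - lam)⁻¹ • b j) x) =ᵐ[μ]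
      fun x => (ev j - lam)⁻¹ * (f x * b j x) := by
    filter_upwards [Lp.coeFn_smul (ev j - lam)⁻¹ (b j)] with x hx
    rw [hx, Pi.smul_apply, smul_eq_mul, mul_left_comm]
  rw [hweak _ (h.exists_abs_basis_le hpos hmono j), multiplierOp_basis b hB,
    integral_congr_ae hsmul, integral_const_mul, hfj, mul_zero]

end IsKernelSmoothing

end KernelSmoothing

section BoundedSet

variable {E : Type*} [NormedAddCommGroup E] [NormedSpace ℝ E] [FiniteDimensional ℝ E]
  [Nontrivial E] [MeasurableSpace E] [BorelSpace E] (μ : Measure E) [μ.IsAddHaarMeasure]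

lemma exists_setLIntegral_norm_sub_rpow_le {S : Set E} (hS : Bornology.IsBounded S) {β : ℝ}
    (hβ : -finrank ℝ E < β) :
    ∃ C : ℝ≥0, ∀ x ∈ S, ∫⁻ y in S, ENNReal.ofReal (‖x - y‖ ^ β) ∂μ ≤ C := by
  obtain ⟨D, hD, hSD⟩ := hS.exists_pos_norm_le
  obtain ⟨C, -, hball⟩ := exists_setLIntegral_ball_norm_sub_rpow_le μ hβ
  refine ⟨(C * (3 * D) ^ (finrank ℝ E + β)).toNNReal, fun x hx => ?_⟩
  refine (lintegral_mono_set fun y hy => ?_).trans (hball (3 * D) (by positivity) x)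
  rw [Metric.mem_ball, dist_eq_norm]
  linarith [norm_sub_le y x, hSD x hx, hSD y hy]

end BoundedSet

section QuasiDist

variable {n : ℕ} {Ω : Set (EuclideanSpace ℝ (Fin n))} {s γ : ℝ} {x y z : EuclideanSpace ℝ (Fin n)}

@[fun_prop]
lemma continuous_bdist : Continuous (bdist Ω) := Metric.continuous_infDist_pt _

lemma bdist_nonneg : 0 ≤ bdist Ω x := Metric.infDist_nonneg

lemma bdist_le_add (x y : EuclideanSpace ℝ (Fin n)) : bdist Ω x ≤ bdist Ω y + ‖x - y‖ := by
  rw [← dist_eq_norm]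
  exact Metric.infDist_le_infDist_add_dist

namespace IsBoundedC11

lemma frontier_nonempty [NeZero n] (hΩ : IsBoundedC11 Ω) : (frontier Ω).Nonempty :=
  nonempty_frontier_iff.2
    ⟨hΩ.nonempty, fun h => NormedSpace.unbounded_univ ℝ (EuclideanSpace ℝ (Fin n)) (h ▸ hΩ.bounded)⟩

lemma bdist_pos [NeZero n] (hΩ : IsBoundedC11 Ω) (hx : x ∈ Ω) : 0 < bdist Ω x := by
  refine (isClosed_frontier.notMem_iff_infDist_pos hΩ.frontier_nonempty).1 fun h => ?_
  rw [hΩ.isOpen.frontier_eq] at h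
  exact h.2 hx

lemma exists_bound [NeZero n] (hΩ : IsBoundedC11 Ω) :
    ∃ D : ℝ, 1 ≤ D ∧ (∀ x ∈ Ω, bdist Ω x ≤ D) ∧ ∀ x ∈ Ω, ∀ y ∈ Ω, ‖x - y‖ ≤ D := by
  have hdist {x y : EuclideanSpace ℝ (Fin n)} (hx : x ∈ closure Ω) (hy : y ∈ closure Ω) :
      dist x y ≤ max 1 (Metric.diam (closure Ω)) :=
    (Metric.dist_le_diam_of_mem hΩ.bounded.closure hx hy).trans (le_max_right _ _)
  obtain ⟨z, hz⟩ := hΩ.frontier_nonempty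
  refine ⟨_, le_max_left 1 (Metric.diam (closure Ω)), fun x hx => ?_, fun x hx y hy => ?_⟩
  · exact (Metric.infDist_le_dist_of_mem hz).trans
      (hdist (subset_closure hx) (frontier_subset_closure hz))
  · exact dist_eq_norm x y ▸ hdist (subset_closure hx) (subset_closure hy)

end IsBoundedC11

/-- The largest of `|x - y|`, `δ(x)` and `δ(y)`. -/
noncomputable def maxDist (Ω : Set (EuclideanSpace ℝ (Fin n))) (x y : EuclideanSpace ℝ (Fin n)) :
    ℝ :=
  max ‖x - y‖ (max (bdist Ω x) (bdist Ω y))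

/-- The quasi-metric `d` for which the model kernel is comparable to `δ^γ(x) δ^γ(y) / d(x, y)`. -/
noncomputable def quasiDist (Ω : Set (EuclideanSpace ℝ (Fin n))) (s γ : ℝ)
    (x y : EuclideanSpace ℝ (Fin n)) : ℝ :=
  ‖x - y‖ ^ ((n : ℝ) - 2 * s) * maxDist Ω x y ^ (2 * γ)

lemma norm_sub_le_maxDist : ‖x - y‖ ≤ maxDist Ω x y := le_max_left _ _

lemma bdist_le_maxDist_left : bdist Ω x ≤ maxDist Ω x y :=
  le_max_of_le_right (le_max_left _ _)

lemma bdist_le_maxDist_right : bdist Ω y ≤ maxDist Ω x y :=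
  le_max_of_le_right (le_max_right _ _)

lemma maxDist_comm (x y : EuclideanSpace ℝ (Fin n)) : maxDist Ω x y = maxDist Ω y x := by
  rw [maxDist, maxDist, norm_sub_rev, max_comm (bdist Ω x)]

lemma maxDist_nonneg : 0 ≤ maxDist Ω x y := (norm_nonneg _).trans norm_sub_le_maxDist

lemma maxDist_pos (hxy : x ≠ y) : 0 < maxDist Ω x y :=
  (norm_sub_pos_iff.2 hxy).trans_le norm_sub_le_maxDist

lemma maxDist_le_three_mul (h : ‖x - y‖ ≤ 2 * ‖x - z‖) : maxDist Ω x y ≤ 3 * maxDist Ω x z := by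
  have hnorm : ‖x - z‖ ≤ maxDist Ω x z := norm_sub_le_maxDist
  have hx : bdist Ω x ≤ maxDist Ω x z := bdist_le_maxDist_left
  have hy : bdist Ω y ≤ bdist Ω x + ‖x - y‖ := norm_sub_rev x y ▸ bdist_le_add y x
  have hnonneg : 0 ≤ maxDist Ω x z := maxDist_nonneg
  exact max_le (by linarith) (max_le (by linarith) (by linarith))

lemma quasiDist_comm (x y : EuclideanSpace ℝ (Fin n)) :
    quasiDist Ω s γ x y = quasiDist Ω s γ y x := by
  rw [quasiDist, quasiDist, maxDist_comm, norm_sub_rev]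

lemma quasiDist_nonneg : 0 ≤ quasiDist Ω s γ x y :=
  mul_nonneg (Real.rpow_nonneg (norm_nonneg _) _) (Real.rpow_nonneg maxDist_nonneg _)

lemma quasiDist_pos (hxy : x ≠ y) : 0 < quasiDist Ω s γ x y :=
  mul_pos (Real.rpow_pos_of_pos (norm_sub_pos_iff.2 hxy) _)
    (Real.rpow_pos_of_pos (maxDist_pos hxy) _)

lemma measurable_quasiDist : Measurable (Function.uncurry (quasiDist Ω s γ)) := by
  have hδ : Measurable (bdist Ω) := continuous_bdist.measurable
  have hnorm : Measurable fun z : EuclideanSpace ℝ (Fin n) × EuclideanSpace ℝ (Fin n) =>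
    ‖z.1 - z.2‖ := by fun_prop
  exact (hnorm.pow_const _).mul ((hnorm.max
    ((hδ.comp measurable_fst).max (hδ.comp measurable_snd))).pow_const _)

lemma quasiDist_le_of_norm_le (hs : 2 * s ≤ n) (hγ : 0 ≤ γ) (h : ‖x - y‖ ≤ 2 * ‖x - z‖) :
    quasiDist Ω s γ x y ≤ 2 ^ ((n : ℝ) - 2 * s) * 3 ^ (2 * γ) * quasiDist Ω s γ x z := by
  have hmax : 0 ≤ maxDist Ω x z := maxDist_nonneg
  calc quasiDist Ω s γ x y
      ≤ (2 * ‖x - z‖) ^ ((n : ℝ) - 2 * s) * (3 * maxDist Ω x z) ^ (2 * γ) :=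
        mul_le_mul (Real.rpow_le_rpow (norm_nonneg _) h (by linarith))
          (Real.rpow_le_rpow maxDist_nonneg (maxDist_le_three_mul h) (by linarith))
          (Real.rpow_nonneg maxDist_nonneg _) (by positivity)
    _ = _ := by
        rw [Real.mul_rpow (by norm_num) (norm_nonneg _), Real.mul_rpow (by norm_num) hmax,
          quasiDist]
        ring

lemma exists_quasiDist_le_max (hs : 2 * s ≤ n) (hγ : 0 ≤ γ) :
    ∃ Q : ℝ, 1 ≤ Q ∧ ∀ x y z : EuclideanSpace ℝ (Fin n),
      quasiDist Ω s γ x y ≤ Q * max (quasiDist Ω s γ x z) (quasiDist Ω s γ z y) := by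
  have hQ : (0 : ℝ) ≤ 2 ^ ((n : ℝ) - 2 * s) * 3 ^ (2 * γ) := by positivity
  refine ⟨2 ^ ((n : ℝ) - 2 * s) * 3 ^ (2 * γ), one_le_mul_of_one_le_of_one_le
    (Real.one_le_rpow (by norm_num) (by linarith))
    (Real.one_le_rpow (by norm_num) (by linarith)), fun x y z => ?_⟩
  have htri := norm_sub_le_norm_sub_add_norm_sub x z y
  rcases le_total ‖z - y‖ ‖x - z‖ with hle | hle
  · exact (quasiDist_le_of_norm_le hs hγ (by linarith)).trans
      (mul_le_mul_of_nonneg_left (le_max_left _ _) hQ)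
  · rw [quasiDist_comm x y, quasiDist_comm z y]
    rw [norm_sub_rev x y, norm_sub_rev z y] at htri
    rw [norm_sub_rev z y] at hle
    exact (quasiDist_le_of_norm_le hs hγ (by linarith)).trans
      (mul_le_mul_of_nonneg_left (le_max_right _ _) hQ)

lemma IsBoundedC11.exists_quasiDist_le [NeZero n] (hΩ : IsBoundedC11 Ω) (hs : 2 * s ≤ n)
    (hγ : 0 ≤ γ) : ∃ D : ℝ, 1 ≤ D ∧ ∀ x ∈ Ω, ∀ y ∈ Ω, quasiDist Ω s γ x y ≤ D := by
  obtain ⟨D, hD, hδD, hnormD⟩ := hΩ.exists_bound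
  refine ⟨D ^ ((n : ℝ) - 2 * s) * D ^ (2 * γ), one_le_mul_of_one_le_of_one_le
    (Real.one_le_rpow hD (by linarith)) (Real.one_le_rpow hD (by linarith)), fun x hx y hy => ?_⟩
  exact mul_le_mul (Real.rpow_le_rpow (norm_nonneg _) (hnormD x hx y hy) (by linarith))
    (Real.rpow_le_rpow maxDist_nonneg
      (max_le (hnormD x hx y hy) (max_le (hδD x hx) (hδD y hy))) (by linarith))
    (Real.rpow_nonneg maxDist_nonneg _) (by positivity)

lemma quasiDist_rpow_mul_bdist_rpow_le (hγ : 0 ≤ γ) {ε : ℝ} (hε : 0 ≤ ε) (hxz : x ≠ z) :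
    quasiDist Ω s γ x z ^ (-(1 + ε)) * bdist Ω z ^ (2 * γ) ≤
      ‖x - z‖ ^ (-(((n : ℝ) - 2 * s) * (1 + ε) + 2 * γ * ε)) := by
  have hr : 0 < ‖x - z‖ := norm_sub_pos_iff.2 hxz
  have hM : 0 < maxDist Ω x z := maxDist_pos hxz
  have hδ : 0 ≤ bdist Ω z := bdist_nonneg
  have hmax_rpow : maxDist Ω x z ^ (2 * γ * -(1 + ε)) =
      maxDist Ω x z ^ (-(2 * γ)) * maxDist Ω x z ^ (-(2 * γ * ε)) := by
    rw [← Real.rpow_add hM]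
    ring_nf
  have hnorm_rpow : ‖x - z‖ ^ (-(((n : ℝ) - 2 * s) * (1 + ε) + 2 * γ * ε)) =
      ‖x - z‖ ^ (((n : ℝ) - 2 * s) * -(1 + ε)) * ‖x - z‖ ^ (-(2 * γ * ε)) := by
    rw [← Real.rpow_add hr]
    ring_nf
  have hmax_le : maxDist Ω x z ^ (-(2 * γ * ε)) ≤ ‖x - z‖ ^ (-(2 * γ * ε)) :=
    Real.rpow_le_rpow_of_nonpos hr norm_sub_le_maxDist (by nlinarith [mul_nonneg hγ hε])
  have hbdist_le : maxDist Ω x z ^ (-(2 * γ)) * bdist Ω z ^ (2 * γ) ≤ 1 := by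
    rw [Real.rpow_neg hM.le, inv_mul_le_one₀ (by positivity)]
    exact Real.rpow_le_rpow bdist_nonneg bdist_le_maxDist_right (by linarith)
  rw [quasiDist, Real.mul_rpow (by positivity) (by positivity), ← Real.rpow_mul hr.le,
    ← Real.rpow_mul hM.le, hmax_rpow, hnorm_rpow]
  calc _ = ‖x - z‖ ^ (((n : ℝ) - 2 * s) * -(1 + ε)) * (maxDist Ω x z ^ (-(2 * γ * ε)) *
        (maxDist Ω x z ^ (-(2 * γ)) * bdist Ω z ^ (2 * γ))) := by ring
    _ ≤ ‖x - z‖ ^ (((n : ℝ) - 2 * s) * -(1 + ε)) * (‖x - z‖ ^ (-(2 * γ * ε)) * 1) := by gcongr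
    _ = _ := by ring

end QuasiDist

section ModelKernel

variable {n : ℕ} {Ω : Set (EuclideanSpace ℝ (Fin n))} {s γ : ℝ} {x y : EuclideanSpace ℝ (Fin n)}

lemma min_div_mul_min_div_le {a b r : ℝ} (ha : 0 < a) (hb : 0 < b) (hr : 0 < r)
    (hab : a ≤ b + r) (hba : b ≤ a + r) :
    min (a / r) 1 * min (b / r) 1 ≤ 4 * (a * b / max r (max a b) ^ 2) := by
  wlog hle : b ≤ a generalizing a b
  · have hswap := this hb ha hba hab (le_of_not_ge hle)
    rwa [mul_comm, mul_comm a b, max_comm a b]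
  rw [max_eq_left hle]
  have hmin : 0 ≤ min (b / r) 1 := le_min (by positivity) zero_le_one
  rcases le_total a r with har | har
  · rw [max_eq_left har]
    calc min (a / r) 1 * min (b / r) 1 ≤ (a / r) * (b / r) :=
          mul_le_mul (min_le_left _ _) (min_le_left _ _) hmin (by positivity)
      _ = a * b / r ^ 2 := by field_simp
      _ ≤ _ := by linarith [show 0 ≤ a * b / r ^ 2 by positivity]
  · rw [max_eq_right har]
    calc min (a / r) 1 * min (b / r) 1 ≤ min (b / r) 1 :=
          mul_le_of_le_one_left hmin (min_le_right _ _)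
      _ ≤ 4 * b / a := by
          rcases le_total a (2 * r) with h2r | h2r
          · refine (min_le_left _ _).trans ?_
            rw [div_le_div_iff₀ hr ha]
            nlinarith
          · refine (min_le_right _ _).trans ?_
            rw [le_div_iff₀ ha]
            linarith
      _ = 4 * (a * b / a ^ 2) := by field_simp

lemma div_max_mul_div_max_le {a b r : ℝ} (ha : 0 ≤ a) (hb : 0 ≤ b) (hr : 0 < r) :
    a * b / max r (max a b) ^ 2 ≤ min (a / r) 1 * min (b / r) 1 := by
  have hM : 0 < max r (max a b) := lt_max_of_lt_left hr
  have hdiv_le {c : ℝ} (hc : 0 ≤ c) (hcM : c ≤ max r (max a b)) :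
      c / max r (max a b) ≤ min (c / r) 1 :=
    le_min (div_le_div_of_nonneg_left hc hr (le_max_left _ _)) ((div_le_one hM).2 hcM)
  rw [sq, mul_div_mul_comm]
  exact mul_le_mul (hdiv_le ha (by simp)) (hdiv_le hb (by simp)) (by positivity)
    (le_min (by positivity) zero_le_one)

lemma min_rpow_div_rpow_one {a r : ℝ} (ha : 0 ≤ a) (hr : 0 ≤ r) (hγ : 0 ≤ γ) :
    min (a ^ γ / r ^ γ) 1 = min (a / r) 1 ^ γ := by
  rw [← Real.div_rpow ha hr]
  rcases le_total (a / r) 1 with h | h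
  · rw [min_eq_left h, min_eq_left (Real.rpow_le_one (by positivity) h hγ)]
  · rw [min_eq_right h, min_eq_right (Real.one_le_rpow h hγ), Real.one_rpow]

lemma modelKernel_eq_mul_rpow (hγ : 0 ≤ γ) :
    modelKernel Ω s γ x y = ‖x - y‖ ^ (-((n : ℝ) - 2 * s)) *
      (min (bdist Ω x / ‖x - y‖) 1 * min (bdist Ω y / ‖x - y‖) 1) ^ γ := by
  have hmin (z : EuclideanSpace ℝ (Fin n)) : 0 ≤ min (bdist Ω z / ‖x - y‖) 1 :=
    le_min (div_nonneg bdist_nonneg (norm_nonneg _)) zero_le_one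
  rw [modelKernel, min_rpow_div_rpow_one bdist_nonneg (norm_nonneg _) hγ,
    min_rpow_div_rpow_one bdist_nonneg (norm_nonneg _) hγ, Real.mul_rpow (hmin x) (hmin y),
    Real.rpow_neg (norm_nonneg _), one_div, mul_assoc]

/-- The powers `δ^γ(x) δ^γ(y) d(x, y)^(-τ)` of the quasi-metric. They interpolate between the model
kernel (`τ = 1`, up to constants) and the product `δ^γ(x) δ^γ(y)` (`τ = 0`). -/
noncomputable def potKernel (Ω : Set (EuclideanSpace ℝ (Fin n))) (s γ τ : ℝ)
    (x y : EuclideanSpace ℝ (Fin n)) : ℝ≥0∞ :=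
  ENNReal.ofReal (bdist Ω x ^ γ * bdist Ω y ^ γ * quasiDist Ω s γ x y ^ (-τ))

lemma potKernel_comm {τ : ℝ} (x y : EuclideanSpace ℝ (Fin n)) :
    potKernel Ω s γ τ x y = potKernel Ω s γ τ y x := by
  rw [potKernel, potKernel, quasiDist_comm, mul_comm (bdist Ω x ^ γ)]

lemma measurable_potKernel {τ : ℝ} : Measurable (Function.uncurry (potKernel Ω s γ τ)) := by
  have hδ : Measurable (bdist Ω) := continuous_bdist.measurable
  exact ((((hδ.comp measurable_fst).pow_const γ).mul ((hδ.comp measurable_snd).pow_const γ)).mul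
    (measurable_quasiDist.pow_const _)).ennreal_ofReal

lemma potKernel_zero : potKernel Ω s γ 0 x y = ‖bdist Ω x ^ γ‖ₑ * ‖bdist Ω y ^ γ‖ₑ := by
  rw [potKernel, neg_zero, Real.rpow_zero, mul_one,
    ENNReal.ofReal_mul (Real.rpow_nonneg bdist_nonneg _),
    Real.enorm_of_nonneg (Real.rpow_nonneg bdist_nonneg _),
    Real.enorm_of_nonneg (Real.rpow_nonneg bdist_nonneg _)]

lemma potKernel_one (hxy : x ≠ y) :
    potKernel Ω s γ 1 x y = ENNReal.ofReal (‖x - y‖ ^ (-((n : ℝ) - 2 * s)) *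
      (bdist Ω x * bdist Ω y / maxDist Ω x y ^ 2) ^ γ) := by
  have hr : 0 < ‖x - y‖ := norm_sub_pos_iff.2 hxy
  have hM : 0 < maxDist Ω x y := maxDist_pos hxy
  rw [potKernel, quasiDist, Real.mul_rpow (by positivity) (by positivity), ← Real.rpow_mul hr.le,
    ← Real.rpow_mul hM.le, Real.div_rpow (mul_nonneg bdist_nonneg bdist_nonneg) (by positivity),
    Real.mul_rpow bdist_nonneg bdist_nonneg, ← Real.rpow_natCast, ← Real.rpow_mul hM.le,
    mul_neg_one, mul_neg_one, Real.rpow_neg hM.le, div_eq_mul_inv]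
  push_cast
  ring_nf

lemma IsBoundedC11.ofReal_modelKernel_le_potKernel [NeZero n] (hΩ : IsBoundedC11 Ω) (hγ : 0 ≤ γ)
    (hx : x ∈ Ω) (hy : y ∈ Ω) (hxy : x ≠ y) :
    ENNReal.ofReal (modelKernel Ω s γ x y) ≤ (4 ^ γ : ℝ≥0) * potKernel Ω s γ 1 x y := by
  have hxpos := hΩ.bdist_pos hx
  have hypos := hΩ.bdist_pos hy
  have hbase : min (bdist Ω x / ‖x - y‖) 1 * min (bdist Ω y / ‖x - y‖) 1 ≤
      4 * (bdist Ω x * bdist Ω y / maxDist Ω x y ^ 2) :=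
    min_div_mul_min_div_le hxpos hypos (norm_sub_pos_iff.2 hxy) (bdist_le_add x y)
      (norm_sub_rev x y ▸ bdist_le_add y x)
  rw [potKernel_one hxy, ← ENNReal.ofReal_coe_nnreal, ← ENNReal.ofReal_mul (by positivity),
    modelKernel_eq_mul_rpow hγ]
  refine ENNReal.ofReal_le_ofReal ?_
  calc _ ≤ ‖x - y‖ ^ (-((n : ℝ) - 2 * s)) *
        (4 * (bdist Ω x * bdist Ω y / maxDist Ω x y ^ 2)) ^ γ := by gcongr
    _ = _ := by
        rw [Real.mul_rpow (by norm_num) (by positivity)]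
        push_cast
        ring

lemma potKernel_le_ofReal_modelKernel (hγ : 0 ≤ γ) (hxy : x ≠ y) :
    potKernel Ω s γ 1 x y ≤ ENNReal.ofReal (modelKernel Ω s γ x y) := by
  rw [potKernel_one hxy, modelKernel_eq_mul_rpow hγ]
  refine ENNReal.ofReal_le_ofReal (mul_le_mul_of_nonneg_left (Real.rpow_le_rpow ?_
    (div_max_mul_div_max_le bdist_nonneg bdist_nonneg (norm_sub_pos_iff.2 hxy)) hγ) (by positivity))
  exact div_nonneg (mul_nonneg bdist_nonneg bdist_nonneg) (sq_nonneg _)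

end ModelKernel

section Potential

variable {n : ℕ} {Ω : Set (EuclideanSpace ℝ (Fin n))} {s γ : ℝ} {x y z : EuclideanSpace ℝ (Fin n)}

lemma max_rpow_neg_le {a b d Q t : ℝ} (ha : 0 < a) (hd : 0 < d) (hQ : 1 ≤ Q)
    (h : d ≤ Q * max a b) (ht : t ∈ Icc (0 : ℝ) 1) : max a b ^ (-t) ≤ Q * d ^ (-t) := by
  have hQpos : 0 < Q := by linarith
  have hmax : 0 < max a b := lt_max_of_lt_left ha
  calc max a b ^ (-t) = Q ^ t * (Q * max a b) ^ (-t) := by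
        rw [Real.mul_rpow hQpos.le hmax.le, ← mul_assoc, ← Real.rpow_add hQpos]
        simp
    _ ≤ Q * d ^ (-t) := by
        gcongr ?_ * ?_
        · exact Real.rpow_le_self_of_one_le hQ ht.2
        · exact Real.rpow_le_rpow_of_nonpos hd h (neg_nonpos.2 ht.1)

lemma inv_mul_rpow_neg_le {a b ε τ : ℝ} (ha : 0 < a) (hb : 0 < b) (hε : 0 ≤ ε) (hτ : τ ≤ 1) :
    a ^ (-1 : ℝ) * b ^ (-τ) ≤ max a b ^ (-(τ - ε)) * (a ^ (-(1 + ε)) + b ^ (-(1 + ε))) := by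
  rcases le_total a b with hab | hab
  · rw [max_eq_right hab]
    calc a ^ (-1 : ℝ) * b ^ (-τ) = b ^ (-(τ - ε)) * (a ^ (-1 : ℝ) * b ^ (-ε)) := by
          rw [mul_left_comm, ← Real.rpow_add hb]
          ring_nf
      _ ≤ b ^ (-(τ - ε)) * (a ^ (-1 : ℝ) * a ^ (-ε)) := by
          gcongr _ * (_ * ?_)
          exact Real.rpow_le_rpow_of_nonpos ha hab (by linarith)
      _ = b ^ (-(τ - ε)) * a ^ (-(1 + ε)) := by
          rw [← Real.rpow_add ha]
          ring_nf
      _ ≤ _ := by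
          gcongr
          exact le_add_of_nonneg_right (by positivity)
  · rw [max_eq_left hab]
    calc a ^ (-1 : ℝ) * b ^ (-τ) = a ^ (-(τ - ε)) * (a ^ (-(1 - τ + ε)) * b ^ (-τ)) := by
          rw [← mul_assoc, ← Real.rpow_add ha]
          ring_nf
      _ ≤ a ^ (-(τ - ε)) * (b ^ (-(1 - τ + ε)) * b ^ (-τ)) := by
          gcongr _ * (?_ * _)
          exact Real.rpow_le_rpow_of_nonpos hb hab (by linarith)
      _ = a ^ (-(τ - ε)) * b ^ (-(1 + ε)) := by
          rw [← Real.rpow_add hb]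
          ring_nf
      _ ≤ _ := by
          gcongr
          exact le_add_of_nonneg_left (by positivity)

lemma quasiDist_rpow_mul_quasiDist_rpow_mul_bdist_rpow_le (hγ : 0 ≤ γ) {Q ε τ : ℝ}
    (hQ : 1 ≤ Q)
    (hxzy : quasiDist Ω s γ x y ≤ Q * max (quasiDist Ω s γ x z) (quasiDist Ω s γ z y))
    (hε : 0 ≤ ε) (hετ : ε ≤ τ) (hτ : τ ≤ 1) (hxy : x ≠ y) (hzx : z ≠ x) (hzy : z ≠ y) :
    quasiDist Ω s γ x z ^ (-1 : ℝ) * quasiDist Ω s γ z y ^ (-τ) * bdist Ω z ^ (2 * γ) ≤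
      Q * quasiDist Ω s γ x y ^ (-(τ - ε)) *
        (‖x - z‖ ^ (-(((n : ℝ) - 2 * s) * (1 + ε) + 2 * γ * ε)) +
          ‖y - z‖ ^ (-(((n : ℝ) - 2 * s) * (1 + ε) + 2 * γ * ε))) := by
  have hdxz : 0 < quasiDist Ω s γ x z := quasiDist_pos hzx.symm
  have hdzy : 0 < quasiDist Ω s γ z y := quasiDist_pos hzy
  have hdxy : 0 < quasiDist Ω s γ x y := quasiDist_pos hxy
  have hδz : 0 ≤ bdist Ω z := bdist_nonneg
  have hsum : (quasiDist Ω s γ x z ^ (-(1 + ε)) + quasiDist Ω s γ z y ^ (-(1 + ε))) *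
      bdist Ω z ^ (2 * γ) ≤ ‖x - z‖ ^ (-(((n : ℝ) - 2 * s) * (1 + ε) + 2 * γ * ε)) +
        ‖y - z‖ ^ (-(((n : ℝ) - 2 * s) * (1 + ε) + 2 * γ * ε)) := by
    rw [add_mul, quasiDist_comm z y]
    exact add_le_add (quasiDist_rpow_mul_bdist_rpow_le hγ hε hzx.symm)
      (quasiDist_rpow_mul_bdist_rpow_le hγ hε hzy.symm)
  calc _ ≤ Q * quasiDist Ω s γ x y ^ (-(τ - ε)) * (quasiDist Ω s γ x z ^ (-(1 + ε)) +
        quasiDist Ω s γ z y ^ (-(1 + ε))) * bdist Ω z ^ (2 * γ) := by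
        gcongr ?_ * _
        refine (inv_mul_rpow_neg_le hdxz hdzy hε hτ).trans ?_
        gcongr
        exact max_rpow_neg_le hdxz hdxy hQ hxzy ⟨by linarith, by linarith⟩
    _ ≤ _ := by
        rw [mul_assoc]
        gcongr

lemma potKernel_mul_potKernel_le (hγ : 0 ≤ γ) {Q ε τ : ℝ} (hQ : 1 ≤ Q)
    (hxzy : quasiDist Ω s γ x y ≤ Q * max (quasiDist Ω s γ x z) (quasiDist Ω s γ z y))
    (hε : 0 ≤ ε) (hετ : ε ≤ τ) (hτ : τ ≤ 1) (hxy : x ≠ y) (hzx : z ≠ x) (hzy : z ≠ y) :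
    potKernel Ω s γ 1 x z * potKernel Ω s γ τ z y ≤
      ENNReal.ofReal Q * potKernel Ω s γ (τ - ε) x y *
        (ENNReal.ofReal (‖x - z‖ ^ (-(((n : ℝ) - 2 * s) * (1 + ε) + 2 * γ * ε))) +
          ENNReal.ofReal (‖y - z‖ ^ (-(((n : ℝ) - 2 * s) * (1 + ε) + 2 * γ * ε)))) := by
  have hδ (v : EuclideanSpace ℝ (Fin n)) : 0 ≤ bdist Ω v := bdist_nonneg
  have hd (v w : EuclideanSpace ℝ (Fin n)) : 0 ≤ quasiDist Ω s γ v w := quasiDist_nonneg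
  have hz : bdist Ω z ^ (2 * γ) = bdist Ω z ^ γ * bdist Ω z ^ γ := by
    rw [two_mul, Real.rpow_add_of_nonneg (hδ z) hγ hγ]
  have hδxy : 0 ≤ bdist Ω x ^ γ * bdist Ω y ^ γ := by have := hδ x; have := hδ y; positivity
  have hle := mul_le_mul_of_nonneg_left
    (quasiDist_rpow_mul_quasiDist_rpow_mul_bdist_rpow_le hγ hQ hxzy hε hετ hτ hxy hzx hzy) hδxy
  have := hδ x; have := hδ y; have := hδ z; have := hd x z; have := hd x y
  rw [potKernel, potKernel, potKernel, ← ENNReal.ofReal_add (by positivity) (by positivity),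
    ← ENNReal.ofReal_mul (by positivity), ← ENNReal.ofReal_mul (zero_le_one.trans hQ),
    ← ENNReal.ofReal_mul (by positivity)]
  refine ENNReal.ofReal_le_ofReal ?_
  rw [hz] at hle
  linear_combination hle

lemma IsBoundedC11.exists_lintegral_potKernel_mul_le [NeZero n] (hΩ : IsBoundedC11 Ω)
    (hs : 2 * s ≤ n) (hγ : 0 ≤ γ) {ε τ : ℝ} (hε : 0 ≤ ε)
    (hεn : ((n : ℝ) - 2 * s) * (1 + ε) + 2 * γ * ε < n) (hετ : ε ≤ τ) (hτ : τ ≤ 1) :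
    ∃ C : ℝ≥0, ∀ᵐ x ∂(volume.restrict Ω), ∀ᵐ y ∂(volume.restrict Ω),
      ∫⁻ z in Ω, potKernel Ω s γ 1 x z * potKernel Ω s γ τ z y ≤
        C * potKernel Ω s γ (τ - ε) x y := by
  obtain ⟨Q, hQ, hquasi⟩ := exists_quasiDist_le_max (Ω := Ω) hs hγ
  obtain ⟨C, hC⟩ := exists_setLIntegral_norm_sub_rpow_le volume hΩ.bounded
    (β := -(((n : ℝ) - 2 * s) * (1 + ε) + 2 * γ * ε)) (by rw [finrank_euclideanSpace_fin]; linarith)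
  have hne (x : EuclideanSpace ℝ (Fin n)) : ∀ᵐ y ∂(volume.restrict Ω), y ≠ x :=
    ae_restrict_of_ae (Measure.ae_ne volume x)
  refine ⟨Q.toNNReal * (C + C), ?_⟩
  filter_upwards [ae_restrict_mem hΩ.isOpen.measurableSet] with x hx
  filter_upwards [ae_restrict_mem hΩ.isOpen.measurableSet, hne x] with y hy hyx
  calc ∫⁻ z in Ω, potKernel Ω s γ 1 x z * potKernel Ω s γ τ z y
      ≤ ∫⁻ z in Ω, ENNReal.ofReal Q * potKernel Ω s γ (τ - ε) x y *
        (ENNReal.ofReal (‖x - z‖ ^ (-(((n : ℝ) - 2 * s) * (1 + ε) + 2 * γ * ε))) +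
          ENNReal.ofReal (‖y - z‖ ^ (-(((n : ℝ) - 2 * s) * (1 + ε) + 2 * γ * ε)))) := by
        refine lintegral_mono_ae ?_
        filter_upwards [hne x, hne y] with z hzx hzy
        exact potKernel_mul_potKernel_le hγ hQ (hquasi x y z) hε hετ hτ hyx.symm hzx hzy
    _ ≤ ENNReal.ofReal Q * potKernel Ω s γ (τ - ε) x y * (C + C) := by
        rw [lintegral_const_mul _ (by fun_prop), lintegral_add_left (by fun_prop)]
        gcongr
        exacts [hC x hx, hC y hy]
    _ = _ := by
        push_cast
        rw [ENNReal.ofReal, mul_right_comm]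

lemma IsBoundedC11.exists_potKernel_le [NeZero n] (hΩ : IsBoundedC11 Ω) (hs : 2 * s ≤ n)
    (hγ : 0 ≤ γ) {τ τ' : ℝ} (hττ' : τ ≤ τ') :
    ∃ C : ℝ≥0, ∀ᵐ x ∂(volume.restrict Ω), ∀ᵐ y ∂(volume.restrict Ω),
      potKernel Ω s γ τ x y ≤ C * potKernel Ω s γ τ' x y := by
  obtain ⟨D, hD, hquasi⟩ := hΩ.exists_quasiDist_le hs hγ
  refine ⟨(D ^ (τ' - τ)).toNNReal, ?_⟩
  filter_upwards [ae_restrict_mem hΩ.isOpen.measurableSet] with x hx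
  filter_upwards [ae_restrict_mem hΩ.isOpen.measurableSet,
    ae_restrict_of_ae (Measure.ae_ne volume x)] with y hy hyx
  have hd : 0 < quasiDist Ω s γ x y := quasiDist_pos hyx.symm
  have hδx : 0 ≤ bdist Ω x := bdist_nonneg
  have hδy : 0 ≤ bdist Ω y := bdist_nonneg
  rw [potKernel, potKernel, ← ENNReal.ofReal, ← ENNReal.ofReal_mul (by positivity)]
  refine ENNReal.ofReal_le_ofReal ?_
  calc _ = quasiDist Ω s γ x y ^ (τ' - τ) *
        (bdist Ω x ^ γ * bdist Ω y ^ γ * quasiDist Ω s γ x y ^ (-τ')) := by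
        rw [mul_left_comm, ← Real.rpow_add hd]
        ring_nf
    _ ≤ _ := by
        gcongr
        exact hquasi x hx y hy

end Potential

section Boundary

lemma setLIntegral_comp_le_of_translate {E : Type*} [NormedAddCommGroup E] [NormedSpace ℝ E]
    [FiniteDimensional ℝ E] [MeasurableSpace E] [BorelSpace E] (μ : Measure E)
    [μ.IsAddHaarMeasure] {A : Set E} (hA : MeasurableSet A) {ρ : ℝ} (hAρ : A ⊆ Metric.ball 0 ρ)
    {F : E → ℝ} (hF : Measurable F) {ν : E} (hFν : ∀ x (t : ℝ), F (x + t • ν) = F x + t)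
    {k : ℝ → ℝ≥0∞} (hk : Measurable k) :
    ∫⁻ x in A, k (F x) ∂μ ≤ μ (Metric.ball 0 (ρ + ‖ν‖)) * ∫⁻ t, k t := by
  set g : E → ℝ≥0∞ := A.indicator fun x => k (F x) with hg
  set B : Set E := Metric.ball 0 (ρ + ‖ν‖)
  have hg_le (x : E) (t : ℝ) (ht : t ∈ Ioo (0 : ℝ) 1) :
      g (x + t • ν) ≤ B.indicator 1 x * k (F x + t) := by
    by_cases hxA : x + t • ν ∈ A
    swap
    · rw [hg, indicator_of_notMem hxA]
      exact zero_le
    have hx : x ∈ B := by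
      have htν : ‖t • ν‖ ≤ ‖ν‖ := by
        rw [norm_smul, Real.norm_of_nonneg ht.1.le]
        exact mul_le_of_le_one_left (norm_nonneg _) ht.2.le
      rw [mem_ball_zero_iff]
      linarith [mem_ball_zero_iff.1 (hAρ hxA), norm_le_add_norm_add x (t • ν)]
    rw [hg, indicator_of_mem hxA, indicator_of_mem hx, hFν, Pi.one_apply, one_mul]
  have hg_meas : Measurable (Function.uncurry fun (t : ℝ) (x : E) => g (x + t • ν)) :=
    ((hk.comp hF).indicator hA).comp (by fun_prop)
  calc ∫⁻ x in A, k (F x) ∂μ = ∫⁻ x, g x ∂μ := (lintegral_indicator hA _).symm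
    _ = ∫⁻ t in Ioo (0 : ℝ) 1, (∫⁻ x, g (x + t • ν) ∂μ) := by
        simp [lintegral_add_right_eq_self]
    _ = ∫⁻ x, (∫⁻ t in Ioo (0 : ℝ) 1, g (x + t • ν)) ∂μ :=
        lintegral_lintegral_swap hg_meas.aemeasurable
    _ ≤ ∫⁻ x, B.indicator 1 x * (∫⁻ t, k t) ∂μ := by
        refine lintegral_mono fun x => ?_
        calc ∫⁻ t in Ioo (0 : ℝ) 1, g (x + t • ν)
            ≤ ∫⁻ t, B.indicator 1 x * k (F x + t) :=
              (setLIntegral_mono' measurableSet_Ioo (hg_le x)).trans (setLIntegral_le_lintegral _ _)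
          _ = B.indicator 1 x * ∫⁻ t, k t := by
              rw [lintegral_const_mul _ (by fun_prop), lintegral_add_left_eq_self k (F x)]
    _ = μ B * ∫⁻ t, k t := by
        rw [lintegral_mul_const _ (measurable_one.indicator measurableSet_ball),
          lintegral_indicator_one measurableSet_ball]

lemma setLIntegral_rpow_lt_top_of_translate {E : Type*} [NormedAddCommGroup E] [NormedSpace ℝ E]
    [FiniteDimensional ℝ E] [MeasurableSpace E] [BorelSpace E] (μ : Measure E)
    [μ.IsAddHaarMeasure] {A : Set E} (hA : MeasurableSet A) (hAb : Bornology.IsBounded A)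
    {F : E → ℝ} (hF : Measurable F) {ν : E} (hFν : ∀ x (t : ℝ), F (x + t • ν) = F x + t)
    {R β : ℝ} (hβ : -1 < β) (hFA : ∀ x ∈ A, F x ∈ Ioo 0 R) :
    ∫⁻ x in A, ENNReal.ofReal (F x ^ β) ∂μ < ∞ := by
  rcases A.eq_empty_or_nonempty with rfl | ⟨a, ha⟩
  · simp
  have hR : 0 ≤ R := ((hFA a ha).1.trans (hFA a ha).2).le
  obtain ⟨ρ, hρ⟩ := hAb.subset_ball 0
  set k : ℝ → ℝ≥0∞ := (Ioo 0 R).indicator fun t => ENNReal.ofReal (t ^ β)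
  have hk : Measurable k := (by fun_prop : Measurable _).indicator measurableSet_Ioo
  have hk_top : ∫⁻ t, k t < ∞ := by
    have hIoo := setLIntegral_Ioo_rpow_sub_one (e := β + 1) (by linarith) hR
    rw [add_sub_cancel_right] at hIoo
    rw [lintegral_indicator measurableSet_Ioo, hIoo]
    exact ENNReal.ofReal_lt_top
  calc ∫⁻ x in A, ENNReal.ofReal (F x ^ β) ∂μ = ∫⁻ x in A, k (F x) ∂μ :=
        setLIntegral_congr_fun hA fun x hx => by simp only [k, indicator_of_mem (hFA x hx)]
    _ ≤ μ (Metric.ball 0 (ρ + ‖ν‖)) * ∫⁻ t, k t :=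
        setLIntegral_comp_le_of_translate μ hA hρ hF hFν hk
    _ < ∞ := ENNReal.mul_lt_top measure_ball_lt_top hk_top

/-- The signed height of `x`, in the direction `ν`, above the graph of `h` over the hyperplane
orthogonal to `ν` through `z`. -/
noncomputable def graphHeight {E : Type*} [NormedAddCommGroup E] [InnerProductSpace ℝ E]
    (h : E → ℝ) (z ν x : E) : ℝ :=
  inner ℝ (x - z) ν - h (x - z - (inner ℝ (x - z) ν : ℝ) • ν)

lemma graphHeight_add_smul {E : Type*} [NormedAddCommGroup E] [InnerProductSpace ℝ E]
    (h : E → ℝ) (z : E) {ν : E} (hν : ‖ν‖ = 1) (x : E) (t : ℝ) :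
    graphHeight h z ν (x + t • ν) = graphHeight h z ν x + t := by
  have hinner : (inner ℝ (x + t • ν - z) ν : ℝ) = inner ℝ (x - z) ν + t := by
    rw [add_sub_right_comm, inner_add_left, real_inner_smul_left, real_inner_self_eq_norm_sq, hν]
    ring
  have hproj : x + t • ν - z - (inner ℝ (x - z) ν + t) • ν =
      x - z - (inner ℝ (x - z) ν : ℝ) • ν := by
    rw [add_smul]
    abel
  rw [graphHeight, hinner, hproj, graphHeight]
  ring

variable {n : ℕ} {Ω : Set (EuclideanSpace ℝ (Fin n))} {z : EuclideanSpace ℝ (Fin n)}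

-- The nearest boundary point `y` to `x` lies in the same chart, where the height is Lipschitz and
-- nonpositive at `y`.
lemma IsBoundedC11.exists_graphHeight_le_bdist (hΩ : IsBoundedC11 Ω) (hz : z ∈ frontier Ω) :
    ∃ ρ > 0, ∃ F : EuclideanSpace ℝ (Fin n) → ℝ, Continuous F ∧
      (∃ ν, ∀ x (t : ℝ), F (x + t • ν) = F x + t) ∧
      ∃ C : ℝ, 0 < C ∧ ∀ x ∈ Metric.ball z ρ ∩ Ω, 0 < F x ∧ F x ≤ C * bdist Ω x := by
  obtain ⟨r, hr, ν, hν, h, hh, -, hchart⟩ := hΩ.chart z hz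
  have hF : ContDiff ℝ 1 (graphHeight h z ν) := by
    have hinner : ContDiff ℝ 1 fun x => (inner ℝ (x - z) ν : ℝ) :=
      (contDiff_id.sub contDiff_const).inner ℝ contDiff_const
    exact hinner.sub (hh.comp ((contDiff_id.sub contDiff_const).sub
      (hinner.smul contDiff_const)))
  obtain ⟨K, U, hU, hlip⟩ := hF.contDiffAt.exists_lipschitzOnWith (x := z)
  obtain ⟨ρ, hρ, hball⟩ := Metric.mem_nhds_iff.1 (Filter.inter_mem hU (Metric.ball_mem_nhds z hr))
  refine ⟨ρ / 2, by positivity, graphHeight h z ν, hF.continuous,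
    ⟨ν, graphHeight_add_smul h z hν⟩, K + 1, by positivity, fun x hx => ?_⟩
  have hxρ : dist x z < ρ / 2 := hx.1
  have hxball := hball (Metric.mem_ball.2 (by linarith : dist x z < ρ))
  refine ⟨sub_pos.2 ((hchart x hxball.2).1 hx.2), ?_⟩
  obtain ⟨y, hy, hxy⟩ := isClosed_frontier.exists_infDist_eq_dist ⟨z, hz⟩ x
  have hyball : y ∈ U ∩ Metric.ball z r := hball <| by
    have hle : dist x y ≤ dist x z := hxy ▸ Metric.infDist_le_dist_of_mem hz
    rw [Metric.mem_ball]
    linarith [dist_triangle_left y z x]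
  have hFy : graphHeight h z ν y ≤ 0 := by
    rw [hΩ.isOpen.frontier_eq] at hy
    exact sub_nonpos.2 (not_lt.1 fun hlt => hy.2 ((hchart y hyball.2).2 hlt))
  have hFxy : graphHeight h z ν x - graphHeight h z ν y ≤ K * dist x y :=
    (le_abs_self _).trans (hlip.dist_le_mul x hxball.1 y hyball.1)
  rw [bdist, hxy]
  linarith [dist_nonneg (x := x) (y := y)]

lemma IsBoundedC11.exists_setLIntegral_bdist_rpow_lt_top (hΩ : IsBoundedC11 Ω) {β : ℝ}
    (hβ : -1 < β) (hβ0 : β ≤ 0) (hz : z ∈ frontier Ω) :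
    ∃ ρ > 0, ∫⁻ x in Metric.ball z ρ ∩ Ω, ENNReal.ofReal (bdist Ω x ^ β) < ∞ := by
  obtain ⟨ρ, hρ, F, hF, ⟨ν, hFν⟩, C, hC, hFC⟩ := hΩ.exists_graphHeight_le_bdist hz
  have hmeas : MeasurableSet (Metric.ball z ρ ∩ Ω) :=
    measurableSet_ball.inter hΩ.isOpen.measurableSet
  have hF_mem : ∀ x ∈ Metric.ball z ρ ∩ Ω, F x ∈ Ioo 0 (C * ρ) := fun x hx =>
    ⟨(hFC x hx).1, (hFC x hx).2.trans_lt ((mul_lt_mul_iff_right₀ hC).2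
      ((Metric.infDist_le_dist_of_mem hz).trans_lt hx.1))⟩
  refine ⟨ρ, hρ, lt_of_le_of_lt ?_ (ENNReal.mul_lt_top (ENNReal.ofReal_lt_top (r := C ^ (-β)))
    (setLIntegral_rpow_lt_top_of_translate volume hmeas (hΩ.bounded.subset inter_subset_right)
      hF.measurable hFν hβ hF_mem))⟩
  rw [← lintegral_const_mul' _ _ ENNReal.ofReal_ne_top]
  refine setLIntegral_mono' hmeas fun x hx => ?_
  rw [← ENNReal.ofReal_mul (by positivity)]
  refine ENNReal.ofReal_le_ofReal ?_
  calc bdist Ω x ^ β = C ^ (-β) * (C * bdist Ω x) ^ β := by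
        rw [Real.mul_rpow hC.le bdist_nonneg, ← mul_assoc, ← Real.rpow_add hC]
        simp
    _ ≤ C ^ (-β) * F x ^ β := by
        gcongr ?_ * ?_
        exact Real.rpow_le_rpow_of_nonpos (hFC x hx).1 (hFC x hx).2 hβ0

lemma IsBoundedC11.setLIntegral_ball_bdist_rpow_lt_top (hΩ : IsBoundedC11 Ω)
    {x : EuclideanSpace ℝ (Fin n)} (hx : 0 < bdist Ω x) {β : ℝ} (hβ : β ≤ 0) :
    ∫⁻ y in Metric.ball x (bdist Ω x / 2) ∩ Ω, ENNReal.ofReal (bdist Ω y ^ β) < ∞ := by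
  calc _ ≤ ∫⁻ _ in Metric.ball x (bdist Ω x / 2) ∩ Ω, ENNReal.ofReal ((bdist Ω x / 2) ^ β) := by
        refine setLIntegral_mono' (measurableSet_ball.inter hΩ.isOpen.measurableSet)
          fun y hy => ENNReal.ofReal_le_ofReal ?_
        have hdist : ‖x - y‖ < bdist Ω x / 2 := mem_ball_iff_norm'.1 hy.1
        exact Real.rpow_le_rpow_of_nonpos (by positivity) (by linarith [bdist_le_add (Ω := Ω) x y])
          hβ
    _ = ENNReal.ofReal ((bdist Ω x / 2) ^ β) * volume (Metric.ball x (bdist Ω x / 2) ∩ Ω) :=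
        setLIntegral_const _ _
    _ < ∞ := ENNReal.mul_lt_top ENNReal.ofReal_lt_top
        (hΩ.bounded.subset inter_subset_right).measure_lt_top

lemma IsBoundedC11.lintegral_bdist_rpow_lt_top [NeZero n] (hΩ : IsBoundedC11 Ω) {β : ℝ}
    (hβ : -1 < β) : ∫⁻ x in Ω, ENNReal.ofReal (bdist Ω x ^ β) < ∞ := by
  rcases le_total 0 β with hβ0 | hβ0
  · obtain ⟨D, -, hD, -⟩ := hΩ.exists_bound
    calc ∫⁻ x in Ω, ENNReal.ofReal (bdist Ω x ^ β) ≤ ∫⁻ _ in Ω, ENNReal.ofReal (D ^ β) :=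
          setLIntegral_mono' hΩ.isOpen.measurableSet fun x hx => ENNReal.ofReal_le_ofReal
            (Real.rpow_le_rpow bdist_nonneg (hD x hx) hβ0)
      _ = ENNReal.ofReal (D ^ β) * volume Ω := setLIntegral_const _ _
      _ < ∞ := ENNReal.mul_lt_top ENNReal.ofReal_lt_top hΩ.bounded.measure_lt_top
  set μ := (volume.restrict Ω).withDensity fun x => ENNReal.ofReal (bdist Ω x ^ β) with hμ
  have hμ_ball (x : EuclideanSpace ℝ (Fin n)) (ρ : ℝ) : μ (Metric.ball x ρ) =
      ∫⁻ y in Metric.ball x ρ ∩ Ω, ENNReal.ofReal (bdist Ω y ^ β) := by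
    rw [hμ, withDensity_apply _ measurableSet_ball, Measure.restrict_restrict measurableSet_ball]
  have hμ_closure : μ (closure Ω) < ∞ := by
    refine hΩ.bounded.isCompact_closure.measure_lt_top_of_nhdsWithin fun x hx => ?_
    suffices ∃ ρ > 0, μ (Metric.ball x ρ) < ∞ from
      this.elim fun ρ h => ⟨_, mem_nhdsWithin_of_mem_nhds (Metric.ball_mem_nhds x h.1), h.2⟩
    simp only [hμ_ball]
    by_cases hxΩ : x ∈ Ω
    · exact ⟨_, half_pos (hΩ.bdist_pos hxΩ),
        hΩ.setLIntegral_ball_bdist_rpow_lt_top (hΩ.bdist_pos hxΩ) hβ0⟩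
    · exact hΩ.exists_setLIntegral_bdist_rpow_lt_top hβ hβ0
        (hΩ.isOpen.frontier_eq ▸ ⟨hx, hxΩ⟩)
  rwa [hμ, withDensity_apply _ isClosed_closure.measurableSet,
    Measure.restrict_restrict isClosed_closure.measurableSet,
    inter_eq_self_of_subset_right subset_closure] at hμ_closure

end Boundary

section GreenOperator

variable {n : ℕ} {Ω : Set (EuclideanSpace ℝ (Fin n))} {s γ : ℝ}
  {G : EuclideanSpace ℝ (Fin n) → EuclideanSpace ℝ (Fin n) → ℝ}
  {f g : EuclideanSpace ℝ (Fin n) → ℝ}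

lemma IsBoundedC11.ae_mem_and_ne [NeZero n] (hΩ : IsBoundedC11 Ω) (x : EuclideanSpace ℝ (Fin n)) :
    ∀ᵐ y ∂(volume.restrict Ω), y ∈ Ω ∧ x ≠ y := by
  filter_upwards [ae_restrict_of_ae (Measure.ae_ne volume x),
    ae_restrict_mem hΩ.isOpen.measurableSet] with y hy hyΩ
  exact ⟨hyΩ, hy.symm⟩

lemma IsBoundedC11.ae_ae_of_forall_ne [NeZero n] (hΩ : IsBoundedC11 Ω)
    {P : EuclideanSpace ℝ (Fin n) → EuclideanSpace ℝ (Fin n) → Prop}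
    (hP : ∀ x ∈ Ω, ∀ y ∈ Ω, x ≠ y → P x y) :
    ∀ᵐ x ∂(volume.restrict Ω), ∀ᵐ y ∂(volume.restrict Ω), P x y := by
  filter_upwards [ae_restrict_mem hΩ.isOpen.measurableSet] with x hx
  filter_upwards [hΩ.ae_mem_and_ne x] with y hy
  exact hP x hx y hy.1 hy.2

lemma modelKernel_nonneg (x y : EuclideanSpace ℝ (Fin n)) : 0 ≤ modelKernel Ω s γ x y := by
  have hmin (z : EuclideanSpace ℝ (Fin n)) : 0 ≤ min (bdist Ω z ^ γ / ‖x - y‖ ^ γ) 1 :=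
    le_min (div_nonneg (Real.rpow_nonneg bdist_nonneg _) (by positivity)) zero_le_one
  exact mul_nonneg (mul_nonneg (by positivity) (hmin x)) (hmin y)

lemma modelKernel_le_norm_rpow (x y : EuclideanSpace ℝ (Fin n)) :
    modelKernel Ω s γ x y ≤ ‖x - y‖ ^ (2 * s - n) := by
  have hmin (z : EuclideanSpace ℝ (Fin n)) : 0 ≤ min (bdist Ω z ^ γ / ‖x - y‖ ^ γ) 1 :=
    le_min (div_nonneg (Real.rpow_nonneg bdist_nonneg _) (by positivity)) zero_le_one
  rw [modelKernel, one_div, ← Real.rpow_neg (norm_nonneg _), neg_sub, mul_assoc]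
  exact mul_le_of_le_one_right (by positivity)
    (mul_le_one₀ (min_le_right _ _) (hmin y) (min_le_right _ _))

lemma enorm_greenOp_le (f : EuclideanSpace ℝ (Fin n) → ℝ) (x : EuclideanSpace ℝ (Fin n)) :
    ‖greenOp Ω G f x‖ₑ ≤
      kernelOp (volume.restrict Ω) (fun x y => ‖G x y‖ₑ) (fun y => ‖f y‖ₑ) x :=
  (enorm_integral_le_lintegral_enorm _).trans_eq (by simp only [kernelOp, enorm_mul])

namespace IsGreenFunction

lemma nonneg (hG : IsGreenFunction Ω s γ G) {x y : EuclideanSpace ℝ (Fin n)} (hx : x ∈ Ω)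
    (hy : y ∈ Ω) (hxy : x ≠ y) : 0 ≤ G x y := by
  obtain ⟨c, hc, hcG⟩ := hG.comparable
  exact (mul_nonneg (inv_nonneg.2 hc.le) (modelKernel_nonneg x y)).trans (hcG x hx y hy hxy).1

lemma exists_enorm_le_modelKernel (hG : IsGreenFunction Ω s γ G) :
    ∃ C : ℝ≥0, ∀ x ∈ Ω, ∀ y ∈ Ω, x ≠ y →
      ‖G x y‖ₑ ≤ C * ENNReal.ofReal (modelKernel Ω s γ x y) := by
  obtain ⟨c, hc, hcG⟩ := hG.comparable
  refine ⟨c.toNNReal, fun x hx y hy hxy => ?_⟩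
  rw [Real.enorm_of_nonneg (hG.nonneg hx hy hxy), ← ENNReal.ofReal, ← ENNReal.ofReal_mul hc.le]
  exact ENNReal.ofReal_le_ofReal (hcG x hx y hy hxy).2

lemma exists_enorm_le_norm_rpow (hG : IsGreenFunction Ω s γ G) :
    ∃ C : ℝ≥0, ∀ x ∈ Ω, ∀ y ∈ Ω, x ≠ y →
      ‖G x y‖ₑ ≤ C * ENNReal.ofReal (‖x - y‖ ^ (2 * s - n)) := by
  obtain ⟨C, hC⟩ := hG.exists_enorm_le_modelKernel
  refine ⟨C, fun x hx y hy hxy => (hC x hx y hy hxy).trans ?_⟩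
  gcongr
  exact modelKernel_le_norm_rpow x y

lemma exists_enorm_le_potKernel [NeZero n] (hG : IsGreenFunction Ω s γ G) (hΩ : IsBoundedC11 Ω)
    (hγ : 0 ≤ γ) :
    ∃ C : ℝ≥0, ∀ x ∈ Ω, ∀ y ∈ Ω, x ≠ y → ‖G x y‖ₑ ≤ C * potKernel Ω s γ 1 x y := by
  obtain ⟨C, hC⟩ := hG.exists_enorm_le_modelKernel
  refine ⟨C * 4 ^ γ, fun x hx y hy hxy => (hC x hx y hy hxy).trans ?_⟩
  rw [ENNReal.coe_mul, mul_assoc]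
  gcongr
  exact hΩ.ofReal_modelKernel_le_potKernel hγ hx hy hxy

lemma exists_potKernel_le_enorm (hG : IsGreenFunction Ω s γ G) (hγ : 0 ≤ γ) :
    ∃ C : ℝ≥0, ∀ x ∈ Ω, ∀ y ∈ Ω, x ≠ y → potKernel Ω s γ 1 x y ≤ C * ‖G x y‖ₑ := by
  obtain ⟨c, hc, hcG⟩ := hG.comparable
  refine ⟨c.toNNReal, fun x hx y hy hxy => (potKernel_le_ofReal_modelKernel hγ hxy).trans ?_⟩
  rw [Real.enorm_of_nonneg (hG.nonneg hx hy hxy), ← ENNReal.ofReal, ← ENNReal.ofReal_mul hc.le]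
  exact ENNReal.ofReal_le_ofReal ((inv_mul_le_iff₀ hc).1 (hcG x hx y hy hxy).1)

end IsGreenFunction

lemma exists_ae_setLIntegral_norm_rpow_le [NeZero n] (hΩ : IsBoundedC11 Ω) {β : ℝ}
    (hβ : -(n : ℝ) < β) :
    ∃ C : ℝ≥0, ∀ᵐ x ∂(volume.restrict Ω), ∫⁻ y in Ω, ENNReal.ofReal (‖x - y‖ ^ β) ≤ C := by
  obtain ⟨C, hC⟩ := exists_setLIntegral_norm_sub_rpow_le volume hΩ.bounded
    (β := β) (by rwa [finrank_euclideanSpace_fin])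
  exact ⟨C, ae_restrict_of_forall_mem hΩ.isOpen.measurableSet hC⟩

lemma lintegral_kernelOp_norm_rpow_sq_lt_top [NeZero n] (hΩ : IsBoundedC11 Ω) {β : ℝ}
    (hβ : -(n : ℝ) < β) (hf : MemLp f 2 (volume.restrict Ω)) :
    ∫⁻ x in Ω, kernelOp (volume.restrict Ω) (fun x y => ENNReal.ofReal (‖x - y‖ ^ β))
      (fun y => ‖f y‖ₑ) x ^ (2 : ℝ) < ∞ := by
  obtain ⟨C, hC⟩ := exists_ae_setLIntegral_norm_rpow_le hΩ hβ
  have hf_top : ∫⁻ x in Ω, ‖f x‖ₑ ^ (2 : ℝ) < ∞ := by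
    simpa using lintegral_rpow_enorm_lt_top_of_eLpNorm_lt_top two_ne_zero ENNReal.ofNat_ne_top hf.2
  refine (lintegral_kernelOp_rpow_le (B := C) one_le_two (by fun_prop) hC ?_ hf.1.enorm).trans_lt ?_
  · simpa only [norm_sub_rev] using hC
  · exact ENNReal.mul_lt_top (ENNReal.rpow_lt_top_of_nonneg (by norm_num) ENNReal.coe_ne_top)
      (ENNReal.mul_lt_top ENNReal.coe_lt_top hf_top)

namespace IsGreenFunction

variable [NeZero n]

lemma exists_kernelOp_enorm_le (hG : IsGreenFunction Ω s γ G) (hΩ : IsBoundedC11 Ω) :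
    ∃ C : ℝ≥0, ∀ g : EuclideanSpace ℝ (Fin n) → ℝ≥0∞, ∀ x ∈ Ω,
      kernelOp (volume.restrict Ω) (fun x y => ‖G x y‖ₑ) g x ≤ C *
        kernelOp (volume.restrict Ω) (fun x y => ENNReal.ofReal (‖x - y‖ ^ (2 * s - n))) g x := by
  obtain ⟨C, hC⟩ := hG.exists_enorm_le_norm_rpow
  exact ⟨C, fun g x hx => kernelOp_le_of_ae_le
    ((hΩ.ae_mem_and_ne x).mono fun y hy => hC x hx y hy.1 hy.2) g⟩

lemma lintegral_kernelOp_enorm_sq_lt_top (hG : IsGreenFunction Ω s γ G) (hΩ : IsBoundedC11 Ω)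
    (hs : 0 < s) (hf : MemLp f 2 (volume.restrict Ω)) :
    ∫⁻ x in Ω, kernelOp (volume.restrict Ω) (fun x y => ‖G x y‖ₑ) (fun y => ‖f y‖ₑ) x ^ (2 : ℝ)
      < ∞ := by
  obtain ⟨C, hC⟩ := hG.exists_kernelOp_enorm_le hΩ
  have htop := lintegral_kernelOp_norm_rpow_sq_lt_top hΩ (β := 2 * s - n) (by linarith) hf
  refine (setLIntegral_mono' hΩ.isOpen.measurableSet fun x hx =>
    ENNReal.rpow_le_rpow (hC _ x hx) zero_le_two).trans_lt ?_
  simp only [ENNReal.mul_rpow_of_nonneg _ _ zero_le_two]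
  rw [lintegral_const_mul' _ _ (by simp)]
  exact ENNReal.mul_lt_top (by simp) htop

lemma memLp_greenOp (hG : IsGreenFunction Ω s γ G) (hΩ : IsBoundedC11 Ω) (hs : 0 < s)
    (hf : MemLp f 2 (volume.restrict Ω)) : MemLp (greenOp Ω G f) 2 (volume.restrict Ω) := by
  refine ⟨(hG.aemeasurable.aestronglyMeasurable.mul hf.1.comp_snd).integral_prod_right', ?_⟩
  rw [eLpNorm_lt_top_iff_lintegral_rpow_enorm_lt_top two_ne_zero ENNReal.ofNat_ne_top,
    ENNReal.toReal_ofNat]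
  exact (lintegral_mono fun x => ENNReal.rpow_le_rpow (enorm_greenOp_le f x) zero_le_two).trans_lt
    (hG.lintegral_kernelOp_enorm_sq_lt_top hΩ hs hf)

lemma integrable_mul_mul (hG : IsGreenFunction Ω s γ G) (hΩ : IsBoundedC11 Ω) (hs : 0 < s)
    (hf : MemLp f 2 (volume.restrict Ω)) (hg : MemLp g 2 (volume.restrict Ω)) :
    Integrable (Function.uncurry fun x y => g x * (G x y * f y))
      ((volume.restrict Ω).prod (volume.restrict Ω)) := by
  have hmeas : AEStronglyMeasurable (Function.uncurry fun x y => g x * (G x y * f y))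
      ((volume.restrict Ω).prod (volume.restrict Ω)) :=
    hg.1.comp_fst.mul (hG.aemeasurable.aestronglyMeasurable.mul hf.1.comp_snd)
  refine ⟨hmeas, ?_⟩
  obtain ⟨C, hC⟩ := hG.exists_kernelOp_enorm_le hΩ
  set κ := kernelOp (volume.restrict Ω) (fun x y => ENNReal.ofReal (‖x - y‖ ^ (2 * s - n)))
    fun y => ‖f y‖ₑ
  have hκ : AEMeasurable κ (volume.restrict Ω) := aemeasurable_kernelOp (by fun_prop) hf.1.enorm
  have hκ_top : ∫⁻ x in Ω, κ x ^ (2 : ℝ) < ∞ :=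
    lintegral_kernelOp_norm_rpow_sq_lt_top hΩ (by linarith) hf
  have hg_top : ∫⁻ x in Ω, ‖g x‖ₑ ^ (2 : ℝ) < ∞ := by
    simpa using lintegral_rpow_enorm_lt_top_of_eLpNorm_lt_top two_ne_zero ENNReal.ofNat_ne_top hg.2
  have hgκ_top : ∫⁻ x in Ω, ‖g x‖ₑ * κ x < ∞ :=
    (ENNReal.lintegral_mul_le_Lp_mul_Lq _ Real.HolderConjugate.two_two hg.1.enorm hκ).trans_lt
      (ENNReal.mul_lt_top (ENNReal.rpow_lt_top_of_nonneg (by norm_num) hg_top.ne)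
        (ENNReal.rpow_lt_top_of_nonneg (by norm_num) hκ_top.ne))
  rw [hasFiniteIntegral_iff_enorm, lintegral_prod _ hmeas.enorm]
  calc _ ≤ ∫⁻ x in Ω, C * (‖g x‖ₑ * κ x) := by
        refine setLIntegral_mono' hΩ.isOpen.measurableSet fun x hx => ?_
        simp only [Function.uncurry_apply_pair, enorm_mul, lintegral_const_mul' _ _ enorm_ne_top]
        rw [mul_left_comm]
        gcongr
        exact hC _ x hx
    _ = C * ∫⁻ x in Ω, ‖g x‖ₑ * κ x := lintegral_const_mul' _ _ ENNReal.coe_ne_top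
    _ < ∞ := ENNReal.mul_lt_top ENNReal.coe_lt_top hgκ_top

lemma integral_mul_greenOp (hG : IsGreenFunction Ω s γ G) (hΩ : IsBoundedC11 Ω) (hs : 0 < s)
    (hf : MemLp f 2 (volume.restrict Ω)) (hg : MemLp g 2 (volume.restrict Ω)) :
    ∫ x in Ω, g x * greenOp Ω G f x = ∫ x in Ω, greenOp Ω G g x * f x := by
  calc ∫ x in Ω, g x * greenOp Ω G f x = ∫ x in Ω, ∫ y in Ω, g x * (G x y * f y) := by
        simp only [greenOp, integral_const_mul]
    _ = ∫ y in Ω, ∫ x in Ω, g x * (G x y * f y) :=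
        integral_integral_swap (hG.integrable_mul_mul hΩ hs hf hg)
    _ = ∫ y in Ω, greenOp Ω G g y * f y := by
        refine setIntegral_congr_fun hΩ.isOpen.measurableSet fun y hy => ?_
        simp only [greenOp, ← integral_mul_const]
        refine integral_congr_ae ?_
        filter_upwards [hΩ.ae_mem_and_ne y] with x hx
        rw [hG.symm y hy x hx.1 hx.2]
        ring

variable {ev : ℕ → ℝ} {φ : HilbertBasis ℕ ℝ (L2 Ω)}

lemma multiplierOp_inv_ae_eq_greenOp (hG : IsGreenFunction Ω s γ G) (hΩ : IsBoundedC11 Ω)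
    (hs : 0 < s) (hφ : IsEigenbasis Ω G ev φ) (ψ : L2 Ω) :
    ∀ᵐ x ∂(volume.restrict Ω), multiplierOp φ ev⁻¹ ψ x = greenOp Ω G ψ x := by
  have hmem : MemLp (greenOp Ω G ψ) 2 (volume.restrict Ω) := hG.memLp_greenOp hΩ hs (Lp.memLp ψ)
  suffices heq : multiplierOp φ ev⁻¹ ψ = hmem.toLp _ from heq ▸ hmem.coeFn_toLp
  refine eq_of_forall_inner_hilbertBasis_eq φ fun j => ?_
  rw [inner_multiplierOp φ (norm_inv_le hφ.pos hφ.mono), L2.inner_def, L2.inner_def]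
  simp only [RCLike.inner_apply, conj_trivial]
  calc ev⁻¹ j * ∫ x in Ω, ψ x * φ j x = ∫ x in Ω, greenOp Ω G (φ j) x * ψ x := by
        rw [← integral_const_mul]
        refine integral_congr_ae ?_
        filter_upwards [hφ.eigen j] with x hx
        rw [hx, Pi.inv_apply]
        field_simp [(hφ.pos j).ne']
    _ = ∫ x in Ω, φ j x * greenOp Ω G ψ x :=
        (hG.integral_mul_greenOp hΩ hs (Lp.memLp ψ) (Lp.memLp (φ j))).symm
    _ = ∫ x in Ω, hmem.toLp _ x * φ j x := by
        refine integral_congr_ae ?_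
        filter_upwards [hmem.coeFn_toLp] with x hx
        rw [hx, mul_comm]

lemma exists_kernelDominated_multiplierOp_inv (hG : IsGreenFunction Ω s γ G) (hΩ : IsBoundedC11 Ω)
    (hs : 0 < s) (hγ : 0 ≤ γ) (hφ : IsEigenbasis Ω G ev φ) :
    ∃ C, KernelDominated (volume.restrict Ω) (potKernel Ω s γ 1) C (multiplierOp φ ev⁻¹) := by
  obtain ⟨C, hC⟩ := hG.exists_enorm_le_potKernel hΩ hγ
  refine ⟨C, fun ψ => ?_⟩
  filter_upwards [hG.multiplierOp_inv_ae_eq_greenOp hΩ hs hφ ψ, hΩ.ae_ae_of_forall_ne hC]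
    with x hx hCx
  rw [hx]
  exact (enorm_greenOp_le _ x).trans (kernelOp_le_of_ae_le hCx _)

-- Each further application of the Green operator lowers the exponent of the quasi-distance by `ε`.
lemma exists_kernelDominated_iterate (hG : IsGreenFunction Ω s γ G) (hΩ : IsBoundedC11 Ω)
    (hs : 0 < s) (hsn : 2 * s ≤ n) (hγ : 0 ≤ γ) (hφ : IsEigenbasis Ω G ev φ) {ε : ℝ}
    (hε : 0 ≤ ε) (hεn : ((n : ℝ) - 2 * s) * (1 + ε) + 2 * γ * ε < n) (i : ℕ) (hi : i * ε ≤ 1) :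
    ∃ C, KernelDominated (volume.restrict Ω) (potKernel Ω s γ (1 - i * ε)) C
      (multiplierOp φ ev⁻¹)^[i + 1] := by
  induction i with
  | zero => simpa using hG.exists_kernelDominated_multiplierOp_inv hΩ hs hγ hφ
  | succ i ih =>
    push_cast at hi
    obtain ⟨C, hC⟩ := hG.exists_kernelDominated_multiplierOp_inv hΩ hs hγ hφ
    obtain ⟨C', hC'⟩ := ih (by linarith)
    obtain ⟨C'', hC''⟩ := hΩ.exists_lintegral_potKernel_mul_le hsn hγ hε hεn
      (τ := 1 - i * ε) (by linarith) (by linarith [mul_nonneg i.cast_nonneg hε])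
    rw [Function.iterate_succ', show 1 - ((i + 1 : ℕ) : ℝ) * ε = 1 - i * ε - ε by push_cast; ring]
    exact ⟨_, hC.comp hC' measurable_potKernel measurable_potKernel hC''⟩

theorem isKernelSmoothing (hG : IsGreenFunction Ω s γ G) (hΩ : IsBoundedC11 Ω)
    (hs : 0 < s) (hsn : 2 * s ≤ n) (hγ : 0 ≤ γ) (hφ : IsEigenbasis Ω G ev φ) :
    IsKernelSmoothing (volume.restrict Ω) (potKernel Ω s γ 1) (fun x => bdist Ω x ^ γ)
      (multiplierOp φ ev⁻¹) where
  weight_pos := ae_restrict_of_forall_mem hΩ.isOpen.measurableSet fun x hx =>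
    Real.rpow_pos_of_pos (hΩ.bdist_pos hx) γ
  memLp_weight := by
    obtain ⟨D, -, hD, -⟩ := hΩ.exists_bound
    have : IsFiniteMeasure (volume.restrict Ω) := ⟨by simpa using hΩ.bounded.measure_lt_top⟩
    refine MemLp.of_bound (continuous_bdist.measurable.pow_const γ).aestronglyMeasurable
      (D ^ γ) (ae_restrict_of_forall_mem hΩ.isOpen.measurableSet fun x hx => ?_)
    rw [Real.norm_of_nonneg (Real.rpow_nonneg bdist_nonneg γ)]
    exact Real.rpow_le_rpow bdist_nonneg (hD x hx) hγ
  weight_mul_le := by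
    simpa only [potKernel_zero] using hΩ.exists_potKernel_le hsn hγ zero_le_one
  iterate i := by
    simpa using hG.exists_kernelDominated_iterate hΩ hs hsn hγ hφ le_rfl (by linarith) i (by simp)
  smoothing := by
    obtain ⟨N, hN⟩ := exists_nat_gt (((n : ℝ) - 2 * s + 2 * γ) / (2 * s))
    have hN0 : (0 : ℝ) < N := (div_nonneg (by linarith [hγ]) (by positivity)).trans_lt hN
    have hεn : ((n : ℝ) - 2 * s) * (1 + 1 / N) + 2 * γ * (1 / N) < n := by
      rw [div_lt_iff₀ (by positivity)] at hN
      field_simp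
      linarith
    have hNε : (N : ℝ) * (1 / N) = 1 := mul_one_div_cancel hN0.ne'
    have hiter := hG.exists_kernelDominated_iterate hΩ hs hsn hγ hφ (by positivity) hεn N hNε.le
    simp only [hNε, sub_self] at hiter
    refine ⟨N + 1, ?_⟩
    simpa only [← potKernel_zero (s := s)] using hiter

end IsGreenFunction

end GreenOperator

section GreenEstimates

variable {n : ℕ} {Ω : Set (EuclideanSpace ℝ (Fin n))} {s γ : ℝ}
  {G : EuclideanSpace ℝ (Fin n) → EuclideanSpace ℝ (Fin n) → ℝ}
  {x y : EuclideanSpace ℝ (Fin n)}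

lemma modelKernel_le_norm_rpow_mul (hxy : x ≠ y) :
    modelKernel Ω s γ x y ≤ ‖x - y‖ ^ (2 * s - n - γ) * bdist Ω y ^ γ := by
  have hr : 0 < ‖x - y‖ := norm_pos_iff.2 (sub_ne_zero.2 hxy)
  have hδ : 0 ≤ bdist Ω y ^ γ := Real.rpow_nonneg bdist_nonneg γ
  rw [modelKernel, one_div, ← Real.rpow_neg hr.le, neg_sub,
    Real.rpow_sub hr (2 * s - n) γ, div_mul_eq_mul_div, mul_div_assoc]
  exact mul_le_mul (mul_le_of_le_one_right (by positivity) (min_le_right _ _)) (min_le_left _ _)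
    (le_min (by positivity) zero_le_one) (by positivity)

lemma exists_modelKernel_mul_bdist_rpow_le (hsn : 2 * s ≤ n) (hγ : 0 ≤ γ) (α : ℝ)
    (hx : 0 < bdist Ω x) :
    ∃ M : ℝ≥0, ∀ y, x ≠ y → 0 < bdist Ω y → modelKernel Ω s γ x y * bdist Ω y ^ α ≤
      M * (‖x - y‖ ^ (2 * s - n) + bdist Ω y ^ (γ + α)) := by
  set a := bdist Ω x
  set A := max ((a / 2) ^ α) ((2 * a) ^ α)
  set B := (a / 2) ^ (2 * s - n - γ)
  refine ⟨(A + B).toNNReal, fun y hxy hy => ?_⟩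
  rw [Real.coe_toNNReal _ (by positivity)]
  rcases le_total ‖x - y‖ (a / 2) with hnear | hfar
  · have hlow : a / 2 ≤ bdist Ω y := by linarith [bdist_le_add (Ω := Ω) x y]
    have hupp : bdist Ω y ≤ 2 * a := by
      linarith [bdist_le_add (Ω := Ω) y x, norm_sub_rev x y]
    have hA : bdist Ω y ^ α ≤ A := by
      rcases le_total 0 α with hα | hα
      · exact (Real.rpow_le_rpow hy.le hupp hα).trans (le_max_right _ _)
      · exact (Real.rpow_le_rpow_of_nonpos (half_pos hx) hlow hα).trans (le_max_left _ _)
    calc modelKernel Ω s γ x y * bdist Ω y ^ α ≤ ‖x - y‖ ^ (2 * s - n) * A :=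
          mul_le_mul (modelKernel_le_norm_rpow x y) hA (by positivity) (by positivity)
      _ ≤ (A + B) * (‖x - y‖ ^ (2 * s - n) + bdist Ω y ^ (γ + α)) := by
          rw [mul_comm]
          gcongr
          · exact le_add_of_nonneg_right (by positivity)
          · exact le_add_of_nonneg_right (by positivity)
  · have hB : ‖x - y‖ ^ (2 * s - n - γ) ≤ B :=
      Real.rpow_le_rpow_of_nonpos (half_pos hx) hfar (by linarith)
    calc modelKernel Ω s γ x y * bdist Ω y ^ α
        ≤ ‖x - y‖ ^ (2 * s - n - γ) * bdist Ω y ^ γ * bdist Ω y ^ α := by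
          gcongr
          exact modelKernel_le_norm_rpow_mul hxy
      _ = ‖x - y‖ ^ (2 * s - n - γ) * bdist Ω y ^ (γ + α) := by
          rw [mul_assoc, Real.rpow_add hy]
      _ ≤ (A + B) * (‖x - y‖ ^ (2 * s - n) + bdist Ω y ^ (γ + α)) := by
          gcongr
          · exact hB.trans (le_add_of_nonneg_left (by positivity))
          · exact le_add_of_nonneg_left (by positivity)

variable [NeZero n]

lemma kernelOp_potKernel_le_of_modelKernel_le (hγ : 0 ≤ γ) {β : ℝ}
    {w : EuclideanSpace ℝ (Fin n) → ℝ}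
    (hw : ∀ x y, x ≠ y → modelKernel Ω s γ x y ≤ ‖x - y‖ ^ β * w y)
    (g : EuclideanSpace ℝ (Fin n) → ℝ≥0∞) (x : EuclideanSpace ℝ (Fin n)) :
    kernelOp (volume.restrict Ω) (potKernel Ω s γ 1) g x ≤
      kernelOp (volume.restrict Ω) (fun x y => ENNReal.ofReal (‖x - y‖ ^ β))
        (fun y => g y * ENNReal.ofReal (w y)) x := by
  refine lintegral_mono_ae ?_
  filter_upwards [ae_restrict_of_ae (Measure.ae_ne volume x)] with y hy
  calc potKernel Ω s γ 1 x y * g y ≤ ENNReal.ofReal (‖x - y‖ ^ β * w y) * g y := by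
        gcongr
        exact (potKernel_le_ofReal_modelKernel hγ hy.symm).trans
          (ENNReal.ofReal_le_ofReal (hw x y hy.symm))
    _ = ENNReal.ofReal (‖x - y‖ ^ β) * (g y * ENNReal.ofReal (w y)) := by
        rw [ENNReal.ofReal_mul (by positivity)]
        ring

lemma kernelOp_potKernel_le_norm_rpow (hγ : 0 ≤ γ) (g : EuclideanSpace ℝ (Fin n) → ℝ≥0∞)
    (x : EuclideanSpace ℝ (Fin n)) :
    kernelOp (volume.restrict Ω) (potKernel Ω s γ 1) g x ≤
      kernelOp (volume.restrict Ω) (fun x y => ENNReal.ofReal (‖x - y‖ ^ (2 * s - n))) g x := by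
  simpa using kernelOp_potKernel_le_of_modelKernel_le (s := s) (w := 1) (Ω := Ω) hγ
    (fun x y _ => (modelKernel_le_norm_rpow x y).trans_eq (mul_one _).symm) g x

lemma exists_eLpNorm_kernelOp_norm_rpow_le (hΩ : IsBoundedC11 Ω) {β p : ℝ} (hp : 1 ≤ p)
    (hβ : -(n : ℝ) < β * p) :
    ∃ C : ℝ≥0, ∀ g : EuclideanSpace ℝ (Fin n) → ℝ≥0∞, AEMeasurable g (volume.restrict Ω) →
      eLpNorm (kernelOp (volume.restrict Ω) (fun x y => ENNReal.ofReal (‖x - y‖ ^ β)) g)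
        (ENNReal.ofReal p) (volume.restrict Ω) ≤ C * ∫⁻ y in Ω, g y := by
  have hp0 : 0 ≤ p := by linarith
  obtain ⟨A, hA⟩ := exists_ae_setLIntegral_norm_rpow_le hΩ hβ
  refine ⟨A ^ (1 / p), fun g hg => ?_⟩
  rw [ENNReal.coe_rpow_of_nonneg _ (by positivity)]
  refine eLpNorm_kernelOp_le hp (by fun_prop) ?_ hg
  filter_upwards [hA] with y hy
  simpa only [ENNReal.ofReal_rpow_of_nonneg (Real.rpow_nonneg (norm_nonneg _) _) hp0,
    ← Real.rpow_mul (norm_nonneg _), norm_sub_rev y] using hy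

lemma exists_eLpNorm_kernelOp_potKernel_le_lintegral (hΩ : IsBoundedC11 Ω) (hγ : 0 ≤ γ)
    (hsn : 2 * s < n) {p : ℝ} (hp : 1 ≤ p) (hpn : p < n / (n - 2 * s)) :
    ∃ C : ℝ≥0, ∀ g : EuclideanSpace ℝ (Fin n) → ℝ≥0∞, AEMeasurable g (volume.restrict Ω) →
      eLpNorm (kernelOp (volume.restrict Ω) (potKernel Ω s γ 1) g) (ENNReal.ofReal p)
        (volume.restrict Ω) ≤ C * ∫⁻ y in Ω, g y := by
  rw [lt_div_iff₀ (by linarith)] at hpn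
  obtain ⟨C, hC⟩ := exists_eLpNorm_kernelOp_norm_rpow_le hΩ (β := 2 * s - n) hp (by linarith)
  exact ⟨C, fun g hg => (eLpNorm_mono_enorm (kernelOp_potKernel_le_norm_rpow hγ g)).trans (hC g hg)⟩

lemma exists_eLpNorm_kernelOp_potKernel_le_lintegral_mul (hΩ : IsBoundedC11 Ω) (hγ : 0 ≤ γ)
    (hsn : 2 * s < n) {p : ℝ} (hp : 1 ≤ p) (hpn : p < n / (n - 2 * s + γ)) :
    ∃ C : ℝ≥0, ∀ g : EuclideanSpace ℝ (Fin n) → ℝ≥0∞, AEMeasurable g (volume.restrict Ω) →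
      eLpNorm (kernelOp (volume.restrict Ω) (potKernel Ω s γ 1) g) (ENNReal.ofReal p)
        (volume.restrict Ω) ≤ C * ∫⁻ y in Ω, g y * ENNReal.ofReal (bdist Ω y ^ γ) := by
  rw [lt_div_iff₀ (by linarith)] at hpn
  obtain ⟨C, hC⟩ := exists_eLpNorm_kernelOp_norm_rpow_le hΩ (β := 2 * s - n - γ) hp (by linarith)
  refine ⟨C, fun g hg => (eLpNorm_mono_enorm (kernelOp_potKernel_le_of_modelKernel_le hγ
    (fun x y => modelKernel_le_norm_rpow_mul) g)).trans (hC _ (hg.mul ?_))⟩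
  exact (continuous_bdist.measurable.pow_const γ).ennreal_ofReal.aemeasurable

lemma exists_eLpNorm_kernelOp_potKernel_le_eLpNorm (hΩ : MeasurableSet Ω) (hγ : 0 ≤ γ)
    (hs : 0 < s) {p : ℝ} (hp : 1 < p) (hpn : p < n / (2 * s)) :
    ∃ C : ℝ≥0, ∀ q, 1 / q = 1 / p - 2 * s / n → ∀ g : EuclideanSpace ℝ (Fin n) → ℝ≥0∞,
      AEMeasurable g (volume.restrict Ω) →
      eLpNorm (kernelOp (volume.restrict Ω) (potKernel Ω s γ 1) g) (ENNReal.ofReal q)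
        (volume.restrict Ω) ≤ C * eLpNorm g (ENNReal.ofReal p) (volume.restrict Ω) := by
  have hdim : (finrank ℝ (EuclideanSpace ℝ (Fin n)) : ℝ) = n := by
    rw [finrank_euclideanSpace_fin]
  rw [lt_div_iff₀ (by positivity)] at hpn
  obtain ⟨C, hC⟩ := exists_eLpNorm_rieszPotential_le
    (volume : Measure (EuclideanSpace ℝ (Fin n))) (σ := 2 * s) (q := (1 / p - 2 * s / n)⁻¹)
    (by positivity) hp (by rwa [hdim]) (by rw [hdim, one_div, inv_inv])
  refine ⟨C, fun q hq g hg => ?_⟩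
  obtain rfl : q = (1 / p - 2 * s / n)⁻¹ := by rw [← hq, one_div, inv_inv]
  have hle (x) : kernelOp (volume.restrict Ω) (potKernel Ω s γ 1) g x ≤
      rieszPotential volume (2 * s) (Ω.indicator g) x := by
    refine (kernelOp_potKernel_le_norm_rpow hγ g x).trans_eq ?_
    rw [rieszPotential, hdim, kernelOp, ← lintegral_indicator hΩ]
    simp only [indicator_mul_right]
  rw [← eLpNorm_indicator_eq_eLpNorm_restrict (f := g) hΩ]
  calc eLpNorm (kernelOp (volume.restrict Ω) (potKernel Ω s γ 1) g) _ (volume.restrict Ω)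
      ≤ eLpNorm (rieszPotential volume (2 * s) (Ω.indicator g)) _ (volume.restrict Ω) :=
        eLpNorm_mono_enorm hle
    _ ≤ eLpNorm (rieszPotential volume (2 * s) (Ω.indicator g)) _ volume :=
        eLpNorm_mono_measure _ Measure.restrict_le_self
    _ ≤ C * eLpNorm (Ω.indicator g) _ volume := hC _ ((aemeasurable_indicator_iff hΩ).2 hg)

namespace IsGreenFunction

lemma kernelOp_enorm_bdist_rpow_lt_top (hG : IsGreenFunction Ω s γ G) (hΩ : IsBoundedC11 Ω)
    (hs : 0 < s) (hsn : 2 * s ≤ n) (hγ : 0 ≤ γ) {α : ℝ} (hα : -1 - γ < α) (hx : x ∈ Ω) :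
    kernelOp (volume.restrict Ω) (fun x y => ‖G x y‖ₑ)
      (fun y => ENNReal.ofReal (bdist Ω y ^ α)) x < ∞ := by
  obtain ⟨C, hC⟩ := hG.exists_enorm_le_modelKernel
  obtain ⟨M, hM⟩ := exists_modelKernel_mul_bdist_rpow_le hsn hγ α (hΩ.bdist_pos hx)
  obtain ⟨D, hD⟩ := exists_setLIntegral_norm_sub_rpow_le
    (volume : Measure (EuclideanSpace ℝ (Fin n))) hΩ.bounded (β := 2 * s - n)
    (by rw [finrank_euclideanSpace_fin]; linarith)
  calc kernelOp (volume.restrict Ω) (fun x y => ‖G x y‖ₑ)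
        (fun y => ENNReal.ofReal (bdist Ω y ^ α)) x
      ≤ ∫⁻ y in Ω, (C * M : ℝ≥0) *
          (ENNReal.ofReal (‖x - y‖ ^ (2 * s - n)) + ENNReal.ofReal (bdist Ω y ^ (γ + α))) := by
        refine lintegral_mono_ae ?_
        filter_upwards [hΩ.ae_mem_and_ne x] with y ⟨hy, hxy⟩
        rw [← ENNReal.ofReal_add (by positivity) (Real.rpow_nonneg bdist_nonneg _),
          ENNReal.coe_mul, mul_assoc, ← ENNReal.ofReal_coe_nnreal (p := M),
          ← ENNReal.ofReal_mul M.coe_nonneg]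
        refine (mul_le_mul_left (hC x hx y hy hxy) _).trans ?_
        rw [mul_assoc, ← ENNReal.ofReal_mul (modelKernel_nonneg x y)]
        exact mul_le_mul_right (ENNReal.ofReal_le_ofReal (hM y hxy (hΩ.bdist_pos hy))) _
    _ < ∞ := by
        rw [lintegral_const_mul' _ _ ENNReal.coe_ne_top, lintegral_add_left (by fun_prop)]
        exact ENNReal.mul_lt_top ENNReal.coe_lt_top (ENNReal.add_lt_top.2
          ⟨(hD x hx).trans_lt ENNReal.coe_lt_top, hΩ.lintegral_bdist_rpow_lt_top (by linarith)⟩)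

lemma ae_kernelOp_enorm_eq_greenOp (hG : IsGreenFunction Ω s γ G) (hΩ : IsBoundedC11 Ω)
    (hs : 0 < s) (hsn : 2 * s ≤ n) (hγ : 0 ≤ γ) {α : ℝ} (hα : -1 - γ < α) :
    ∀ᵐ x ∂(volume.restrict Ω), 0 ≤ greenOp Ω G (fun y => bdist Ω y ^ α) x ∧
      kernelOp (volume.restrict Ω) (fun x y => ‖G x y‖ₑ)
        (fun y => ENNReal.ofReal (bdist Ω y ^ α)) x =
      ENNReal.ofReal (greenOp Ω G (fun y => bdist Ω y ^ α) x) := by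
  have hδ : Measurable fun y => bdist Ω y ^ α := continuous_bdist.measurable.pow_const α
  filter_upwards [ae_restrict_mem hΩ.isOpen.measurableSet,
    hG.aemeasurable.aestronglyMeasurable.prodMk_left] with x hx hGx
  have hnonneg : 0 ≤ᵐ[volume.restrict Ω] fun y => G x y * bdist Ω y ^ α := by
    filter_upwards [hΩ.ae_mem_and_ne x] with y ⟨hy, hxy⟩
    exact mul_nonneg (hG.nonneg hx hy hxy) (Real.rpow_nonneg bdist_nonneg α)
  have henorm (y) : ‖G x y * bdist Ω y ^ α‖ₑ = ‖G x y‖ₑ * ENNReal.ofReal (bdist Ω y ^ α) := by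
    rw [enorm_mul, Real.enorm_of_nonneg (Real.rpow_nonneg bdist_nonneg α)]
  have hint : Integrable (fun y => G x y * bdist Ω y ^ α) (volume.restrict Ω) := by
    refine ⟨hGx.mul hδ.aestronglyMeasurable, ?_⟩
    simpa only [HasFiniteIntegral, henorm, kernelOp] using
      hG.kernelOp_enorm_bdist_rpow_lt_top hΩ hs hsn hγ hα hx
  refine ⟨integral_nonneg_of_ae hnonneg, ?_⟩
  rw [greenOp, ofReal_integral_eq_lintegral_ofReal hint hnonneg]
  refine lintegral_congr_ae (hnonneg.mono fun y hy => ?_)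
  exact (henorm y).symm.trans (Real.enorm_of_nonneg hy)

lemma exists_kernelOp_potKernel_bdist_rpow_le (hG : IsGreenFunction Ω s γ G) (hΩ : IsBoundedC11 Ω)
    (hs : 0 < s) (hsn : 2 * s ≤ n) (hγ : 0 ≤ γ) :
    ∃ C : ℝ≥0, ∀ α, -1 - γ < α → ∀ᵐ x ∂(volume.restrict Ω),
      kernelOp (volume.restrict Ω) (potKernel Ω s γ 1)
        (fun y => ENNReal.ofReal (bdist Ω y ^ α)) x ≤
      C * ENNReal.ofReal (greenOp Ω G (fun y => bdist Ω y ^ α) x) := by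
  obtain ⟨C, hC⟩ := hG.exists_potKernel_le_enorm hγ
  refine ⟨C, fun α hα => ?_⟩
  filter_upwards [ae_restrict_mem hΩ.isOpen.measurableSet,
    hG.ae_kernelOp_enorm_eq_greenOp hΩ hs hsn hγ hα] with x hx hgreen
  rw [← hgreen.2]
  exact kernelOp_le_of_ae_le ((hΩ.ae_mem_and_ne x).mono fun y hy => hC x hx y hy.1 hy.2) _

end IsGreenFunction

lemma ofReal_integral_abs_mul {X : Type*} [MeasurableSpace X] {μ : Measure X} {f w : X → ℝ}
    (hw : 0 ≤ᵐ[μ] w) (hfw : Integrable (fun x => f x * w x) μ) :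
    ENNReal.ofReal (∫ x, |f x| * w x ∂μ) = ∫⁻ x, ‖f x‖ₑ * ENNReal.ofReal (w x) ∂μ := by
  calc ENNReal.ofReal (∫ x, |f x| * w x ∂μ) = ENNReal.ofReal (∫ x, ‖f x * w x‖ ∂μ) := by
        congr 1
        refine integral_congr_ae (hw.mono fun x hx => ?_)
        simp only [norm_mul, Real.norm_eq_abs, abs_of_nonneg hx]
    _ = ∫⁻ x, ‖f x‖ₑ * ENNReal.ofReal (w x) ∂μ := by
        rw [ofReal_integral_norm_eq_lintegral_enorm hfw]
        refine lintegral_congr_ae (hw.mono fun x hx => ?_)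
        simp only [enorm_mul, Real.enorm_of_nonneg hx]

lemma lintegral_mul_le_of_ae_le_kernelOp {X : Type*} [MeasurableSpace X] {μ : Measure X}
    [SFinite μ] {K : X → X → ℝ≥0∞} {g h u v : X → ℝ≥0∞} {c d : ℝ≥0}
    (hK : Measurable (Function.uncurry K)) (hsymm : ∀ x y, K x y = K y x)
    (hg : AEMeasurable g μ) (hh : AEMeasurable h μ) (hu : ∀ᵐ x ∂μ, u x ≤ c * kernelOp μ K h x)
    (hv : ∀ᵐ x ∂μ, kernelOp μ K g x ≤ d * v x) :
    ∫⁻ x, u x * g x ∂μ ≤ (c * d : ℝ≥0) * ∫⁻ x, h x * v x ∂μ :=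
  calc ∫⁻ x, u x * g x ∂μ ≤ ∫⁻ x, c * (g x * kernelOp μ K h x) ∂μ :=
        lintegral_mono_ae (hu.mono fun x hx => (mul_le_mul_left hx _).trans_eq (by ring))
    _ = c * ∫⁻ x, kernelOp μ K g x * h x ∂μ := by
        rw [lintegral_const_mul' _ _ ENNReal.coe_ne_top, lintegral_mul_kernelOp hK hsymm hh hg]
    _ ≤ c * ∫⁻ x, d * (h x * v x) ∂μ := by
        refine mul_le_mul_right ?_ _
        exact lintegral_mono_ae (hv.mono fun x hx => (mul_le_mul_left hx _).trans_eq (by ring))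
    _ = (c * d : ℝ≥0) * ∫⁻ x, h x * v x ∂μ := by
        rw [lintegral_const_mul' _ _ ENNReal.coe_ne_top, ← mul_assoc, ENNReal.coe_mul]

lemma IsGreenFunction.exists_integral_mul_bdist_rpow_le (hG : IsGreenFunction Ω s γ G)
    (hΩ : IsBoundedC11 Ω) (hs : 0 < s) (hsn : 2 * s ≤ n) (hγ : 0 ≤ γ) (C : ℝ≥0) :
    ∃ D : ℝ≥0, ∀ f u : EuclideanSpace ℝ (Fin n) → ℝ, AEMeasurable f (volume.restrict Ω) →
      AEMeasurable u (volume.restrict Ω) →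
      (∀ᵐ x ∂(volume.restrict Ω),
        ‖u x‖ₑ ≤ C * kernelOp (volume.restrict Ω) (potKernel Ω s γ 1) (fun y => ‖f y‖ₑ) x) →
      ∀ α, -1 - γ < α → MemWeightedL1 Ω (greenOp Ω G fun x => bdist Ω x ^ α) f →
      MemWeightedL1 Ω (fun x => bdist Ω x ^ α) u ∧
        ∫ x in Ω, |u x| * bdist Ω x ^ α ≤
          D * ∫ x in Ω, |f x| * greenOp Ω G (fun y => bdist Ω y ^ α) x := by
  obtain ⟨c, hc⟩ := hG.exists_kernelOp_potKernel_bdist_rpow_le hΩ hs hsn hγ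
  refine ⟨C * c, fun f u hf hu hle α hα hfα => ?_⟩
  have hδ : Measurable fun y => bdist Ω y ^ α := continuous_bdist.measurable.pow_const α
  have hδ0 : 0 ≤ᵐ[volume.restrict Ω] fun y => bdist Ω y ^ α :=
    .of_forall fun y => Real.rpow_nonneg bdist_nonneg α
  have hgreen0 : 0 ≤ᵐ[volume.restrict Ω] greenOp Ω G fun y => bdist Ω y ^ α :=
    (hG.ae_kernelOp_enorm_eq_greenOp hΩ hs hsn hγ hα).mono fun x hx => hx.1
  have key : ∫⁻ x in Ω, ‖u x‖ₑ * ENNReal.ofReal (bdist Ω x ^ α) ≤ ENNReal.ofReal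
      ((C * c : ℝ≥0) * ∫ x in Ω, |f x| * greenOp Ω G (fun y => bdist Ω y ^ α) x) := by
    rw [ENNReal.ofReal_mul NNReal.zero_le_coe, ofReal_integral_abs_mul hgreen0 hfα,
      ENNReal.ofReal_coe_nnreal]
    exact lintegral_mul_le_of_ae_le_kernelOp measurable_potKernel potKernel_comm
      hδ.ennreal_ofReal.aemeasurable hf.enorm hle (hc α hα)
  have huα : MemWeightedL1 Ω (fun x => bdist Ω x ^ α) u := by
    refine ⟨(hu.mul hδ.aemeasurable).aestronglyMeasurable, ?_⟩
    refine lt_of_eq_of_lt ?_ (key.trans_lt ENNReal.ofReal_lt_top)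
    exact lintegral_congr fun x => by
      rw [enorm_mul, Real.enorm_of_nonneg (Real.rpow_nonneg bdist_nonneg α)]
  refine ⟨huα, (ENNReal.ofReal_le_ofReal_iff ?_).1 ((ofReal_integral_abs_mul hδ0 huα).trans_le key)⟩
  exact mul_nonneg (NNReal.coe_nonneg _)
    (integral_nonneg_of_ae (hgreen0.mono fun x hx => mul_nonneg (abs_nonneg _) hx))

lemma memLp_and_eLpNorm_le_of_ae_le {X : Type*} [MeasurableSpace X] {μ : Measure X} {u : X → ℝ}
    {g : X → ℝ≥0∞} {p N : ℝ≥0∞} {C D : ℝ≥0} (hu : AEStronglyMeasurable u μ)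
    (hle : ∀ᵐ x ∂μ, ‖u x‖ₑ ≤ C * g x) (hg : eLpNorm g p μ ≤ D * N) (hN : N ≠ ∞) :
    MemLp u p μ ∧ eLpNorm u p μ ≤ ENNReal.ofReal (C * D : ℝ≥0) * N := by
  have h : eLpNorm u p μ ≤ ENNReal.ofReal (C * D : ℝ≥0) * N :=
    calc eLpNorm u p μ ≤ C • eLpNorm g p μ :=
          eLpNorm_le_nnreal_smul_eLpNorm_of_ae_le_mul' hle p
      _ ≤ C * (D * N) := by
          rw [ENNReal.smul_def, smul_eq_mul]
          gcongr
      _ = ENNReal.ofReal (C * D : ℝ≥0) * N := by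
          rw [ENNReal.ofReal_coe_nnreal, ENNReal.coe_mul, mul_assoc]
  exact ⟨⟨hu, h.trans_lt (ENNReal.mul_lt_top ENNReal.ofReal_lt_top hN.lt_top)⟩, h⟩

end GreenEstimates

section DimensionBound

lemma ae_fst_ne_snd {X : Type*} [MeasurableSpace X] [MeasurableEq X] {μ ν : Measure X} [SFinite ν]
    [NullSingletonClass ν] : ∀ᵐ z ∂μ.prod ν, z.1 ≠ z.2 :=
  (Measure.ae_prod_iff_ae_ae (MeasurableEq.measurableSet_diagonal (α := X)).compl).2 <|
    .of_forall fun x => (Measure.ae_ne ν x).mono fun _ hy => hy.symm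

lemma indicator_sub_mul_le {X : Type*} {A B : Set X} (hAB : Disjoint A B) {σ : X → ℝ}
    (hσ : σ = A.indicator 1 - B.indicator 1) {x y : X} {k κ : ℝ}
    (hle : (x, y) ∈ A ×ˢ A ∪ B ×ˢ B → k ≤ κ / 2) (hge : (x, y) ∈ A ×ˢ B ∪ B ×ˢ A → κ ≤ k) :
    σ x * (k * σ y) ≤
      κ / 2 * (A.indicator 1 x * A.indicator 1 y + B.indicator 1 x * B.indicator 1 y) -
        κ * (A.indicator 1 x * B.indicator 1 y + B.indicator 1 x * A.indicator 1 y) := by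
  have hx : x ∈ A → x ∉ B := fun h => disjoint_left.1 hAB h
  have hy : y ∈ A → y ∉ B := fun h => disjoint_left.1 hAB h
  by_cases hxA : x ∈ A <;> by_cases hxB : x ∈ B <;> by_cases hyA : y ∈ A <;>
    by_cases hyB : y ∈ B <;> simp_all

lemma integral_indicator_sub_mul_le {X : Type*} [MeasurableSpace X] {μ : Measure X} [SFinite μ]
    {A B : Set X} (hA : MeasurableSet A) (hB : MeasurableSet B) (hAB : Disjoint A B)
    (hA_top : μ A ≠ ∞) (hμ : μ A = μ B) {K : X → X → ℝ} {κ : ℝ} {σ : X → ℝ}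
    (hσ : σ = A.indicator 1 - B.indicator 1)
    (hint : Integrable (Function.uncurry fun x y => σ x * (K x y * σ y)) (μ.prod μ))
    (hle : ∀ᵐ z ∂μ.prod μ, z ∈ A ×ˢ A ∪ B ×ˢ B → K z.1 z.2 ≤ κ / 2)
    (hge : ∀ᵐ z ∂μ.prod μ, z ∈ A ×ˢ B ∪ B ×ˢ A → κ ≤ K z.1 z.2) :
    ∫ x, σ x * ∫ y, K x y * σ y ∂μ ∂μ ≤ -(κ * μ.real A ^ 2) := by
  set a : X → ℝ := A.indicator 1
  set b : X → ℝ := B.indicator 1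
  have ha : Integrable a μ := (integrable_indicator_iff hA).2 (integrableOn_const hA_top)
  have hb : Integrable b μ := (integrable_indicator_iff hB).2 (integrableOn_const (hμ ▸ hA_top))
  have hInt_a : ∫ x, a x ∂μ = μ.real A := integral_indicator_one hA
  have hInt_b : ∫ x, b x ∂μ = μ.real A := by
    rw [integral_indicator_one hB, measureReal_def, measureReal_def, hμ]
  have hdiag : Integrable (fun z : X × X => a z.1 * a z.2 + b z.1 * b z.2) (μ.prod μ) :=
    (ha.mul_prod ha).add (hb.mul_prod hb)
  have hoff : Integrable (fun z : X × X => a z.1 * b z.2 + b z.1 * a z.2) (μ.prod μ) :=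
    (ha.mul_prod hb).add (hb.mul_prod ha)
  calc ∫ x, σ x * ∫ y, K x y * σ y ∂μ ∂μ
      = ∫ z, Function.uncurry (fun x y => σ x * (K x y * σ y)) z ∂μ.prod μ := by
        rw [integral_prod _ hint]
        simp only [Function.uncurry_apply_pair, integral_const_mul]
    _ ≤ ∫ z, (κ / 2 * (a z.1 * a z.2 + b z.1 * b z.2) -
          κ * (a z.1 * b z.2 + b z.1 * a z.2)) ∂μ.prod μ := by
        refine integral_mono_ae hint ((hdiag.const_mul _).sub (hoff.const_mul _)) ?_
        filter_upwards [hle, hge] with z hz_le hz_ge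
        exact indicator_sub_mul_le hAB hσ hz_le hz_ge
    _ = -(κ * μ.real A ^ 2) := by
        rw [integral_sub (hdiag.const_mul _) (hoff.const_mul _), integral_const_mul,
          integral_const_mul, integral_add (ha.mul_prod ha) (hb.mul_prod hb),
          integral_add (ha.mul_prod hb) (hb.mul_prod ha)]
        simp only [integral_prod_mul, hInt_a, hInt_b]
        ring

variable {n : ℕ} {Ω : Set (EuclideanSpace ℝ (Fin n))} {s γ : ℝ}
  {G : EuclideanSpace ℝ (Fin n) → EuclideanSpace ℝ (Fin n) → ℝ}
  {a b : EuclideanSpace ℝ (Fin n)}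

namespace IsGreenFunction

lemma exists_pos_forall_le_of_norm_lt (hG : IsGreenFunction Ω s γ G) (hn : n < 2 * s) {κ : ℝ}
    (hκ : 0 < κ) :
    ∃ η : ℝ, 0 < η ∧ ∀ x ∈ Ω, ∀ y ∈ Ω, x ≠ y → ‖x - y‖ < η → G x y ≤ κ := by
  obtain ⟨c, hc, hcG⟩ := hG.comparable
  have hcont : ContinuousAt (fun t : ℝ => c * t ^ (2 * s - n)) 0 :=
    (Real.continuousAt_rpow_const 0 _ (.inr (by linarith))).const_mul c
  have hzero : c * (0 : ℝ) ^ (2 * s - n) < κ := by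
    rwa [Real.zero_rpow (by linarith), mul_zero]
  obtain ⟨η, hη, hηκ⟩ := Metric.eventually_nhds_iff.1 (hcont.eventually_lt_const hzero)
  refine ⟨η, hη, fun x hx y hy hne hxy => ?_⟩
  calc G x y ≤ c * modelKernel Ω s γ x y := (hcG x hx y hy hne).2
    _ ≤ c * ‖x - y‖ ^ (2 * s - n) := by gcongr; exact modelKernel_le_norm_rpow x y
    _ ≤ κ := (hηκ (by rwa [dist_zero_right, norm_norm])).le

variable [NeZero n]

lemma _root_.IsBoundedC11.modelKernel_pos (hΩ : IsBoundedC11 Ω) (ha : a ∈ Ω) (hb : b ∈ Ω)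
    (hab : a ≠ b) : 0 < modelKernel Ω s γ a b := by
  have hnorm : 0 < ‖a - b‖ := norm_sub_pos_iff.2 hab
  have hδa := hΩ.bdist_pos ha
  have hδb := hΩ.bdist_pos hb
  rw [modelKernel]
  positivity

lemma _root_.IsBoundedC11.continuousAt_modelKernel (hΩ : IsBoundedC11 Ω) (ha : a ∈ Ω) (hb : b ∈ Ω)
    (hab : a ≠ b) : ContinuousAt (Function.uncurry (modelKernel Ω s γ)) (a, b) := by
  have hnorm : ContinuousAt (fun z : EuclideanSpace ℝ (Fin n) × EuclideanSpace ℝ (Fin n) =>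
      ‖z.1 - z.2‖) (a, b) := by fun_prop
  have hne : ‖a - b‖ ≠ 0 := norm_sub_eq_zero_iff.not.2 hab
  have hden : ‖a - b‖ ^ γ ≠ 0 := (Real.rpow_pos_of_pos (norm_sub_pos_iff.2 hab) γ).ne'
  have hfst : ContinuousAt (fun z : EuclideanSpace ℝ (Fin n) × EuclideanSpace ℝ (Fin n) =>
      bdist Ω z.1 ^ γ) (a, b) :=
    (continuous_bdist.comp continuous_fst).continuousAt.rpow_const (.inl (hΩ.bdist_pos ha).ne')
  have hsnd : ContinuousAt (fun z : EuclideanSpace ℝ (Fin n) × EuclideanSpace ℝ (Fin n) =>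
      bdist Ω z.2 ^ γ) (a, b) :=
    (continuous_bdist.comp continuous_snd).continuousAt.rpow_const (.inl (hΩ.bdist_pos hb).ne')
  have hγ := hnorm.rpow_const (p := γ) (.inl hne)
  exact ((continuousAt_const.div (hnorm.rpow_const (.inl hne)) (by positivity)).mul
    ((hfst.div hγ hden).min continuousAt_const)).mul ((hsnd.div hγ hden).min continuousAt_const)

lemma exists_pos_eventually_le (hG : IsGreenFunction Ω s γ G) (hΩ : IsBoundedC11 Ω) (ha : a ∈ Ω)
    (hb : b ∈ Ω) (hab : a ≠ b) :
    ∃ κ : ℝ, 0 < κ ∧ ∀ᶠ z in 𝓝 (a, b), (z.1 ∈ Ω ∧ z.2 ∈ Ω ∧ z.1 ≠ z.2) ∧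
      κ ≤ G z.1 z.2 := by
  obtain ⟨c, hc, hcG⟩ := hG.comparable
  have hpos : 0 < modelKernel Ω s γ a b := hΩ.modelKernel_pos ha hb hab
  refine ⟨c⁻¹ * (modelKernel Ω s γ a b / 2), by positivity, ?_⟩
  filter_upwards [prod_mem_nhds (hΩ.isOpen.mem_nhds ha) (hΩ.isOpen.mem_nhds hb),
    (isOpen_ne_fun continuous_fst continuous_snd).mem_nhds hab,
    (hΩ.continuousAt_modelKernel ha hb hab).eventually_const_lt (half_lt_self hpos)]
    with z ⟨hz1, hz2⟩ hne hz
  refine ⟨⟨hz1, hz2, hne⟩, le_trans ?_ (hcG _ hz1 _ hz2 hne).1⟩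
  gcongr
  exact hz.le

lemma exists_balls (hG : IsGreenFunction Ω s γ G) (hΩ : IsBoundedC11 Ω) (hn : n < 2 * s) :
    ∃ (a b : EuclideanSpace ℝ (Fin n)) (ε κ : ℝ), 0 < ε ∧ 0 < κ ∧
      (∀ x ∈ Metric.ball a ε, ∀ y ∈ Metric.ball b ε,
        (x ∈ Ω ∧ y ∈ Ω ∧ x ≠ y) ∧ κ ≤ G x y ∧ κ ≤ G y x) ∧
      ∀ x ∈ Ω, ∀ y ∈ Ω, x ≠ y → ‖x - y‖ < 2 * ε → G x y ≤ κ / 2 := by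
  obtain ⟨a, ha⟩ := hΩ.nonempty
  obtain ⟨b, hb, hba⟩ := (infinite_of_mem_nhds a (hΩ.isOpen.mem_nhds ha)).nontrivial.exists_ne a
  obtain ⟨κ, hκ, hfar⟩ := hG.exists_pos_eventually_le hΩ ha hb hba.symm
  obtain ⟨η, hη, hnear⟩ := hG.exists_pos_forall_le_of_norm_lt hn (half_pos hκ)
  obtain ⟨ε, hε, hfar⟩ := Metric.eventually_nhds_iff_ball.1 hfar
  refine ⟨a, b, min ε (η / 2), κ, by positivity, hκ, fun x hx y hy => ?_,
    fun x hx y hy hxy h => hnear x hx y hy hxy (by linarith [min_le_right ε (η / 2)])⟩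
  obtain ⟨⟨hxΩ, hyΩ, hxy⟩, hκG⟩ := hfar (x, y) (ball_prod_same a b ε ▸
    mk_mem_prod (Metric.ball_subset_ball (min_le_left _ _) hx)
      (Metric.ball_subset_ball (min_le_left _ _) hy))
  exact ⟨⟨hxΩ, hyΩ, hxy⟩, hκG, hG.symm x hxΩ y hyΩ hxy ▸ hκG⟩

lemma integral_mul_greenOp_self_nonneg {ev : ℕ → ℝ} {φ : HilbertBasis ℕ ℝ (L2 Ω)}
    (hG : IsGreenFunction Ω s γ G) (hΩ : IsBoundedC11 Ω) (hs : 0 < s)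
    (hφ : IsEigenbasis Ω G ev φ) {f : EuclideanSpace ℝ (Fin n) → ℝ}
    (hf : MemLp f 2 (volume.restrict Ω)) : 0 ≤ ∫ x in Ω, f x * greenOp Ω G f x := by
  set ψ : L2 Ω := hf.toLp f
  have hψ : ψ =ᵐ[volume.restrict Ω] f := hf.coeFn_toLp
  have hinner : ∫ x in Ω, f x * greenOp Ω G f x = inner ℝ ψ (multiplierOp φ ev⁻¹ ψ) := by
    rw [L2.inner_def]
    refine integral_congr_ae ?_
    filter_upwards [hψ, hG.multiplierOp_inv_ae_eq_greenOp hΩ hs hφ ψ] with x hx hTx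
    have hgreen : greenOp Ω G f x = greenOp Ω G ψ x :=
      integral_congr_ae (hψ.mono fun y hy => congrArg (G x y * ·) hy.symm)
    rw [hTx, hx, hgreen, RCLike.inner_apply, conj_trivial, mul_comm]
  rw [hinner]
  refine (φ.hasSum_inner_mul_inner ψ _).nonneg fun j => ?_
  rw [inner_multiplierOp φ (norm_inv_le hφ.pos hφ.mono), real_inner_comm, mul_left_comm]
  exact mul_nonneg (inv_nonneg.2 (hφ.pos j).le) (mul_self_nonneg _)

-- For `n < 2 * s` the kernel would vanish on the diagonal while staying positive off it, so that
-- its quadratic form is negative at the difference of the indicators of two small balls.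
theorem two_mul_le {ev : ℕ → ℝ} {φ : HilbertBasis ℕ ℝ (L2 Ω)} (hG : IsGreenFunction Ω s γ G)
    (hΩ : IsBoundedC11 Ω) (hs : 0 < s) (hφ : IsEigenbasis Ω G ev φ) : 2 * s ≤ n := by
  by_contra! hn
  obtain ⟨a, b, ε, κ, hε, hκ, hfar, hnear⟩ := hG.exists_balls hΩ hn
  set A := Metric.ball a ε
  set B := Metric.ball b ε
  set σ : EuclideanSpace ℝ (Fin n) → ℝ := A.indicator 1 - B.indicator 1
  have hAΩ : A ⊆ Ω := fun x hx => (hfar x hx b (Metric.mem_ball_self hε)).1.1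
  have hBΩ : B ⊆ Ω := fun y hy => (hfar a (Metric.mem_ball_self hε) y hy).1.2.1
  have hAB : Disjoint A B := disjoint_left.2 fun x hxA hxB => (hfar x hxA x hxB).1.2.2 rfl
  have hvolA : volume.restrict Ω A = volume A := Measure.restrict_eq_self _ hAΩ
  have hvolB : volume.restrict Ω B = volume A := (Measure.restrict_eq_self _ hBΩ).trans
    ((Measure.addHaar_ball_center volume b ε).trans (Measure.addHaar_ball_center volume a ε).symm)
  have hA_top : volume A ≠ ∞ := measure_ball_lt_top.ne
  have hσ : MemLp σ 2 (volume.restrict Ω) :=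
    (memLp_indicator_const 2 Metric.isOpen_ball.measurableSet 1 (.inr (hvolA ▸ hA_top))).sub
      (memLp_indicator_const 2 Metric.isOpen_ball.measurableSet 1 (.inr (hvolB ▸ hA_top)))
  have hV : 0 < (volume.restrict Ω).real A :=
    ENNReal.toReal_pos (hvolA ▸ (Metric.measure_ball_pos volume a hε).ne') (hvolA ▸ hA_top)
  have hdiam (c : EuclideanSpace ℝ (Fin n)) :
      ∀ x ∈ Metric.ball c ε, ∀ y ∈ Metric.ball c ε, ‖x - y‖ < 2 * ε := fun x hx y hy => by
    rw [← dist_eq_norm, two_mul]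
    exact (dist_triangle_right x y c).trans_lt (add_lt_add hx hy)
  refine (hG.integral_mul_greenOp_self_nonneg hΩ hs hφ hσ).not_gt <|
    (integral_indicator_sub_mul_le (κ := κ) Metric.isOpen_ball.measurableSet
      Metric.isOpen_ball.measurableSet hAB (hvolA ▸ hA_top) (hvolA.trans hvolB.symm) rfl
      (hG.integrable_mul_mul hΩ hs hσ hσ) ?_ ?_).trans_lt (neg_neg_of_pos (by positivity))
  · filter_upwards [ae_fst_ne_snd] with z hz
    rintro (⟨hx, hy⟩ | ⟨hx, hy⟩)
    exacts [hnear _ (hAΩ hx) _ (hAΩ hy) hz (hdiam a _ hx _ hy),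
      hnear _ (hBΩ hx) _ (hBΩ hy) hz (hdiam b _ hx _ hy)]
  · refine .of_forall ?_
    rintro ⟨x, y⟩ (⟨hx, hy⟩ | ⟨hx, hy⟩)
    exacts [(hfar x hx y hy).2.1, (hfar y hy x hx).2.2]

end IsGreenFunction

end DimensionBound

section WeakSolution

variable {n : ℕ} {Ω : Set (EuclideanSpace ℝ (Fin n))} {s γ : ℝ}
  {G : EuclideanSpace ℝ (Fin n) → EuclideanSpace ℝ (Fin n) → ℝ}
  {ev : ℕ → ℝ} {φ : HilbertBasis ℕ ℝ (L2 Ω)} {lam : ℝ} {I : ℕ}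
  {f u : EuclideanSpace ℝ (Fin n) → ℝ}

lemma eq_of_lt_succ_of_apply_succ_eq {α : Type*} [Preorder α] {v : ℕ → α} (hv : Monotone v)
    {i j : ℕ} (hi : v i < v (i + 1)) (hj : v j < v (j + 1)) (hij : v (i + 1) = v (j + 1)) :
    i = j :=
  le_antisymm (Nat.lt_succ_iff.1 (hv.reflect_lt (hij ▸ hi)))
    (Nat.lt_succ_iff.1 (hv.reflect_lt (hij ▸ hj)))

lemma helmholtzOp_eq_multiplierOp :
    helmholtzOp ev φ lam = multiplierOp φ fun j => (ev j - lam)⁻¹ := by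
  funext ψ
  simp only [helmholtzOp, multiplierOp, div_eq_inv_mul]

variable [NeZero n]

lemma MemWeightedL1.aemeasurable (hu : MemWeightedL1 Ω (fun x => bdist Ω x ^ γ) u)
    (hΩ : IsBoundedC11 Ω) : AEMeasurable u (volume.restrict Ω) :=
  aemeasurable_of_integrable_mul
    (ae_restrict_of_forall_mem hΩ.isOpen.measurableSet fun _ hx =>
      Real.rpow_pos_of_pos (hΩ.bdist_pos hx) γ)
    (continuous_bdist.measurable.pow_const γ).aemeasurable hu

namespace IsGreenFunction

lemma memPerp_of_isWeakSolution (hG : IsGreenFunction Ω s γ G) (hΩ : IsBoundedC11 Ω) (hs : 0 < s)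
    (hsn : 2 * s ≤ n) (hγ : 0 ≤ γ) (hφ : IsEigenbasis Ω G ev φ) (hI : IsCutIndex ev lam I)
    (hf : MemPerp Ω γ φ I f) (hu : IsWeakSolution Ω γ ev φ lam f u) : MemPerp Ω γ φ I u :=
  ⟨hu.2.1, fun j hj => (hG.isKernelSmoothing hΩ hs hsn hγ hφ).integral_mul_basis_eq_zero hφ.pos
    hφ.mono hI.1.2 hI.1.1 (helmholtzOp_eq_multiplierOp (φ := φ) ▸ hu.2.2) (hf.2 j hj)⟩

lemma exists_ae_enorm_le_kernelOp_potKernel (hG : IsGreenFunction Ω s γ G) (hΩ : IsBoundedC11 Ω)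
    (hs : 0 < s) (hsn : 2 * s ≤ n) (hγ : 0 ≤ γ) (hφ : IsEigenbasis Ω G ev φ) (lamBar m : ℝ) :
    ∃ C : ℝ≥0, ∀ (lam : ℝ) (I : ℕ), lam ∉ range ev → -m ≤ lam → IsCutIndex ev lam I →
      ev (I + 1) = lamBar → ∀ f u : EuclideanSpace ℝ (Fin n) → ℝ,
      MemPerp Ω γ φ I f → IsWeakSolution Ω γ ev φ lam f u → ∀ᵐ x ∂(volume.restrict Ω),
        ‖u x‖ₑ ≤ C * kernelOp (volume.restrict Ω) (potKernel Ω s γ 1) (fun y => ‖f y‖ₑ) x := by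
  by_cases hbar : ∃ I, ev I < ev (I + 1) ∧ ev (I + 1) = lamBar
  · obtain ⟨I, hgap, rfl⟩ := hbar
    obtain ⟨C, hC⟩ := (hG.isKernelSmoothing hΩ hs hsn hγ hφ).exists_ae_enorm_le_kernelOp
      measurable_potKernel potKernel_comm hφ.pos hφ.mono hgap m
    refine ⟨C, fun lam J hlam hm hJ hJI f u hf hu => ?_⟩
    obtain rfl : J = I := eq_of_lt_succ_of_apply_succ_eq hφ.mono hJ.1.2 hgap hJI
    exact hC lam hlam hm hJ.1.1 f u hf.1 hf.2 hu.2.1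
      (helmholtzOp_eq_multiplierOp (φ := φ) ▸ hu.2.2)
  · exact ⟨0, fun _ I _ _ hI hIbar => absurd ⟨I, hI.1.2, hIbar⟩ hbar⟩

end IsGreenFunction

end WeakSolution

theorem mainTheorem3_general (n : ℕ) (hn : 1 ≤ n) (s γ : ℝ) (hs : 0 < s) (hγ : 0 ≤ γ)
    (hns : (n : ℝ) ≠ 2 * s)
    (Ω : Set (EuclideanSpace ℝ (Fin n))) (hΩ : IsBoundedC11 Ω)
    (G : EuclideanSpace ℝ (Fin n) → EuclideanSpace ℝ (Fin n) → ℝ)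
    (hG : IsGreenFunction Ω s γ G)
    (ev : ℕ → ℝ) (φ : HilbertBasis ℕ ℝ (L2 Ω)) (hφ : IsEigenbasis Ω G ev φ)
    (lamBar m : ℝ) :
    ∃ (C₀ : ℝ) (C₁ C₂ C₃ : ℝ → ℝ),
      ∀ (lam : ℝ) (I : ℕ), lam ∉ range ev → -m ≤ lam → IsCutIndex ev lam I →
        ev (I + 1) = lamBar →
      ∀ f u : EuclideanSpace ℝ (Fin n) → ℝ,
        MemPerp Ω γ φ I f → IsWeakSolution Ω γ ev φ lam f u →
        MemPerp Ω γ φ I u ∧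
        (∀ α : ℝ, -1 - γ < α →
          MemWeightedL1 Ω (greenOp Ω G fun x => bdist Ω x ^ α) f →
          MemWeightedL1 Ω (fun x => bdist Ω x ^ α) u ∧
          ∫ x in Ω, |u x| * bdist Ω x ^ α ≤
            C₀ * ∫ x in Ω, |f x| * greenOp Ω G (fun y => bdist Ω y ^ α) x) ∧
        (∀ p : ℝ, 1 ≤ p → p < n / (n - 2 * s) →
          MemLp f 1 (volume.restrict Ω) →
          MemLp u (ENNReal.ofReal p) (volume.restrict Ω) ∧
          eLpNorm u (ENNReal.ofReal p) (volume.restrict Ω) ≤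
            ENNReal.ofReal (C₁ p) * eLpNorm f 1 (volume.restrict Ω)) ∧
        (∀ p₀ p₁ : ℝ, 1 < p₀ → p₀ < n / (2 * s) → 1 / p₁ = 1 / p₀ - 2 * s / n →
          MemLp f (ENNReal.ofReal p₀) (volume.restrict Ω) →
          MemLp u (ENNReal.ofReal p₁) (volume.restrict Ω) ∧
          eLpNorm u (ENNReal.ofReal p₁) (volume.restrict Ω) ≤
            ENNReal.ofReal (C₂ p₀) * eLpNorm f (ENNReal.ofReal p₀) (volume.restrict Ω)) ∧
        (γ < 2 * s → ∀ p : ℝ, 1 ≤ p → p < n / (n - 2 * s + γ) →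
          MemLp u (ENNReal.ofReal p) (volume.restrict Ω) ∧
          eLpNorm u (ENNReal.ofReal p) (volume.restrict Ω) ≤
            ENNReal.ofReal (C₃ p * ∫ x in Ω, |f x| * bdist Ω x ^ γ)) := by
  have : NeZero n := ⟨by omega⟩
  have hsn : 2 * s < n := (hG.two_mul_le hΩ hs hφ).lt_of_ne hns.symm
  obtain ⟨C, hC⟩ := hG.exists_ae_enorm_le_kernelOp_potKernel hΩ hs hsn.le hγ hφ lamBar m
  obtain ⟨D₀, hD₀⟩ := hG.exists_integral_mul_bdist_rpow_le hΩ hs hsn.le hγ C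
  choose! D₁ hD₁ using fun p (hp : 1 ≤ p) (hpn : p < n / (n - 2 * s)) =>
    exists_eLpNorm_kernelOp_potKernel_le_lintegral hΩ hγ hsn hp hpn
  choose! D₂ hD₂ using fun p (hp : 1 < p) (hpn : p < n / (2 * s)) =>
    exists_eLpNorm_kernelOp_potKernel_le_eLpNorm hΩ.isOpen.measurableSet hγ hs hp hpn
  choose! D₃ hD₃ using fun p (hp : 1 ≤ p) (hpn : p < n / (n - 2 * s + γ)) =>
    exists_eLpNorm_kernelOp_potKernel_le_lintegral_mul hΩ hγ hsn hp hpn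
  refine ⟨D₀, fun p => C * D₁ p, fun p => C * D₂ p, fun p => C * D₃ p,
    fun lam I hlam hm hI hbar f u hf hu => ?_⟩
  have hle := hC lam I hlam hm hI hbar f u hf hu
  have hfm := hf.1.aemeasurable hΩ
  have hum := hu.2.1.aemeasurable hΩ
  refine ⟨hG.memPerp_of_isWeakSolution hΩ hs hsn.le hγ hφ hI hf hu, hD₀ f u hfm hum hle,
    fun p hp hpn hf1 => ?_, fun p q hp hpn hpq hfp => ?_, fun _ p hp hpn => ?_⟩
  · refine memLp_and_eLpNorm_le_of_ae_le hum.aestronglyMeasurable hle ?_ hf1.2.ne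
    exact (hD₁ p hp hpn _ hfm.enorm).trans_eq (by rw [eLpNorm_one_eq_lintegral_enorm])
  · refine memLp_and_eLpNorm_le_of_ae_le hum.aestronglyMeasurable hle ?_ hfp.2.ne
    exact (hD₂ p hp hpn q hpq _ hfm.enorm).trans_eq (by rw [eLpNorm_enorm])
  · rw [ENNReal.ofReal_mul (by positivity)]
    refine memLp_and_eLpNorm_le_of_ae_le hum.aestronglyMeasurable hle ?_ ENNReal.ofReal_ne_top
    refine (hD₃ p hp hpn _ hfm.enorm).trans_eq (congrArg _ ?_)
    exact (ofReal_integral_abs_mul (.of_forall fun x => Real.rpow_nonneg bdist_nonneg γ) hf.1).symm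

theorem mainTheorem3 (n : ℕ) (hn : 1 ≤ n) (s γ : ℝ) (hs : s ∈ Ioo (0 : ℝ) 1)
    (hγ : γ ∈ Ioc (0 : ℝ) 1) (hns : (n : ℝ) ≠ 2 * s)
    (Ω : Set (EuclideanSpace ℝ (Fin n))) (hΩ : IsBoundedC11 Ω)
    (G : EuclideanSpace ℝ (Fin n) → EuclideanSpace ℝ (Fin n) → ℝ)
    (hG : IsGreenFunction Ω s γ G)
    (ev : ℕ → ℝ) (φ : HilbertBasis ℕ ℝ (L2 Ω)) (hφ : IsEigenbasis Ω G ev φ)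
    (lamBar m : ℝ) :
    ∃ (C₀ : ℝ) (C₁ C₂ C₃ : ℝ → ℝ),
      ∀ (lam : ℝ) (I : ℕ), lam ∉ range ev → -m ≤ lam → IsCutIndex ev lam I →
        ev (I + 1) = lamBar →
      ∀ f u : EuclideanSpace ℝ (Fin n) → ℝ,
        MemPerp Ω γ φ I f → IsWeakSolution Ω γ ev φ lam f u →
        MemPerp Ω γ φ I u ∧
        (∀ α : ℝ, -1 - γ < α →
          MemWeightedL1 Ω (greenOp Ω G fun x => bdist Ω x ^ α) f →
          MemWeightedL1 Ω (fun x => bdist Ω x ^ α) u ∧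
          ∫ x in Ω, |u x| * bdist Ω x ^ α ≤
            C₀ * ∫ x in Ω, |f x| * greenOp Ω G (fun y => bdist Ω y ^ α) x) ∧
        (∀ p : ℝ, 1 ≤ p → p < n / (n - 2 * s) →
          MemLp f 1 (volume.restrict Ω) →
          MemLp u (ENNReal.ofReal p) (volume.restrict Ω) ∧
          eLpNorm u (ENNReal.ofReal p) (volume.restrict Ω) ≤
            ENNReal.ofReal (C₁ p) * eLpNorm f 1 (volume.restrict Ω)) ∧
        (∀ p₀ p₁ : ℝ, 1 < p₀ → p₀ < n / (2 * s) → 1 / p₁ = 1 / p₀ - 2 * s / n →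
          MemLp f (ENNReal.ofReal p₀) (volume.restrict Ω) →
          MemLp u (ENNReal.ofReal p₁) (volume.restrict Ω) ∧
          eLpNorm u (ENNReal.ofReal p₁) (volume.restrict Ω) ≤
            ENNReal.ofReal (C₂ p₀) * eLpNorm f (ENNReal.ofReal p₀) (volume.restrict Ω)) ∧
        (γ < 2 * s → ∀ p : ℝ, 1 ≤ p → p < n / (n - 2 * s + γ) →
          MemLp u (ENNReal.ofReal p) (volume.restrict Ω) ∧
          eLpNorm u (ENNReal.ofReal p) (volume.restrict Ω) ≤
            ENNReal.ofReal (C₃ p * ∫ x in Ω, |f x| * bdist Ω x ^ γ)) :=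
  mainTheorem3_general n hn s γ hs.1 hγ.1.le hns Ω hΩ G hG ev φ hφ lamBar m
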